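/- **Setting.** All systems are finite-dimensional with a particle number operator with eigenvalues in $\{0,1,2,\dots\}$; particle numbers add under tensor products. Let $\phi$ be a bipartite pure state of $A$ and $B$ obeying the superselection rule (SSR), i.e. a unit vector that is an eigenvector of $\hat N_A\otimes 1+1\otimes\hat N_B$, with eigenvalue $I$. Let $E(\phi)=-\operatorname{tr}\rho_A\log_2\rho_A$, $\rho_A=\operatorname{tr}_B|\phi\rangle\langle\phi|$, be its entropy of entanglement and $V(\phi)=4\left[\langle\phi|\hat N_A^2|\phi\rangle-\langle\phi|\hat N_A|\phi\rangle^2\right]$ its superselection induced variance (SiV). SSR-LOCC protocols consist of finitely many rounds of local measurements with classical communication, where each Kraus operator changes the local particle number by a definite integer. For two sequences of states write $\psi_N\leadsto\chi_N$ if there are SSR-LOCC protocols $\Lambda_N$ with $\langle\chi_N|\Lambda_N(|\psi_N\rangle\langle\psi_N|)|\chi_N\rangle\to1$ as $N\to\infty$. Let $|\hat0\rangle=|01\rangle$, $|\hat1\rangle=|10\rangle$, $|\text{E-EPR}\rangle=\frac1{\sqrt2}(|\hat0\rangle_A|\hat1\rangle_B+|\hat1\rangle_A|\hat0\rangle_B)$,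 $|\text{V-EPR}\rangle=\frac1{\sqrt2}(|0\rangle_A|1\rangle_B+|1\rangle_A|0\rangle_B)$, and let $|\hat0\hat0\rangle=|\hat0\rangle_A|\hat0\rangle_B$. Let $|n\rangle$ denote a state with $n$ particles. **Theorem.** 1. There are coefficients $c^{(N)}_n\ge0$ ($0\le n\le IN$, $\sum_n (c_n^{(N)})^2=1$) and integers $m_N,m_N'\ge 0$ with $m_N/N\to E(\phi)$ and $m'_N/N\to E(\phi)$ such that $$\phi^{\otimes N}\otimes|\hat0\hat0\rangle^{\otimes m_N}\leadsto\sum_n c^{(N)}_n|n\rangle_A|IN-n\rangle_B\otimes|\text{E-EPR}\rangle^{\otimes m_N},$$ $$\sum_n c^{(N)}_n|n\rangle_A|IN-n\rangle_B\otimes|\text{E-EPR}\rangle^{\otimes m_N'}\leadsto\phi^{\otimes N}\otimes|\hat0\hat0\rangle^{\otimes m_N'}.$$ The state $\sum_n c^{(N)}_n|n\rangle|IN-n\rangle$ has SiV exactly $N\,V(\phi)$, and its distribution of $n$ is asymptotically Gaussian: for all $x\in\mathbb R$, $\sum_{n\le N\langle\phi|\hat N_A|\phi\rangle+x\sqrt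 N}(c^{(N)}_n)^2$ tends to the value at $x$ of the distribution function of the normal law $\mathcal N(0,V(\phi)/4)$ (a point mass at $0$ if $V(\phi)=0$). 2. Let $G_N=\sum_{n=0}^N g_n|n\rangle_A|N-n\rangle_B$ be the normalized state with $g_n\ge0$ and $g_n^2\propto\exp\left(-\frac{(n-\lfloor N/2\rfloor)^2}{2\sigma^2}\right)$, $\sigma^2=N\,V(\phi)/4$ (and $g_n=\delta_{n,\lfloor N/2\rfloor}$ if $\sigma^2=0$); it depends on $\phi$ only through $V(\phi)$. Then the SiV of $G_N$ divided by $N$ tends to $V(\phi)$, and there are integers $m_N,m_N',k_N\ge0$ with $m_N/N\to E(\phi)$, $m_N'/N\to E(\phi)$, $k_N/N\to0$ such that $$\phi^{\otimes N}\otimes|\text{V-EPR}\rangle^{\otimes k_N}\otimes|\hat0\hat0\rangle^{\otimes m_N}\leadsto G_N\otimes|\text{V-EPR}\rangle^{\otimes k_N}\otimes|\text{E-EPR}\rangle^{\otimes m_N},$$ $$G_N\otimes|\text{E-EPR}\rangle^{\otimes m'_N}\leadsto\phi^{\otimes N}\otimes|\hat0\hat0\rangle^{\otimes m'_N}.$$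 Here one can take $k_N=0$ for all $N$ unless $\phi$ has a periodic gap, i.e. unless at least two values of Alice's particle number occur in $\phi$ and all values that occur are congruent modulo some $d\ge2$. 3. If $\psi$ is another SSR-obeying bipartite pure state, of any finite-dimensional local systems and any total particle number, with $E(\psi)=E(\phi)$ and $V(\psi)=V(\phi)$, then there are integers $k_N,l_N\ge0$ with $k_N/N\to0$ and $l_N/N\to0$ such that $$\phi^{\otimes N}\otimes|\text{V-EPR}\rangle^{\otimes k_N}\otimes|\text{E-EPR}\rangle^{\otimes l_N}\leadsto\psi^{\otimes N}\otimes|\text{V-EPR}\rangle^{\otimes k_N}\otimes|\hat0\hat0\rangle^{\otimes l_N},$$ and the same holds with $\phi$ and $\psi$ interchanged. -/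

import Mathlib

open scoped Matrix Kronecker Topology

noncomputable section

namespace SSR

/-- A finite-dimensional quantum system with a particle number operator, given by an orthonormal
basis (indexed by `ι`) of eigenvectors; `num i` is the particle number of the basis vector `i`.
Several basis vectors may have the same particle number. -/
structure LocalSystem : Type 1 where
  ι : Type
  [fintype : Fintype ι]
  [decEq : DecidableEq ι]
  num : ι → ℕ

attribute [instance] LocalSystem.fintype LocalSystem.decEq

namespace LocalSystem

/-- The tensor product of two systems; particle numbers add. -/
abbrev tensor (A B : LocalSystem) : LocalSystem where
  ι := A.ι × B.ι
  num p := A.num p.1 + B.num p.2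

/-- `N` copies of a system; particle numbers add. -/
abbrev pow (A : LocalSystem) (N : ℕ) : LocalSystem where
  ι := Fin N → A.ι
  num f := ∑ i, A.num (f i)

/-- A register with one basis vector `|n⟩` of particle number `n` for each `0 ≤ n ≤ K`. -/
abbrev register (K : ℕ) : LocalSystem where
  ι := Fin (K + 1)
  num n := n

/-- A single mode that carries zero or one particle. -/
abbrev mode : LocalSystem := register 1

/-- A pair of modes, which carries the hat basis. -/
abbrev twoModes : LocalSystem := mode.tensor mode

end LocalSystem

open LocalSystem

/-- Vectors of the bipartite space `H_A ⊗ H_B`. -/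
abbrev BiVec (A B : LocalSystem) : Type := A.ι × B.ι → ℂ

/-- A bipartite pure state that obeys the superselection rule with total particle number `I`:
a unit vector in the eigenspace of `N_A ⊗ 1 + 1 ⊗ N_B` for the eigenvalue `I`. -/
structure IsPureState {A B : LocalSystem} (φ : BiVec A B) (I : ℕ) : Prop where
  norm_eq : ∑ p, ‖φ p‖ ^ 2 = 1
  total : ∀ a b, φ (a, b) ≠ 0 → A.num a + B.num b = I

/-- The tensor product of two bipartite vectors, as a vector shared by `A C` and `B D`. -/
def tensorVec {A B C D : LocalSystem} (φ : BiVec A B) (χ : BiVec C D) :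
    BiVec (A.tensor C) (B.tensor D) :=
  fun p => φ (p.1.1, p.2.1) * χ (p.1.2, p.2.2)

/-- `N` copies of a bipartite vector. -/
def powVec {A B : LocalSystem} (φ : BiVec A B) (N : ℕ) : BiVec (A.pow N) (B.pow N) :=
  fun p => ∏ i, φ (p.1 i, p.2 i)

/-! ### Entropy of entanglement and superselection induced variance -/

/-- The reduced density matrix `tr_B |φ⟩⟨φ|`. -/
def reducedA {A B : LocalSystem} (φ : BiVec A B) : Matrix A.ι A.ι ℂ :=
  Matrix.of fun a a' => ∑ b, φ (a, b) * star (φ (a', b))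

theorem reducedA_isHermitian {A B : LocalSystem} (φ : BiVec A B) :
    (reducedA φ).IsHermitian := by
  ext a a'
  simp [reducedA, Matrix.conjTranspose_apply, mul_comm]

/-- The entropy of entanglement: the von Neumann entropy (base 2) of the reduced state. -/
def EoE {A B : LocalSystem} (φ : BiVec A B) : ℝ :=
  -∑ i, (reducedA_isHermitian φ).eigenvalues i *
    Real.logb 2 ((reducedA_isHermitian φ).eigenvalues i)

/-- The local particle number operator `N_A ⊗ 1`. -/
def numOpA (A B : LocalSystem) : Matrix (A.ι × B.ι) (A.ι × B.ι) ℂ :=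
  (Matrix.diagonal fun a => (A.num a : ℂ)) ⊗ₖ (1 : Matrix B.ι B.ι ℂ)

/-- The expectation value `⟨φ|O|φ⟩` of a Hermitian operator. -/
def expect {A B : LocalSystem} (O : Matrix (A.ι × B.ι) (A.ι × B.ι) ℂ) (φ : BiVec A B) : ℝ :=
  (star φ ⬝ᵥ (O *ᵥ φ)).re

/-- The superselection induced variance. -/
def SiV {A B : LocalSystem} (φ : BiVec A B) : ℝ :=
  4 * (expect (numOpA A B * numOpA A B) φ - expect (numOpA A B) φ ^ 2)

/-! ### Local operations and classical communication under the superselection rule -/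

/-- A Kraus operator compatible with the superselection rule (ancillas allowed): it changes the
particle number by a definite amount `Δ`. -/
def HasDefiniteShift {A A' : LocalSystem} (K : Matrix A'.ι A.ι ℂ) : Prop :=
  ∃ Δ : ℤ, ∀ a' a, K a' a ≠ 0 → (A'.num a' : ℤ) = A.num a + Δ

/-- A generalized measurement compatible with the superselection rule; the system that is left
may depend on the outcome. -/
structure IsMeasurement {A : LocalSystem} {n : ℕ} {A₁ : Fin n → LocalSystem}
    (K : ∀ i, Matrix (A₁ i).ι A.ι ℂ) : Prop where
  shift : ∀ i, HasDefiniteShift (K i)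
  complete : ∑ i, (K i)ᴴ * K i = 1

/-- SSR-LOCC protocols with finitely many rounds that end on the systems `A' B'`: in each round
one party measures, and everything done afterwards may depend on the outcome. -/
inductive Protocol (A' B' : LocalSystem) : LocalSystem → LocalSystem → Type 1
  | done : Protocol A' B' A' B'
  | alice {A B : LocalSystem} (n : ℕ) (A₁ : Fin n → LocalSystem)
      (K : ∀ i, Matrix (A₁ i).ι A.ι ℂ) (hK : IsMeasurement K)
      (next : ∀ i, Protocol A' B' (A₁ i) B) : Protocol A' B' A B
  | bob {A B : LocalSystem} (n : ℕ) (B₁ : Fin n → LocalSystem)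
      (K : ∀ i, Matrix (B₁ i).ι B.ι ℂ) (hK : IsMeasurement K)
      (next : ∀ i, Protocol A' B' A (B₁ i)) : Protocol A' B' A B

/-- The quantum channel of a protocol: the output density matrix, averaged over all outcomes. -/
def Protocol.run {A' B' : LocalSystem} : {A B : LocalSystem} → Protocol A' B' A B →
    Matrix (A.ι × B.ι) (A.ι × B.ι) ℂ → Matrix (A'.ι × B'.ι) (A'.ι × B'.ι) ℂ
  | _, _, .done, ρ => ρ
  | _, B, .alice _ _ K _ next, ρ =>
      ∑ i, (next i).run ((K i ⊗ₖ (1 : Matrix B.ι B.ι ℂ)) * ρ * (K i ⊗ₖ (1 : Matrix B.ι B.ι ℂ))ᴴ)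
  | A, _, .bob _ _ K _ next, ρ =>
      ∑ i, (next i).run (((1 : Matrix A.ι A.ι ℂ) ⊗ₖ K i) * ρ * ((1 : Matrix A.ι A.ι ℂ) ⊗ₖ K i)ᴴ)

/-- The fidelity `⟨χ|Λ(|ψ⟩⟨ψ|)|χ⟩` with which a protocol converts `ψ` into `χ`. -/
def Protocol.fidelity {A B A' B' : LocalSystem} (P : Protocol A' B' A B)
    (ψ : BiVec A B) (χ : BiVec A' B') : ℝ :=
  expect (P.run (Matrix.vecMulVec ψ (star ψ))) χ

/-- The sequence of states `ψ N` can be converted by SSR-LOCC into the sequence `χ N` with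
fidelity tending to one. -/
def AsympConverts {A B A' B' : ℕ → LocalSystem}
    (ψ : ∀ N, BiVec (A N) (B N)) (χ : ∀ N, BiVec (A' N) (B' N)) : Prop :=
  ∃ P : ∀ N, Protocol (A' N) (B' N) (A N) (B N),
    Filter.Tendsto (fun N => (P N).fidelity (ψ N) (χ N)) Filter.atTop (𝓝 1)

/-! ### The standard states -/

/-- The basis index of the empty mode `|0⟩`. -/
def ket0 : mode.ι := (0 : Fin 2)

/-- The basis index of the occupied mode `|1⟩`. -/
def ket1 : mode.ι := (1 : Fin 2)

/-- `|V-EPR⟩ = (|0⟩_A|1⟩_B + |1⟩_A|0⟩_B)/√2`. -/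
def vEPR : BiVec mode mode := fun p =>
  if p = (ket0, ket1) ∨ p = (ket1, ket0) then ((1 / Real.sqrt 2 : ℝ) : ℂ) else 0

/-- The basis index of `|0̂⟩ = |01⟩`. -/
def hat0 : twoModes.ι := (ket0, ket1)

/-- The basis index of `|1̂⟩ = |10⟩`. -/
def hat1 : twoModes.ι := (ket1, ket0)

/-- `|E-EPR⟩ = (|0̂⟩_A|1̂⟩_B + |1̂⟩_A|0̂⟩_B)/√2`. -/
def eEPR : BiVec twoModes twoModes := fun p =>
  if p = (hat0, hat1) ∨ p = (hat1, hat0) then ((1 / Real.sqrt 2 : ℝ) : ℂ) else 0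

/-- The ancilla product state `|0̂⟩_A|0̂⟩_B`. -/
def ancilla : BiVec twoModes twoModes := fun p => if p = (hat0, hat0) then 1 else 0

/-- `∑ n, c n |n⟩_A |K - n⟩_B`. -/
def numberState (K : ℕ) (c : Fin (K + 1) → ℝ) : BiVec (register K) (register K) := fun p =>
  if (register K).num p.1 + (register K).num p.2 = K then ((c p.1 : ℝ) : ℂ) else 0

/-- The unnormalized Gaussian weight of variance `v` centred at `μ`, on the natural numbers;
for `v = 0` it is concentrated at `μ`. -/
def gaussWeight (μ : ℕ) (v : ℝ) (n : ℕ) : ℝ :=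
  if v = 0 then (if n = μ then 1 else 0) else Real.exp (-((n : ℝ) - μ) ^ 2 / (2 * v))

/-- Coefficients `c n`, `0 ≤ n ≤ K`, for which `c n ^ 2` is a (discretized) Gaussian distribution
centred at `⌊K / 2⌋` with SiV `s`, that is, with variance `s / 4`. -/
def gaussCoeff (K : ℕ) (s : ℝ) (n : Fin (K + 1)) : ℝ :=
  Real.sqrt (gaussWeight (K / 2) (s / 4) n /
    ∑ j : Fin (K + 1), gaussWeight (K / 2) (s / 4) j)

/-- The Gaussian state `∑ n, c n |n⟩_A |K - n⟩_B` with SiV parameter `s`. -/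
def gaussState (K : ℕ) (s : ℝ) : BiVec (register K) (register K) :=
  numberState K (gaussCoeff K s)

/-- The distribution of Alice's particle number in `φ` has a periodic gap: it is not concentrated
in one point, and all numbers that occur lie in one residue class modulo some `d ≥ 2`. -/
def HasGap {A B : LocalSystem} (φ : BiVec A B) : Prop :=
  (∃ p q, φ p ≠ 0 ∧ φ q ≠ 0 ∧ A.num p.1 ≠ A.num q.1) ∧
  ∃ d : ℕ, 2 ≤ d ∧ ∀ p q, φ p ≠ 0 → φ q ≠ 0 → A.num p.1 ≡ A.num q.1 [MOD d]

/-- The sequence of integers `m N` is `r N + o(N)`. -/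
def HasRate (m : ℕ → ℕ) (r : ℝ) : Prop :=
  Filter.Tendsto (fun N => (m N : ℝ) / N) Filter.atTop (𝓝 r)

end SSR

end

/-! Because of the superselection rule, a state has a Schmidt decomposition into vectors of definite
local particle number (`exists_schmidt`). Only the pairs (weight `w s`, Alice's number `n s`)
matter. For `N` copies two things can be controlled: the weights are close to `2 ^ (-N E)` up to a
factor `2 ^ (± window N)`, and the law of Alice's number is asymptotically Gaussian.

One-shot conversion. Alice applies a random weighted matching between source and target Schmidt
vectors that shifts the number by a constant, and Bob follows the same matching without weights.
Birkhoff's theorem supplies the matchings as long as, in every number sector, no source weight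
exceeds the sector mass divided by the number of target vectors. The fidelity is then a squared
Bhattacharyya overlap of number laws (`Schmidt.exists_protocol_sectors`). If source weights are at
most `α` and `β` target vectors suffice, the condition fails only in sectors of mass below `α β`.
There are O(N) sectors, so `α β` of order `N * 2 ^ (-window N)` is harmless, and a margin of o(N)
ebits achieves this (`asympConverts_of_cover`). What remains is to compare number laws in total
variation, up to translation.

Number laws. Laws are Laurent polynomials, and tensor products multiply them. The central limit
theorem gives convergence of distribution functions only. The upgrade to `ℓ¹` needs regularity: `(T
g - 1) * p ^ N` has norm O(1/√N) whenever `g` is a difference of occurring numbers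
(`l1_T_sub_T_mul_law_pow_le`). The shifts with this property form a subgroup `d ℤ`. Smearing with
the uniform law on `0, …, d - 1` gives regularity under unit shifts, and `tendsto_l1_sub_of_cdf`
then yields `exists_period_tendsto_gauss`.

The period `d`. From the Gaussian to `φ`, Alice measures her number modulo `d`
(`Schmidt.exists_protocol_residues`). In the other direction gaps must be filled: about √N V-EPRs
have a binomial number law smooth enough to absorb the uniform law, and they are returned
(`Schmidt.exists_tendsto_gauss_mul`). The first part of the theorem uses the number law of the
copies themselves, so there nothing has to be smoothed. -/

noncomputable section

namespace SSR

open LocalSystem Matrix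

/-! ### Fidelities of protocols -/

/-- A bipartite vector as a matrix. -/
def toMat {A B : LocalSystem} (ψ : BiVec A B) : Matrix A.ι B.ι ℂ := Matrix.of fun i j => ψ (i, j)

theorem toMat_kronecker_mulVec {A B A' B' : LocalSystem} (K : Matrix A'.ι A.ι ℂ)
    (L : Matrix B'.ι B.ι ℂ) (ψ : BiVec A B) :
    toMat (A := A') (B := B') ((K ⊗ₖ L) *ᵥ ψ) = K * toMat ψ * Lᵀ := by
  ext i j
  simp only [toMat, Matrix.of_apply, Matrix.mulVec, dotProduct, Matrix.kroneckerMap_apply,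
    Matrix.mul_apply, Matrix.transpose_apply, Fintype.sum_prod_type, Finset.sum_mul]
  rw [Finset.sum_comm]
  refine Finset.sum_congr rfl fun _ _ => Finset.sum_congr rfl fun _ _ => by ring

theorem star_dotProduct_eq_trace {A B : LocalSystem} (χ ψ : BiVec A B) :
    star χ ⬝ᵥ ψ = ((toMat χ)ᴴ * toMat ψ).trace := by
  simp only [dotProduct, Matrix.trace, Matrix.diag, Matrix.mul_apply, toMat,
    Matrix.conjTranspose_apply, Matrix.of_apply, Fintype.sum_prod_type, Pi.star_apply]
  exact Finset.sum_comm

theorem expect_sum {A B : LocalSystem} {n : ℕ} (O : Fin n → Matrix (A.ι × B.ι) (A.ι × B.ι) ℂ)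
    (χ : BiVec A B) : expect (∑ i, O i) χ = ∑ i, expect (O i) χ := by
  simp only [expect, Matrix.sum_mulVec, dotProduct_sum, Complex.re_sum]

theorem conj_vecMulVec {m n : Type*} [Fintype m] [Fintype n] (M : Matrix m n ℂ) (ψ : n → ℂ) :
    M * Matrix.vecMulVec ψ (star ψ) * Mᴴ = Matrix.vecMulVec (M *ᵥ ψ) (star (M *ᵥ ψ)) := by
  rw [Matrix.mul_vecMulVec, Matrix.vecMulVec_mul, Matrix.star_mulVec]

theorem Protocol.fidelity_done {A B : LocalSystem} (ψ χ : BiVec A B) :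
    (Protocol.done : Protocol A B A B).fidelity ψ χ = ‖star χ ⬝ᵥ ψ‖ ^ 2 := by
  have h : star ψ ⬝ᵥ χ = star (star χ ⬝ᵥ ψ) := by
    rw [Matrix.star_dotProduct]
  simp only [Protocol.fidelity, Protocol.run, expect, Matrix.vecMulVec_mulVec, dotProduct_smul]
  rw [h]
  simp [MulOpposite.smul_eq_mul_unop, Complex.mul_conj, Complex.normSq_eq_norm_sq]
  norm_cast

theorem Protocol.fidelity_alice {A B A' B' : LocalSystem} (n : ℕ) (A₁ : Fin n → LocalSystem)
    (K : ∀ i, Matrix (A₁ i).ι A.ι ℂ) (hK : IsMeasurement K)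
    (next : ∀ i, Protocol A' B' (A₁ i) B) (ψ : BiVec A B) (χ : BiVec A' B') :
    (Protocol.alice n A₁ K hK next).fidelity ψ χ =
      ∑ i, (next i).fidelity ((K i ⊗ₖ (1 : Matrix B.ι B.ι ℂ)) *ᵥ ψ) χ := by
  simp only [Protocol.fidelity, Protocol.run, expect_sum, conj_vecMulVec]

theorem Protocol.fidelity_bob {A B A' B' : LocalSystem} (n : ℕ) (B₁ : Fin n → LocalSystem)
    (K : ∀ i, Matrix (B₁ i).ι B.ι ℂ) (hK : IsMeasurement K)
    (next : ∀ i, Protocol A' B' A (B₁ i)) (ψ : BiVec A B) (χ : BiVec A' B') :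
    (Protocol.bob n B₁ K hK next).fidelity ψ χ =
      ∑ i, (next i).fidelity (((1 : Matrix A.ι A.ι ℂ) ⊗ₖ K i) *ᵥ ψ) χ := by
  simp only [Protocol.fidelity, Protocol.run, expect_sum, conj_vecMulVec]

/-- This is what allows lower bounds that keep only the favourable measurement branches. -/
theorem Protocol.fidelity_nonneg {A' B' : LocalSystem} (χ : BiVec A' B') {A B : LocalSystem}
    (P : Protocol A' B' A B) (ψ : BiVec A B) : 0 ≤ P.fidelity ψ χ := by
  induction P with
  | done => rw [Protocol.fidelity_done]; positivity
  | alice n A₁ K hK next ih =>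
    rw [Protocol.fidelity_alice]; exact Finset.sum_nonneg fun i _ => ih i _
  | bob n B₁ K hK next ih =>
    rw [Protocol.fidelity_bob]; exact Finset.sum_nonneg fun i _ => ih i _

theorem sum_norm_sq_eq_star_dotProduct {n : Type*} [Fintype n] (ψ : n → ℂ) :
    star ψ ⬝ᵥ ψ = ((∑ i, ‖ψ i‖ ^ 2 : ℝ) : ℂ) := by
  simp [dotProduct, Complex.conj_mul']

theorem norm_star_dotProduct_sq_le {n : Type*} [Fintype n] (χ ψ : n → ℂ) :
    ‖star χ ⬝ᵥ ψ‖ ^ 2 ≤ (∑ i, ‖ψ i‖ ^ 2) * ∑ i, ‖χ i‖ ^ 2 := by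
  have h1 : ‖star χ ⬝ᵥ ψ‖ ≤ ∑ i, ‖χ i‖ * ‖ψ i‖ := by
    refine (norm_sum_le _ _).trans (le_of_eq (Finset.sum_congr rfl fun i _ => ?_))
    simp
  calc ‖star χ ⬝ᵥ ψ‖ ^ 2 ≤ (∑ i, ‖χ i‖ * ‖ψ i‖) ^ 2 := by gcongr
    _ ≤ (∑ i, ‖χ i‖ ^ 2) * ∑ i, ‖ψ i‖ ^ 2 := Finset.sum_mul_sq_le_sq_mul_sq _ _ _
    _ = _ := mul_comm _ _

theorem sum_norm_sq_mulVec {m n : Type*} [Fintype m] [Fintype n] (M : Matrix m n ℂ) (ψ : n → ℂ) :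
    ((∑ i, ‖(M *ᵥ ψ) i‖ ^ 2 : ℝ) : ℂ) = star ψ ⬝ᵥ ((Mᴴ * M) *ᵥ ψ) := by
  rw [← sum_norm_sq_eq_star_dotProduct, Matrix.star_mulVec, ← Matrix.dotProduct_mulVec,
    Matrix.mulVec_mulVec]

theorem sum_sum_norm_sq_mulVec {n : Type*} [Fintype n] [DecidableEq n] {N : ℕ}
    {m : Fin N → Type*} [∀ i, Fintype (m i)] (M : ∀ i, Matrix (m i) n ℂ)
    (hM : ∑ i, (M i)ᴴ * M i = 1) (ψ : n → ℂ) :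
    ∑ i, ∑ j, ‖(M i *ᵥ ψ) j‖ ^ 2 = ∑ j, ‖ψ j‖ ^ 2 := by
  have h : ((∑ i, ∑ j, ‖(M i *ᵥ ψ) j‖ ^ 2 : ℝ) : ℂ) = ((∑ j, ‖ψ j‖ ^ 2 : ℝ) : ℂ) := by
    rw [Complex.ofReal_sum]
    simp_rw [sum_norm_sq_mulVec]
    rw [← dotProduct_sum, ← Matrix.sum_mulVec, hM, Matrix.one_mulVec,
      sum_norm_sq_eq_star_dotProduct]
  exact_mod_cast h

/-- Each measurement preserves the total squared norm summed over its branches, and the final step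
is Cauchy–Schwarz. The norms appear because branch vectors are not normalized; for unit vectors the
bound is 1. -/
theorem Protocol.fidelity_le {A' B' : LocalSystem} (χ : BiVec A' B') {A B : LocalSystem}
    (P : Protocol A' B' A B) (ψ : BiVec A B) :
    P.fidelity ψ χ ≤ (∑ p, ‖ψ p‖ ^ 2) * ∑ p, ‖χ p‖ ^ 2 := by
  induction P with
  | done => rw [Protocol.fidelity_done]; exact norm_star_dotProduct_sq_le χ ψ
  | @alice A B n A₁ K hK next ih =>
    rw [Protocol.fidelity_alice]
    refine (Finset.sum_le_sum fun i _ => ih i _).trans (le_of_eq ?_)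
    rw [← Finset.sum_mul, sum_sum_norm_sq_mulVec (fun i => K i ⊗ₖ (1 : Matrix B.ι B.ι ℂ))]
    simp only [Matrix.conjTranspose_kronecker, ← Matrix.mul_kronecker_mul, Matrix.conjTranspose_one,
      Matrix.one_mul]
    rw [← Matrix.one_kronecker_one, ← hK.complete]
    ext p q
    simp [Matrix.sum_apply, Finset.sum_mul]
  | @bob A B n B₁ K hK next ih =>
    rw [Protocol.fidelity_bob]
    refine (Finset.sum_le_sum fun i _ => ih i _).trans (le_of_eq ?_)
    rw [← Finset.sum_mul, sum_sum_norm_sq_mulVec (fun i => (1 : Matrix A.ι A.ι ℂ) ⊗ₖ K i)]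
    simp only [Matrix.conjTranspose_kronecker, ← Matrix.mul_kronecker_mul, Matrix.conjTranspose_one,
      Matrix.one_mul]
    rw [← Matrix.one_kronecker_one, ← hK.complete]
    ext p q
    simp [Matrix.sum_apply, Finset.mul_sum]

/-! ### Completing a family of Kraus operators to a measurement -/

/-- The defect `1 - ∑ Kᴴ K` has to be split into operators of definite shift. Its Hermitian square
root `C` preserves the number, so the operator that reads off row `i` of `C` and outputs the fixed
vector `o` sees a single number sector. These extra outcomes, indexed by `A.ι`, are the failures of
the protocol. -/
theorem exists_measurement {A A' : LocalSystem} (o : A'.ι) {S Ω : Type} [Fintype S]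
    [DecidableEq S] [Fintype Ω] (a : Matrix A.ι S ℂ) (n : S → ℕ) (ha : aᴴ * a = 1)
    (hn : ∀ i s, a i s ≠ 0 → A.num i = n s) (K : Ω → Matrix A'.ι A.ι ℂ)
    (hK : ∀ ω, HasDefiniteShift (A := A) (A' := A') (K ω)) (r : S → ℝ) (hr : ∀ s, r s ≤ 1)
    (hsum : ∑ ω, (K ω)ᴴ * K ω = a * Matrix.diagonal (fun s => (r s : ℂ)) * aᴴ) :
    ∃ (N : ℕ) (e : Ω ⊕ A.ι ≃ Fin N) (K' : Fin N → Matrix A'.ι A.ι ℂ),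
      IsMeasurement (A := A) (A₁ := fun _ => A') K' ∧ ∀ ω, K' (e (Sum.inl ω)) = K ω := by
  classical
  -- Acts as `√(1 - r s)` on column `s` of `a` and as the identity on the orthogonal complement of
  -- the columns.
  let C : Matrix A.ι A.ι ℂ :=
    1 - a * Matrix.diagonal (fun s => ((1 - Real.sqrt (1 - r s) : ℝ) : ℂ)) * aᴴ
  have hCH : Cᴴ = C := by
    simp only [C, Matrix.conjTranspose_sub, Matrix.conjTranspose_one, Matrix.conjTranspose_mul,
      Matrix.conjTranspose_conjTranspose, Matrix.diagonal_conjTranspose, Matrix.mul_assoc]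
    congr 4
    ext s
    simp
  have hCC : Cᴴ * C = 1 - a * Matrix.diagonal (fun s => (r s : ℂ)) * aᴴ := by
    rw [hCH]
    set d : S → ℂ := fun s => ((1 - Real.sqrt (1 - r s) : ℝ) : ℂ) with hd
    have h1 : (a * Matrix.diagonal d * aᴴ) * (a * Matrix.diagonal d * aᴴ)
        = a * Matrix.diagonal (fun s => d s * d s) * aᴴ := by
      calc (a * Matrix.diagonal d * aᴴ) * (a * Matrix.diagonal d * aᴴ)
          = a * Matrix.diagonal d * (aᴴ * a) * Matrix.diagonal d * aᴴ := by
            simp only [Matrix.mul_assoc]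
        _ = _ := by rw [ha, Matrix.mul_one, Matrix.mul_assoc a, Matrix.diagonal_mul_diagonal]
    have h2 : (Matrix.diagonal (fun s => (r s : ℂ)) : Matrix S S ℂ)
        = Matrix.diagonal d + Matrix.diagonal d - Matrix.diagonal (fun s => d s * d s) := by
      rw [Matrix.diagonal_add, Matrix.diagonal_sub]
      congr 1
      ext s
      have h3 : Real.sqrt (1 - r s) * Real.sqrt (1 - r s) = 1 - r s :=
        Real.mul_self_sqrt (by linarith [hr s])
      have h4 : r s = (1 - Real.sqrt (1 - r s)) + (1 - Real.sqrt (1 - r s)) -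
        (1 - Real.sqrt (1 - r s)) * (1 - Real.sqrt (1 - r s)) := by linarith
      simp only [hd, ← Complex.ofReal_mul, ← Complex.ofReal_add, ← Complex.ofReal_sub]
      exact_mod_cast h4
    have h5 : C * C = 1 - a * Matrix.diagonal d * aᴴ - a * Matrix.diagonal d * aᴴ
        + (a * Matrix.diagonal d * aᴴ) * (a * Matrix.diagonal d * aᴴ) := by
      simp only [C, Matrix.sub_mul, Matrix.mul_sub, Matrix.one_mul, Matrix.mul_one]; abel
    rw [h5, h1, h2]
    simp only [Matrix.mul_add, Matrix.mul_sub, Matrix.add_mul, Matrix.sub_mul]; abel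
  have hCnum : ∀ i j, C i j ≠ 0 → A.num j = A.num i := by
    intro i j hij
    by_contra hne
    apply hij
    have : i ≠ j := fun h => hne (by rw [h])
    simp only [C, Matrix.sub_apply, Matrix.one_apply_ne this]
    rw [Matrix.mul_apply, Finset.sum_eq_zero, sub_zero]
    intro s _
    rw [Matrix.mul_diagonal, Matrix.conjTranspose_apply]
    by_cases h1 : a i s = 0
    · simp [h1]
    by_cases h2 : a j s = 0
    · simp [h2]
    exact absurd ((hn j s h2).trans (hn i s h1).symm) hne
  let K₀ : Ω ⊕ A.ι → Matrix A'.ι A.ι ℂ :=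
    Sum.elim K fun i => Matrix.of fun x j => if x = o then C i j else 0
  let e : Ω ⊕ A.ι ≃ Fin (Fintype.card (Ω ⊕ A.ι)) := Fintype.equivFin _
  refine ⟨_, e, fun i => K₀ (e.symm i), ⟨fun i => ?_, ?_⟩, fun ω => by simp [K₀]⟩
  · rcases h : e.symm i with ω | j
    · simpa only [K₀, Sum.elim_inl] using hK ω
    · refine ⟨A'.num o - A.num j, fun x y hxy => ?_⟩
      simp only [K₀, Sum.elim_inr, Matrix.of_apply] at hxy
      obtain ⟨rfl, h2⟩ : x = o ∧ C j y ≠ 0 := by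
        by_cases hx : x = o
        · exact ⟨hx, by simpa [hx] using hxy⟩
        · simp [hx] at hxy
      rw [hCnum j y h2]; ring
  · rw [Equiv.sum_comp e.symm (fun x => (K₀ x)ᴴ * K₀ x), Fintype.sum_sum_type]
    have h1 : ∑ i : A.ι, (K₀ (Sum.inr i))ᴴ * K₀ (Sum.inr i) = Cᴴ * C := by
      ext y z
      simp [K₀, Matrix.sum_apply, Matrix.mul_apply, Matrix.conjTranspose_apply]
    rw [h1, hCC]
    simp only [K₀, Sum.elim_inl, hsum]
    abel

end SSR

namespace SSR

open LocalSystem Matrix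

/-! ### Schmidt decompositions compatible with the particle number -/

/-- A Schmidt decomposition `φ = ∑ s, √(w s) |a s⟩ |b s⟩` into vectors of definite particle number;
the vectors `a s` and `b s` are the columns of the matrices `a` and `b`. -/
structure Schmidt {A B : LocalSystem} (φ : BiVec A B) (I : ℕ) where
  S : Type
  [fintype : Fintype S]
  [decEq : DecidableEq S]
  w : S → ℝ
  a : Matrix A.ι S ℂ
  b : Matrix B.ι S ℂ
  n : S → ℕ
  w_nonneg : ∀ s, 0 ≤ w s
  a_iso : aᴴ * a = 1
  b_iso : bᴴ * b = 1
  a_num : ∀ i s, a i s ≠ 0 → A.num i = n s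
  b_num : ∀ j s, b j s ≠ 0 → n s + B.num j = I
  eq : toMat φ = a * Matrix.diagonal (fun s => ((Real.sqrt (w s) : ℝ) : ℂ)) * bᵀ

attribute [instance] Schmidt.fintype Schmidt.decEq

/-- The weighted partial map `t ↦ f t` on `D`, as a matrix. -/
def partialMat {S T : Type} [DecidableEq S] [DecidableEq T] (D : Finset T) (f : T → S)
    (κ : T → ℝ) : Matrix T S ℂ :=
  Matrix.of fun t s => if t ∈ D ∧ f t = s then (κ t : ℂ) else 0

/-- Diagonal without injectivity of `f`, since row `t` has its only possible nonzero entry in column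
`f t`. The maps run from target to source indices. -/
theorem partialMat_conjTranspose_mul_self {S T : Type} [Fintype T] [DecidableEq S]
    [DecidableEq T] (D : Finset T) (f : T → S) (κ : T → ℝ) :
    (partialMat D f κ)ᴴ * partialMat D f κ =
      Matrix.diagonal fun s => ((∑ t ∈ D, if f t = s then κ t ^ 2 else 0 : ℝ) : ℂ) := by
  ext s s'
  simp only [partialMat, Matrix.mul_apply, Matrix.conjTranspose_apply, Matrix.of_apply,
    Matrix.diagonal_apply]
  split_ifs with h
  · subst h
    rw [Complex.ofReal_sum, ← Finset.sum_subset (Finset.subset_univ D)]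
    · refine Finset.sum_congr rfl fun t ht => ?_
      by_cases h1 : f t = s <;> simp [h1, ht, pow_two]
    · intro t _ ht
      simp [ht]
  · refine Finset.sum_eq_zero fun t _ => ?_
    by_cases h1 : t ∈ D ∧ f t = s
    · rw [if_neg (fun h2 : t ∈ D ∧ f t = s' => h (h1.2.symm.trans h2.2)), mul_zero]
    · rw [if_neg h1, star_zero, zero_mul]

theorem conj_mul_conjTranspose_mul {m n S T : Type*} [Fintype m] [Fintype n] [Fintype S] [Fintype T]
    [DecidableEq T] (a : Matrix n S ℂ) (a' : Matrix m T ℂ) (ha' : a'ᴴ * a' = 1)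
    (k : Matrix T S ℂ) :
    (a' * k * aᴴ)ᴴ * (a' * k * aᴴ) = a * (kᴴ * k) * aᴴ := by
  calc (a' * k * aᴴ)ᴴ * (a' * k * aᴴ) = a * kᴴ * (a'ᴴ * a') * k * aᴴ := by
        simp only [Matrix.conjTranspose_mul, Matrix.conjTranspose_conjTranspose, Matrix.mul_assoc]
    _ = _ := by rw [ha', Matrix.mul_one, Matrix.mul_assoc a]

/-! ### Protocols that map one Schmidt basis to another. -/

section convert

variable {A B A' B' : LocalSystem} {ψ : BiVec A B} {χ : BiVec A' B'} {I J : ℕ}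

theorem hasDefiniteShift_of_partialMat {C C' : LocalSystem} {S T : Type} [Fintype S] [Fintype T]
    [DecidableEq S] [DecidableEq T] (c : Matrix C.ι S ℂ) (c' : Matrix C'.ι T ℂ) (D : Finset T)
    (f : T → S) (κ : T → ℝ) (Δ : ℤ)
    (h : ∀ t ∈ D, ∀ i j, c' i t ≠ 0 → c j (f t) ≠ 0 → (C'.num i : ℤ) = C.num j + Δ) :
    HasDefiniteShift (A := C) (A' := C') (c' * partialMat D f κ * cᴴ) := by
  refine ⟨Δ, fun i j hij => ?_⟩
  rw [Matrix.mul_apply] at hij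
  obtain ⟨s, -, hs⟩ := Finset.exists_ne_zero_of_sum_ne_zero hij
  have h1 := left_ne_zero_of_mul hs
  have h2 := right_ne_zero_of_mul hs
  rw [Matrix.mul_apply] at h1
  obtain ⟨t, -, ht⟩ := Finset.exists_ne_zero_of_sum_ne_zero h1
  have h3 := left_ne_zero_of_mul ht
  have h4 := right_ne_zero_of_mul ht
  simp only [partialMat, Matrix.of_apply, ne_eq, ite_eq_right_iff, not_forall] at h4
  obtain ⟨⟨h5, h6⟩, -⟩ := h4
  subst h6
  refine h t h5 i j h3 fun h7 => h2 ?_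
  rw [Matrix.conjTranspose_apply, h7, star_zero]

/-- Injectivity turns the unweighted partial map into a partial isometry, which is an admissible
Kraus operator by itself. Only that branch enters the bound. -/
theorem Schmidt.exists_bob_protocol (F : Schmidt ψ I) (G : Schmidt χ J) (o : B'.ι)
    (D : Finset G.S) (f : G.S → F.S) (hinj : Set.InjOn f D) (Δ : ℤ)
    (hΔ : ∀ t ∈ D, (G.n t : ℤ) = F.n (f t) + Δ) :
    ∃ Q : Protocol A' B' A' B, ∀ ψ' : BiVec A' B,
      ‖star χ ⬝ᵥ (((1 : Matrix A'.ι A'.ι ℂ) ⊗ₖ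
        (G.b * partialMat D f (fun _ => 1) * F.bᴴ)) *ᵥ ψ')‖ ^ 2 ≤ Q.fidelity ψ' χ := by
  obtain ⟨N, e, K', hK', hKe⟩ := exists_measurement (A := B) (A' := B') o (Ω := Unit) F.b
    (fun s => I - F.n s) F.b_iso (fun i s h => by have := F.b_num i s h; omega)
    (fun _ => G.b * partialMat D f (fun _ => 1) * F.bᴴ)
    -- Alice's number changes by `Δ` and the total from `I` to `J`, which fixes Bob's shift.
    (fun _ => hasDefiniteShift_of_partialMat F.b G.b D f _ (J - I - Δ)
      (fun t ht i j h1 h2 => by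
        have h3 := G.b_num _ _ h1
        have h4 := F.b_num _ _ h2
        have h5 := hΔ t ht
        omega))
    (fun s => ∑ t ∈ D, if f t = s then (1 : ℝ) ^ 2 else 0)
    (fun s => by
      rw [Finset.sum_ite, Finset.sum_const_zero, add_zero, Finset.sum_const, nsmul_eq_mul,
        one_pow, mul_one]
      have : (D.filter fun t => f t = s).card ≤ 1 := by
        rw [Finset.card_le_one]
        intro x hx y hy
        simp only [Finset.mem_filter] at hx hy
        exact hinj hx.1 hy.1 (hx.2.trans hy.2.symm)
      exact_mod_cast this)
    (by simp only [Finset.univ_unique, Finset.sum_singleton]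
        rw [conj_mul_conjTranspose_mul _ _ G.b_iso, partialMat_conjTranspose_mul_self])
  refine ⟨.bob N (fun _ => B') K' hK' fun _ => .done, fun ψ' => ?_⟩
  rw [Protocol.fidelity_bob, ← hKe (), ← Protocol.fidelity_done]
  exact Finset.single_le_sum (f := fun i => (Protocol.done : Protocol A' B' A' B').fidelity
    (((1 : Matrix A'.ι A'.ι ℂ) ⊗ₖ K' i) *ᵥ ψ') χ)
    (fun i _ => Protocol.fidelity_nonneg χ _ _) (Finset.mem_univ _)

/-- The Schmidt bases are isometries, so they cancel inside the trace and leave a product of small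
matrices indexed by `F.S` and `G.S`. -/
theorem Schmidt.overlap (F : Schmidt ψ I) (G : Schmidt χ J) (D : Finset G.S) (f : G.S → F.S)
    (κ : G.S → ℝ) :
    star χ ⬝ᵥ (((1 : Matrix A'.ι A'.ι ℂ) ⊗ₖ (G.b * partialMat D f (fun _ => 1) * F.bᴴ)) *ᵥ
      (((G.a * partialMat D f κ * F.aᴴ) ⊗ₖ (1 : Matrix B.ι B.ι ℂ)) *ᵥ ψ)) =
      ((∑ t ∈ D, κ t * Real.sqrt (F.w (f t)) * Real.sqrt (G.w t) : ℝ) : ℂ) := by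
  set k := partialMat D f κ with hk
  set l := partialMat D f (fun _ => 1) with hl
  set dF : Matrix F.S F.S ℂ := Matrix.diagonal (fun s => ((Real.sqrt (F.w s) : ℝ) : ℂ)) with hdF
  set dG : Matrix G.S G.S ℂ := Matrix.diagonal (fun s => ((Real.sqrt (G.w s) : ℝ) : ℂ)) with hdG
  have hF : F.bᵀ * (F.bᴴ)ᵀ = 1 := by
    rw [← Matrix.transpose_mul, F.b_iso, Matrix.transpose_one]
  have hG : G.bᵀ * (G.bᴴ)ᵀ = 1 := by
    rw [← Matrix.transpose_mul, G.b_iso, Matrix.transpose_one]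
  have hGd : dGᴴ = dG := by
    rw [hdG, Matrix.diagonal_conjTranspose]; congr 1; ext s; simp
  rw [star_dotProduct_eq_trace, toMat_kronecker_mulVec, toMat_kronecker_mulVec, F.eq, G.eq,
    ← hdF, ← hdG]
  have h1 : (1 : Matrix A'.ι A'.ι ℂ) * (G.a * k * F.aᴴ * (F.a * dF * F.bᵀ) *
      (1 : Matrix B.ι B.ι ℂ)ᵀ) * (G.b * l * F.bᴴ)ᵀ
      = G.a * (k * dF * lᵀ) * G.bᵀ := by
    calc _ = G.a * k * (F.aᴴ * F.a) * dF * (F.bᵀ * (F.bᴴ)ᵀ) * lᵀ * G.bᵀ := by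
          simp only [Matrix.transpose_mul, Matrix.transpose_one, Matrix.mul_one, Matrix.one_mul,
            Matrix.mul_assoc]
      _ = _ := by rw [hF, F.a_iso]; simp only [Matrix.mul_one, Matrix.mul_assoc]
  rw [h1]
  have h2 : (G.a * dG * G.bᵀ)ᴴ * (G.a * (k * dF * lᵀ) * G.bᵀ)
      = (G.bᵀ)ᴴ * (dG * (k * dF * lᵀ) * G.bᵀ) := by
    calc _ = (G.bᵀ)ᴴ * (dGᴴ * (G.aᴴ * G.a) * (k * dF * lᵀ) * G.bᵀ) := by
          simp only [Matrix.conjTranspose_mul, Matrix.mul_assoc]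
      _ = _ := by rw [hGd, G.a_iso, Matrix.mul_one]
  have h3 : (G.bᵀ)ᴴ = (G.bᴴ)ᵀ := rfl
  rw [h2, Matrix.trace_mul_comm, Matrix.mul_assoc, h3, hG, Matrix.mul_one]
  simp only [Matrix.trace, Matrix.diag]
  rw [Complex.ofReal_sum, ← Finset.sum_subset (Finset.subset_univ D)]
  · refine Finset.sum_congr rfl fun t ht => ?_
    rw [hdG, Matrix.diagonal_mul, Matrix.mul_apply, Finset.sum_eq_single (f t)]
    · simp [hk, hl, hdF, Matrix.mul_diagonal, partialMat, ht]; ring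
    · intro s _ hs
      simp [hk, hl, hdF, Matrix.mul_diagonal, partialMat, ht, hs.symm]
    · simp
  · intro t _ ht
    rw [hdG, Matrix.diagonal_mul, Matrix.mul_apply, Finset.sum_eq_zero, mul_zero]
    intro s _
    simp [hk, hl, hdF, Matrix.mul_diagonal, partialMat, ht]

/-- One-way protocols that apply random weighted partial injections between Schmidt bases. -/
theorem Schmidt.exists_protocol (F : Schmidt ψ I) (G : Schmidt χ J) (oA : A'.ι) (oB : B'.ι)
    {Ω : Type} [Fintype Ω] (D : Ω → Finset G.S) (f : Ω → G.S → F.S)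
    (hinj : ∀ ω, Set.InjOn (f ω) (D ω)) (κ : Ω → G.S → ℝ) (Δ : Ω → ℤ)
    (hΔ : ∀ ω, ∀ t ∈ D ω, (G.n t : ℤ) = F.n (f ω t) + Δ ω)
    (hκ : ∀ s, ∑ ω, ∑ t ∈ D ω, (if f ω t = s then κ ω t ^ 2 else 0) ≤ 1) :
    ∃ P : Protocol A' B' A B,
      ∑ ω, (∑ t ∈ D ω, κ ω t * Real.sqrt (F.w (f ω t)) * Real.sqrt (G.w t)) ^ 2
        ≤ P.fidelity ψ χ := by
  obtain ⟨N, e, K', hK', hKe⟩ := exists_measurement (A := A) (A' := A') oA (Ω := Ω) F.a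
    F.n F.a_iso F.a_num
    (fun ω => G.a * partialMat (D ω) (f ω) (κ ω) * F.aᴴ)
    (fun ω => hasDefiniteShift_of_partialMat F.a G.a (D ω) (f ω) _ (Δ ω)
      (fun t ht i j h1 h2 => by
        rw [G.a_num _ _ h1, F.a_num _ _ h2, hΔ ω t ht]))
    (fun s => ∑ ω, ∑ t ∈ D ω, if f ω t = s then κ ω t ^ 2 else 0) hκ
    (by simp only [conj_mul_conjTranspose_mul _ _ G.a_iso, partialMat_conjTranspose_mul_self]
        rw [← Matrix.sum_mul, ← Matrix.mul_sum]
        congr 2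
        ext s s'
        rw [Matrix.sum_apply]
        by_cases h : s = s'
        · subst h; simp
        · simp [h])
  -- Alice announces her outcome. For an `ω` Bob applies the matching partial isometry. For a
  -- failure he makes an arbitrary measurement that ends on `B'`, since every branch must finish on
  -- the prescribed systems.
  have hQ : ∀ i : Fin N, ∃ Q : Protocol A' B' A' B, ∀ ω, i = e (Sum.inl ω) → ∀ ψ' : BiVec A' B,
      ‖star χ ⬝ᵥ (((1 : Matrix A'.ι A'.ι ℂ) ⊗ₖ
        (G.b * partialMat (D ω) (f ω) (fun _ => 1) * F.bᴴ)) *ᵥ ψ')‖ ^ 2 ≤ Q.fidelity ψ' χ := by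
    intro i
    rcases h : e.symm i with ω | j
    · obtain ⟨Q, hQ⟩ := F.exists_bob_protocol G oB (D ω) (f ω) (hinj ω) (Δ ω) (hΔ ω)
      refine ⟨Q, fun ω' hω' => ?_⟩
      have : ω' = ω := by
        rw [hω', Equiv.symm_apply_apply] at h
        exact Sum.inl_injective h
      subst this
      exact hQ
    · have hno : ∀ ω, i ≠ e (Sum.inl ω) := by
        rintro ω rfl
        simp at h
      obtain ⟨K, hK⟩ : ∃ K : B.ι → Matrix B'.ι B.ι ℂ,
          (∀ x, HasDefiniteShift (A := B) (A' := B') (K x)) ∧ ∑ x, (K x)ᴴ * K x = 1 := by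
        refine ⟨fun x => Matrix.single oB x 1, fun x => ⟨B'.num oB - B.num x, ?_⟩, ?_⟩
        · intro u v huv
          simp only [Matrix.single_apply, ne_eq, ite_eq_right_iff, not_forall] at huv
          obtain ⟨⟨rfl, rfl⟩, -⟩ := huv
          ring
        · simp [Matrix.conjTranspose_single, Matrix.sum_single_one]
      refine ⟨.bob _ (fun _ => B') (fun j => K ((Fintype.equivFin B.ι).symm j))
        ⟨fun _ => hK.1 _, ?_⟩ fun _ => .done, fun ω hω => absurd hω (hno ω)⟩
      rw [← hK.2]
      exact Equiv.sum_comp (Fintype.equivFin B.ι).symm (fun x => (K x)ᴴ * K x)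
  choose Q hQ using hQ
  refine ⟨.alice N (fun _ => A') K' hK' Q, ?_⟩
  rw [Protocol.fidelity_alice, ← Equiv.sum_comp e, Fintype.sum_sum_type]
  refine le_trans ?_ (le_add_of_nonneg_right
    (Finset.sum_nonneg fun _ _ => Protocol.fidelity_nonneg χ _ _))
  refine Finset.sum_le_sum fun ω _ => ?_
  refine le_trans (le_of_eq ?_) (hQ _ ω rfl _)
  rw [hKe, F.overlap G (D ω) (f ω) (κ ω), Complex.norm_real, Real.norm_eq_abs, sq_abs]

end convert

end SSR

namespace SSR

open LocalSystem Matrix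

/-! ### Random injections and transport between number sectors -/

/-- Doubly substochastic matrices are mixtures of partial injections. -/
theorem exists_random_injection {S T : Type} [Fintype S] [Fintype T] [DecidableEq S]
    [DecidableEq T] (d : S → T → ℝ) (hd : ∀ s t, 0 ≤ d s t) (hrow : ∀ s, ∑ t, d s t ≤ 1)
    (hcol : ∀ t, ∑ s, d s t ≤ 1) :
    ∃ q : Equiv.Perm (S ⊕ T) → ℝ, (∀ σ, 0 ≤ q σ) ∧ ∑ σ, q σ = 1 ∧
      (∀ s t, ∑ σ, (if σ (Sum.inr t) = Sum.inl s then q σ else 0) = d s t) ∧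
      ∀ σ t, q σ ≠ 0 → ∑ s, d s t = 1 → ∃ s, σ (Sum.inr t) = Sum.inl s := by
  -- The missing row and column sums are put on the diagonal blocks, which makes the matrix doubly
  -- stochastic, so that Birkhoff's theorem applies. A permutation matches `t` exactly when it sends
  -- `inr t` into `S`.
  let M : Matrix (S ⊕ T) (S ⊕ T) ℝ := Matrix.fromBlocks
    (Matrix.diagonal fun s => 1 - ∑ t, d s t) (Matrix.of d)
    (Matrix.of fun t s => d s t) (Matrix.diagonal fun t => 1 - ∑ s, d s t)
  have hM : M ∈ doublyStochastic ℝ (S ⊕ T) := by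
    rw [mem_doublyStochastic_iff_sum]
    refine ⟨?_, ?_, ?_⟩
    · rintro (s | t) (s' | t')
      · simp only [M, Matrix.fromBlocks_apply₁₁, Matrix.diagonal_apply]
        split_ifs
        · linarith [hrow s]
        · exact le_rfl
      · exact hd _ _
      · exact hd _ _
      · simp only [M, Matrix.fromBlocks_apply₂₂, Matrix.diagonal_apply]
        split_ifs
        · linarith [hcol t]
        · exact le_rfl
    · rintro (s | t) <;> simp [M, Fintype.sum_sum_type, Matrix.diagonal_apply]
    · rintro (s | t) <;> simp [M, Fintype.sum_sum_type, Matrix.diagonal_apply]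
  obtain ⟨q, hq0, hq1, hq⟩ := exists_eq_sum_perm_of_mem_doublyStochastic hM
  have happ : ∀ x y, ∑ σ : Equiv.Perm (S ⊕ T), (if σ x = y then q σ else 0) = M x y := by
    intro x y
    rw [← hq, Matrix.sum_apply]
    refine Finset.sum_congr rfl fun σ _ => ?_
    simp [Matrix.smul_apply, Equiv.Perm.permMatrix, PEquiv.toMatrix_apply, eq_comm]
  refine ⟨q, hq0, hq1, fun s t => happ _ _, fun σ t hσ ht => ?_⟩
  -- A target index with full column sum has a zero row in the lower right block, so no permutation
  -- of positive weight leaves it unmatched.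
  rcases h : σ (Sum.inr t) with s | t'
  · exact ⟨s, rfl⟩
  · exfalso
    have h1 := happ (Sum.inr t) (Sum.inr t')
    have h2 : M (Sum.inr t) (Sum.inr t') = 0 := by
      simp only [M, Matrix.fromBlocks_apply₂₂, Matrix.diagonal_apply]
      split_ifs
      · rw [ht, sub_self]
      · rfl
    rw [h2, Finset.sum_eq_zero_iff_of_nonneg] at h1
    · exact hσ (by simpa [h] using h1 σ (Finset.mem_univ _))
    · intro σ _
      split_ifs
      · exact hq0 σ
      · exact le_rfl

/-! ### Transport from source to target within number sectors. -/

section transport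

variable {A B A' B' : LocalSystem} {ψ : BiVec A B} {χ : BiVec A' B'} {I J : ℕ}

/-- The weight, within the set `U` of Schmidt vectors, of Alice's particle number `z`. -/
def Schmidt.mass (F : Schmidt ψ I) (U : Finset F.S) (z : ℤ) : ℝ :=
  ∑ s ∈ U with (F.n s : ℤ) = z, F.w s

theorem Schmidt.mass_nonneg (F : Schmidt ψ I) (U : Finset F.S) (z : ℤ) : 0 ≤ F.mass U z :=
  Finset.sum_nonneg fun s _ => F.w_nonneg s

/-- A target vector `t` is matched to a source vector `s` of the corresponding sector with
probability `w s / mass`. Then every target vector whose source sector has mass is matched, and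
`hcond` says exactly that the row sums are at most one. Within a sector the weighting reproduces the
target amplitudes up to a constant, so only the sector masses are felt. The label `r` is a recorded
outcome, hence squares are added over `r`, while the sectors `z` stay in coherent superposition. -/
theorem Schmidt.exists_protocol_sectors (F : Schmidt ψ I) (G : Schmidt χ J) (oA : A'.ι)
    (oB : B'.ι) (s₀ : F.S) {R : Type} [Fintype R] (U : R → Finset F.S)
    (hU : ∀ r r' s, s ∈ U r → s ∈ U r' → r = r') (V : Finset G.S) (Δ : R → ℤ)
    (hcond : ∀ r, ∀ s ∈ U r, ((V.filter fun t => (G.n t : ℤ) = F.n s + Δ r).card : ℝ) * F.w s ≤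
      F.mass (U r) (F.n s)) :
    ∃ P : Protocol A' B' A B,
      ∑ r, (∑ z ∈ V.image fun t => (G.n t : ℤ),
        Real.sqrt (F.mass (U r) (z - Δ r) * G.mass V z)) ^ 2 ≤ P.fidelity ψ χ := by
  classical
  let d : R → F.S → G.S → ℝ := fun r s t =>
    if s ∈ U r ∧ t ∈ V ∧ (G.n t : ℤ) = F.n s + Δ r then F.w s / F.mass (U r) (F.n s) else 0
  have hd : ∀ r s t, 0 ≤ d r s t := by
    intro r s t
    simp only [d]
    split_ifs
    · exact div_nonneg (F.w_nonneg s) (F.mass_nonneg _ _)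
    · exact le_rfl
  have hrow : ∀ r s, ∑ t, d r s t ≤ 1 := by
    intro r s
    by_cases hs : s ∈ U r
    · have : ∑ t, d r s t = ((V.filter fun t => (G.n t : ℤ) = F.n s + Δ r).card : ℝ) * F.w s /
          F.mass (U r) (F.n s) := by
        simp only [d, hs, true_and]
        rw [← Finset.sum_filter, Finset.sum_const, nsmul_eq_mul, mul_div_assoc]
        congr 3
        ext t
        simp
      rw [this]
      exact div_le_one_of_le₀ (hcond r s hs) (F.mass_nonneg _ _)
    · simp [d, hs]
  have hcol' : ∀ r t, t ∈ V → ∑ s, d r s t =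
      F.mass (U r) (G.n t - Δ r) / F.mass (U r) (G.n t - Δ r) := by
    intro r t ht
    simp only [d, ht, true_and]
    rw [← Finset.sum_filter, Schmidt.mass, Finset.sum_div]
    have : (Finset.univ.filter fun s => s ∈ U r ∧ (G.n t : ℤ) = F.n s + Δ r)
        = (U r).filter fun s => (F.n s : ℤ) = G.n t - Δ r := by
      ext s
      simp only [Finset.mem_filter, Finset.mem_univ, true_and]
      refine and_congr_right fun _ => ⟨fun h => by omega, fun h => by omega⟩
    rw [this]
    refine Finset.sum_congr rfl fun s hs => ?_
    rw [Finset.mem_filter] at hs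
    simp only [Schmidt.mass, hs.2]
  have hcol : ∀ r t, ∑ s, d r s t ≤ 1 := by
    intro r t
    by_cases ht : t ∈ V
    · rw [hcol' r t ht]; exact div_self_le_one _
    · simp [d, ht]
  have hq := fun r => exists_random_injection (d r) (hd r) (hrow r) (hcol r)
  choose q hq0 hq1 hqd hqc using hq
  let f : R × Equiv.Perm (F.S ⊕ G.S) → G.S → F.S := fun ω t =>
    Sum.elim id (fun _ => s₀) (ω.2 (Sum.inr t))
  let D : R × Equiv.Perm (F.S ⊕ G.S) → Finset G.S := fun ω =>
    V.filter fun t => q ω.1 ω.2 ≠ 0 ∧ ∃ s, ω.2 (Sum.inr t) = Sum.inl s ∧ d ω.1 s t ≠ 0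
  have hDf : ∀ ω t, t ∈ D ω → ω.2 (Sum.inr t) = Sum.inl (f ω t) ∧ d ω.1 (f ω t) t ≠ 0 := by
    intro ω t ht
    obtain ⟨-, -, s, hs, hs'⟩ := Finset.mem_filter.1 ht
    simp only [f, hs, Sum.elim_inl, id]
    exact ⟨trivial, hs'⟩
  have hdU : ∀ r s t, d r s t ≠ 0 → s ∈ U r ∧ t ∈ V ∧ (G.n t : ℤ) = F.n s + Δ r ∧ 0 < F.w s ∧
      0 < F.mass (U r) (F.n s) ∧ d r s t = F.w s / F.mass (U r) (F.n s) := by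
    intro r s t h
    by_cases h1 : s ∈ U r ∧ t ∈ V ∧ (G.n t : ℤ) = F.n s + Δ r
    · have h2 : d r s t = F.w s / F.mass (U r) (F.n s) := if_pos h1
      rw [h2] at h
      exact ⟨h1.1, h1.2.1, h1.2.2,
        lt_of_le_of_ne (F.w_nonneg s) (fun h3 => h (by rw [← h3, zero_div])),
        lt_of_le_of_ne (F.mass_nonneg _ _) (fun h3 => h (by rw [← h3, div_zero])), h2⟩
    · exact absurd (if_neg h1) h
  -- Chosen so that `κ * √(w s)` is proportional to `√(w t)` within a sector, times the square root
  -- of the probability of the permutation. With this normalization the total of `κ ^ 2` over all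
  -- matches of `s` is at most `∑ w t / mass V` over its target sector, hence at most 1.
  let κ : R × Equiv.Perm (F.S ⊕ G.S) → G.S → ℝ := fun ω t =>
    Real.sqrt (q ω.1 ω.2) * Real.sqrt (G.w t * F.mass (U ω.1) (F.n (f ω t)) /
      (F.w (f ω t) * G.mass V (G.n t)))
  have hκsq : ∀ ω t, κ ω t ^ 2 = q ω.1 ω.2 * (G.w t * F.mass (U ω.1) (F.n (f ω t)) /
      (F.w (f ω t) * G.mass V (G.n t))) := by
    intro ω t
    simp only [κ]
    rw [mul_pow, Real.sq_sqrt (hq0 _ _), Real.sq_sqrt]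
    exact div_nonneg (mul_nonneg (G.w_nonneg _) (F.mass_nonneg _ _))
      (mul_nonneg (F.w_nonneg _) (G.mass_nonneg _ _))
  have hinj : ∀ ω, Set.InjOn (f ω) (D ω) := by
    intro ω t ht t' ht' h
    have h1 := (hDf ω t ht).1
    have h2 := (hDf ω t' ht').1
    rw [h, ← h2] at h1
    exact Sum.inr_injective (ω.2.injective h1)
  have hshift : ∀ ω, ∀ t ∈ D ω, (G.n t : ℤ) = F.n (f ω t) + Δ ω.1 := by
    intro ω t ht
    exact (hdU _ _ _ (hDf ω t ht).2).2.2.1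
  have hκ : ∀ s, ∑ ω, ∑ t ∈ D ω, (if f ω t = s then κ ω t ^ 2 else 0) ≤ 1 := by
    intro s
    rw [Fintype.sum_prod_type]
    have h1 : ∀ r, ∑ σ, ∑ t ∈ D (r, σ), (if f (r, σ) t = s then κ (r, σ) t ^ 2 else 0) ≤
        if s ∈ U r then 1 else 0 := by
      intro r
      have h2 : ∀ σ, ∑ t ∈ D (r, σ), (if f (r, σ) t = s then κ (r, σ) t ^ 2 else 0) ≤
          ∑ t, if d r s t ≠ 0 ∧ σ (Sum.inr t) = Sum.inl s then
            q r σ * (G.w t * F.mass (U r) (F.n s) / (F.w s * G.mass V (G.n t))) else 0 := by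
        intro σ
        refine (Finset.sum_le_sum (g := fun t => if d r s t ≠ 0 ∧ σ (Sum.inr t) = Sum.inl s then
            q r σ * (G.w t * F.mass (U r) (F.n s) / (F.w s * G.mass V (G.n t))) else 0)
            fun t ht => ?_).trans
          (Finset.sum_le_sum_of_subset_of_nonneg (Finset.subset_univ _) fun t _ _ => ?_)
        · obtain ⟨h3, h4⟩ := hDf _ t ht
          by_cases h5 : f (r, σ) t = s
          · rw [if_pos h5]
            rw [h5] at h3 h4
            rw [if_pos ⟨h4, h3⟩, hκsq, h5]
          · rw [if_neg h5]
            split_ifs with h6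
            · exact absurd (Sum.inl_injective (h3.symm.trans h6.2)) h5
            · exact le_rfl
        · split_ifs
          · exact mul_nonneg (hq0 _ _) (div_nonneg (mul_nonneg (G.w_nonneg _) (F.mass_nonneg _ _))
              (mul_nonneg (F.w_nonneg _) (G.mass_nonneg _ _)))
          · exact le_rfl
      refine (Finset.sum_le_sum fun σ _ => h2 σ).trans ?_
      rw [Finset.sum_comm]
      by_cases hs : s ∈ U r
      · rw [if_pos hs]
        have h3 : ∀ t, (∑ σ, if d r s t ≠ 0 ∧ σ (Sum.inr t) = Sum.inl s then
            q r σ * (G.w t * F.mass (U r) (F.n s) / (F.w s * G.mass V (G.n t))) else 0) ≤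
            if t ∈ V ∧ (G.n t : ℤ) = F.n s + Δ r then
              G.w t / G.mass V (F.n s + Δ r) else 0 := by
          intro t
          by_cases hd0 : d r s t = 0
          · simp only [hd0, ne_eq, not_true_eq_false, false_and, if_false, Finset.sum_const_zero]
            split_ifs
            · exact div_nonneg (G.w_nonneg _) (G.mass_nonneg _ _)
            · exact le_rfl
          · obtain ⟨-, h4, h5, h6, h7, h8⟩ := hdU _ _ _ hd0
            rw [if_pos ⟨h4, h5⟩]
            have h9 : ∀ σ, (if d r s t ≠ 0 ∧ σ (Sum.inr t) = Sum.inl s then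
              q r σ * (G.w t * F.mass (U r) (F.n s) / (F.w s * G.mass V (G.n t))) else 0) =
              (if σ (Sum.inr t) = Sum.inl s then q r σ else 0) *
                (G.w t * F.mass (U r) (F.n s) / (F.w s * G.mass V (G.n t))) := by
              intro σ
              by_cases h10 : σ (Sum.inr t) = Sum.inl s <;> simp [h10, hd0]
            rw [Finset.sum_congr rfl fun σ _ => h9 σ, ← Finset.sum_mul, hqd, h8, h5]
            apply le_of_eq
            field_simp
        refine (Finset.sum_le_sum fun t _ => h3 t).trans ?_
        rw [← Finset.sum_filter]
        have : (Finset.univ.filter fun t => t ∈ V ∧ (G.n t : ℤ) = F.n s + Δ r)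
          = V.filter fun t => (G.n t : ℤ) = F.n s + Δ r := by ext; simp
        rw [this, ← Finset.sum_div]
        exact div_self_le_one _
      · rw [if_neg hs]
        refine Finset.sum_nonpos fun t _ => Finset.sum_nonpos fun σ _ => ?_
        rw [if_neg]
        rintro ⟨h3, -⟩
        exact hs (hdU _ _ _ h3).1
    refine (Finset.sum_le_sum fun r _ => h1 r).trans ?_
    rw [← Finset.sum_filter, Finset.sum_const, nsmul_eq_mul, mul_one]
    have : (Finset.univ.filter fun r => s ∈ U r).card ≤ 1 := by
      rw [Finset.card_le_one]
      intro r hr r' hr'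
      exact hU r r' s (Finset.mem_filter.1 hr).2 (Finset.mem_filter.1 hr').2
    exact_mod_cast this
  obtain ⟨P, hP⟩ := F.exists_protocol G oA oB D f hinj κ (fun ω => Δ ω.1) hshift hκ
  refine ⟨P, le_trans (le_of_eq ?_) hP⟩
  rw [Fintype.sum_prod_type]
  refine Finset.sum_congr rfl fun r _ => ?_
  -- The amplitude depends on `σ` only through `√(q r σ)`: every permutation of positive weight
  -- matches all target vectors whose source sector has mass, and the others contribute zero.
  have key : ∀ σ, q r σ ≠ 0 → (∑ t ∈ D (r, σ), κ (r, σ) t * Real.sqrt (F.w (f (r, σ) t)) *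
      Real.sqrt (G.w t)) = Real.sqrt (q r σ) * ∑ z ∈ V.image fun t => (G.n t : ℤ),
      Real.sqrt (F.mass (U r) (z - Δ r) * G.mass V z) := by
    intro σ hσ
    have h1 : ∀ z ∈ V.image (fun t => (G.n t : ℤ)),
        Real.sqrt (F.mass (U r) (z - Δ r) * G.mass V z) =
        ∑ t ∈ V with (G.n t : ℤ) = z,
          G.w t * Real.sqrt (F.mass (U r) (G.n t - Δ r) / G.mass V (G.n t)) := by
      intro z _
      have : ∑ t ∈ V with (G.n t : ℤ) = z,
          G.w t * Real.sqrt (F.mass (U r) (G.n t - Δ r) / G.mass V (G.n t)) =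
          G.mass V z * Real.sqrt (F.mass (U r) (z - Δ r) / G.mass V z) := by
        rw [Schmidt.mass, Finset.sum_mul]
        refine Finset.sum_congr rfl fun t ht => ?_
        rw [(Finset.mem_filter.1 ht).2]
        rfl
      rw [this, Real.sqrt_div (F.mass_nonneg _ _), Real.sqrt_mul (F.mass_nonneg _ _)]
      rcases eq_or_lt_of_le (G.mass_nonneg V z) with h | h
      · simp [← h]
      · have h2 := Real.mul_self_sqrt h.le
        have h3 := (Real.sqrt_pos.2 h).ne'
        field_simp
        rw [← h2]; simp [pow_two]
    rw [Finset.sum_congr rfl h1, Finset.sum_fiberwise_of_maps_to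
      (fun t ht => Finset.mem_image_of_mem (fun t => (G.n t : ℤ)) ht), Finset.mul_sum]
    have hsub : D (r, σ) ⊆ V := Finset.filter_subset _ _
    rw [← Finset.sum_subset hsub]
    · refine Finset.sum_congr rfl fun t ht => ?_
      obtain ⟨h2, h3⟩ := hDf _ t ht
      obtain ⟨-, -, h4, h5, h6, -⟩ := hdU _ _ _ h3
      have h7 : (G.n t : ℤ) - Δ r = F.n (f (r, σ) t) := by rw [h4]; ring
      simp only [κ]
      rw [h7, Real.sqrt_div (mul_nonneg (G.w_nonneg _) h6.le), Real.sqrt_mul (G.w_nonneg _),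
        Real.sqrt_mul h5.le, Real.sqrt_div h6.le]
      have h8 := (Real.sqrt_pos.2 h5).ne'
      have h9 := Real.mul_self_sqrt (G.w_nonneg t)
      field_simp
      rw [← h9]; simp [pow_two]
    · intro t ht htD
      have h0 : F.mass (U r) (G.n t - Δ r) = 0 := by
        by_contra hne
        apply htD
        have h2 : ∑ s, d r s t = 1 := by rw [hcol' r t ht, div_self hne]
        obtain ⟨s, hs⟩ := hqc r σ t hσ h2
        refine Finset.mem_filter.2 ⟨ht, hσ, s, hs, ?_⟩
        rw [← hqd r s t]
        refine (Finset.sum_pos' (fun σ _ => ?_) ⟨σ, Finset.mem_univ _, ?_⟩).ne'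
        · split_ifs
          · exact hq0 _ _
          · exact le_rfl
        · rw [if_pos hs]; exact lt_of_le_of_ne (hq0 _ _) hσ.symm
      simp [h0]
  have key2 : ∀ σ, (∑ t ∈ D (r, σ), κ (r, σ) t * Real.sqrt (F.w (f (r, σ) t)) *
      Real.sqrt (G.w t)) ^ 2 = q r σ * (∑ z ∈ V.image fun t => (G.n t : ℤ),
      Real.sqrt (F.mass (U r) (z - Δ r) * G.mass V z)) ^ 2 := by
    intro σ
    by_cases hσ : q r σ = 0
    · simp [D, hσ]
    · rw [key σ hσ, mul_pow, Real.sq_sqrt (hq0 _ _)]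
  rw [Finset.sum_congr rfl fun σ _ => key2 σ, ← Finset.sum_mul, hq1, one_mul]

end transport

end SSR

namespace SSR

open LaurentPolynomial AddMonoidAlgebra

/-! ### Laurent polynomials as finitely supported signed laws on the integers -/

/-- The `ℓ¹` norm of the coefficients. -/
def l1 (p : ℝ[T;T⁻¹]) : ℝ := p.coeff.sum fun _ c => |c|

theorem l1_eq_sum (p : ℝ[T;T⁻¹]) (s : Finset ℤ) (h : p.coeff.support ⊆ s) :
    l1 p = ∑ z ∈ s, |p.coeff z| :=
  Finsupp.sum_of_support_subset _ h _ (by simp)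

theorem sum_abs_coeff_le_l1 (p : ℝ[T;T⁻¹]) (s : Finset ℤ) : ∑ z ∈ s, |p.coeff z| ≤ l1 p := by
  rw [l1_eq_sum p (p.coeff.support ∪ s) Finset.subset_union_left]
  exact Finset.sum_le_sum_of_subset_of_nonneg Finset.subset_union_right fun _ _ _ => abs_nonneg _

theorem l1_nonneg (p : ℝ[T;T⁻¹]) : 0 ≤ l1 p := Finset.sum_nonneg fun _ _ => abs_nonneg _

theorem l1_zero : l1 0 = 0 := by simp [l1]

theorem l1_add_le (p q : ℝ[T;T⁻¹]) : l1 (p + q) ≤ l1 p + l1 q := by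
  classical
  have h := Finsupp.support_add (g₁ := p.coeff) (g₂ := q.coeff)
  rw [l1_eq_sum (p + q) _ (by simpa using h), l1_eq_sum p _ Finset.subset_union_left,
    l1_eq_sum q _ Finset.subset_union_right, ← Finset.sum_add_distrib]
  exact Finset.sum_le_sum fun z _ => by simpa using abs_add_le _ _

theorem l1_neg (p : ℝ[T;T⁻¹]) : l1 (-p) = l1 p := by
  simp [l1, Finsupp.sum]

theorem l1_sub_le (p q : ℝ[T;T⁻¹]) : l1 (p - q) ≤ l1 p + l1 q := by
  rw [sub_eq_add_neg, ← l1_neg q]; exact l1_add_le _ _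

theorem l1_sub_comm (p q : ℝ[T;T⁻¹]) : l1 (p - q) = l1 (q - p) := by
  rw [← l1_neg, neg_sub]

theorem l1_triangle (p q r : ℝ[T;T⁻¹]) : l1 (p - r) ≤ l1 (p - q) + l1 (q - r) := by
  rw [← sub_add_sub_cancel p q r]; exact l1_add_le _ _

theorem l1_sum_le {ι : Type*} (s : Finset ι) (p : ι → ℝ[T;T⁻¹]) :
    l1 (∑ i ∈ s, p i) ≤ ∑ i ∈ s, l1 (p i) := by
  classical
  induction s using Finset.induction_on with
  | empty => simp [l1_zero]
  | insert a s ha ih =>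
    rw [Finset.sum_insert ha, Finset.sum_insert ha]
    exact (l1_add_le _ _).trans (by gcongr)

theorem l1_single (z : ℤ) (c : ℝ) : l1 (single z c) = |c| := by
  rw [l1, AddMonoidAlgebra.coeff_single, Finsupp.sum_single_index abs_zero]

theorem l1_T (z : ℤ) : l1 (T z) = 1 := by rw [T, l1_single, abs_one]

theorem l1_mul_le (p q : ℝ[T;T⁻¹]) : l1 (p * q) ≤ l1 p * l1 q := by
  rw [AddMonoidAlgebra.mul_def, Finsupp.sum]
  refine (l1_sum_le _ _).trans ?_
  rw [l1, Finsupp.sum, Finset.sum_mul]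
  refine Finset.sum_le_sum fun z _ => ?_
  rw [Finsupp.sum]
  refine (l1_sum_le _ _).trans ?_
  rw [l1, Finsupp.sum, Finset.mul_sum]
  exact Finset.sum_le_sum fun z' _ => by rw [l1_single, abs_mul]

theorem l1_smul (c : ℝ) (p : ℝ[T;T⁻¹]) : l1 (c • p) = |c| * l1 p := by
  by_cases hc : c = 0
  · simp [hc, l1_zero]
  · rw [l1_eq_sum (c • p) p.coeff.support (by
      rw [AddMonoidAlgebra.coeff_smul]; exact Finsupp.support_smul), l1, Finsupp.sum, Finset.mul_sum]
    exact Finset.sum_congr rfl fun z _ => by simp [abs_mul]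

theorem l1_T_mul (z : ℤ) (p : ℝ[T;T⁻¹]) : l1 (T z * p) = l1 p := by
  apply le_antisymm
  · exact (l1_mul_le _ _).trans (le_of_eq (by rw [l1_T, one_mul]))
  · have h : T (-z) * (T z * p) = p := by rw [← mul_assoc, ← T_add]; simp
    calc l1 p = l1 (T (-z) * (T z * p)) := by rw [h]
      _ ≤ l1 (T (-z)) * l1 (T z * p) := l1_mul_le _ _
      _ = _ := by rw [l1_T, one_mul]

theorem coeff_T_mul (m : ℤ) (p : ℝ[T;T⁻¹]) (z : ℤ) : (T m * p).coeff z = p.coeff (z - m) := by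
  rw [T, AddMonoidAlgebra.coeff_single_mul_eq_mul_coeff (z - m), one_mul]
  intro m' _
  constructor <;> intro h <;> omega

/-- The law of `n` under the (signed) weights `w`. -/
def law {S : Type*} [Fintype S] (w : S → ℝ) (n : S → ℤ) : ℝ[T;T⁻¹] := ∑ s, single (n s) (w s)

theorem coeff_law {S : Type*} [Fintype S] (w : S → ℝ) (n : S → ℤ) (z : ℤ) :
    (law w n).coeff z = ∑ s with n s = z, w s := by
  classical
  simp [law, Finsupp.single_apply, Finset.sum_filter, -single_eq_C_mul_T]

theorem l1_law_le {S : Type*} [Fintype S] (w : S → ℝ) (n : S → ℤ) :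
    l1 (law w n) ≤ ∑ s, |w s| := by
  refine (l1_sum_le _ _).trans (le_of_eq ?_)
  simp only [l1_single]

theorem law_mul {S S' : Type*} [Fintype S] [Fintype S'] (w : S → ℝ) (n : S → ℤ) (w' : S' → ℝ)
    (n' : S' → ℤ) :
    law (fun p : S × S' => w p.1 * w' p.2) (fun p => n p.1 + n' p.2) = law w n * law w' n' := by
  simp only [law, Finset.sum_mul_sum, Fintype.sum_prod_type, AddMonoidAlgebra.single_mul_single]

theorem prod_single {ι : Type*} (s : Finset ι) (z : ι → ℤ) (c : ι → ℝ) :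
    ∏ i ∈ s, (single (z i) (c i) : ℝ[T;T⁻¹]) = single (∑ i ∈ s, z i) (∏ i ∈ s, c i) := by
  classical
  induction s using Finset.induction_on with
  | empty => rfl
  | insert a s ha ih =>
    rw [Finset.sum_insert ha, Finset.prod_insert ha, Finset.prod_insert ha, ih,
      AddMonoidAlgebra.single_mul_single]

theorem prod_law {S : Type*} [Fintype S] {N : ℕ} (w : Fin N → S → ℝ) (n : S → ℤ) :
    law (fun s : Fin N → S => ∏ i, w i (s i)) (fun s => ∑ i, n (s i)) = ∏ i, law (w i) n := by
  classical
  simp only [law]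
  rw [Finset.prod_univ_sum, Fintype.piFinset_univ]
  exact Finset.sum_congr rfl fun s _ => (prod_single _ _ _).symm

theorem law_pow {S : Type*} [Fintype S] (N : ℕ) (w : S → ℝ) (n : S → ℤ) :
    law (fun s : Fin N → S => ∏ i, w (s i)) (fun s => ∑ i, n (s i)) = law w n ^ N := by
  rw [prod_law (fun _ => w) n]; simp

theorem law_sum {S ι : Type*} [Fintype S] (t : Finset ι) (w : ι → S → ℝ) (n : S → ℤ) :
    law (fun s => ∑ i ∈ t, w i s) n = ∑ i ∈ t, law (w i) n := by
  classical
  simp only [law]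
  rw [Finset.sum_comm]
  refine Finset.sum_congr rfl fun s _ => ?_
  exact map_sum (AddMonoidAlgebra.singleAddHom (n s)) _ _

/-! ### Moments of sums of independent variables -/

section moments

variable {S : Type*} [Fintype S]

theorem sum_fin_succ_pi {N : ℕ} (w : S → ℝ) (F : (Fin (N + 1) → S) → ℝ) :
    ∑ s : Fin (N + 1) → S, (∏ i, w (s i)) * F s =
      ∑ x, w x * ∑ s : Fin N → S, (∏ i, w (s i)) * F (Fin.cons x s) := by
  rw [← Equiv.sum_comp (Fin.consEquiv fun _ => S), Fintype.sum_prod_type]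
  refine Finset.sum_congr rfl fun x _ => ?_
  rw [Finset.mul_sum]
  refine Finset.sum_congr rfl fun s _ => ?_
  simp [Fin.consEquiv, Fin.prod_univ_succ, mul_assoc]

theorem sum_prod_pi (w : S → ℝ) (hw : ∑ s, w s = 1) (N : ℕ) :
    ∑ s : Fin N → S, ∏ i, w (s i) = 1 := by
  have := Finset.prod_univ_sum (fun _ : Fin N => (Finset.univ : Finset S)) (fun _ s => w s)
  rw [Fintype.piFinset_univ] at this
  rw [← this, hw]; simp

theorem sum_prod_pi_mul_sum (w : S → ℝ) (hw : ∑ s, w s = 1) (u : S → ℝ) (N : ℕ) :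
    ∑ s : Fin N → S, (∏ i, w (s i)) * ∑ i, u (s i) = N * ∑ s, w s * u s := by
  induction N with
  | zero => simp
  | succ N ih =>
    rw [sum_fin_succ_pi]
    simp only [Fin.sum_univ_succ, Fin.cons_zero, Fin.cons_succ, mul_add, Finset.sum_add_distrib, ih,
      ← Finset.sum_mul, sum_prod_pi w hw, hw, one_mul]
    push_cast; ring

theorem sum_prod_pi_mul_sum_sq (w : S → ℝ) (hw : ∑ s, w s = 1) (u : S → ℝ) (N : ℕ) :
    ∑ s : Fin N → S, (∏ i, w (s i)) * (∑ i, u (s i)) ^ 2 =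
      N * (∑ s, w s * u s ^ 2 - (∑ s, w s * u s) ^ 2) + (N * ∑ s, w s * u s) ^ 2 := by
  induction N with
  | zero => simp
  | succ N ih =>
    rw [sum_fin_succ_pi]
    have h : ∀ x, w x * ∑ s : Fin N → S, (∏ i, w (s i)) *
        (∑ i, u ((Fin.cons x s : Fin (N + 1) → S) i)) ^ 2 =
        w x * u x ^ 2 + w x * u x * (2 * (N * ∑ s, w s * u s)) +
          w x * ∑ s : Fin N → S, (∏ i, w (s i)) * (∑ i, u (s i)) ^ 2 := by
      intro x
      rw [← sum_prod_pi_mul_sum w hw u N]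
      simp only [Fin.sum_univ_succ, Fin.cons_zero, Fin.cons_succ]
      have h1 : ∑ s : Fin N → S, (∏ i, w (s i)) * (u x + ∑ i, u (s i)) ^ 2 =
          u x ^ 2 * ∑ s : Fin N → S, (∏ i, w (s i)) +
          2 * u x * ∑ s : Fin N → S, (∏ i, w (s i)) * ∑ i, u (s i) +
          ∑ s : Fin N → S, (∏ i, w (s i)) * (∑ i, u (s i)) ^ 2 := by
        rw [Finset.mul_sum, Finset.mul_sum, ← Finset.sum_add_distrib, ← Finset.sum_add_distrib]
        exact Finset.sum_congr rfl fun s _ => by ring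
      rw [h1, sum_prod_pi w hw]; ring
    rw [Finset.sum_congr rfl fun x _ => h x, Finset.sum_add_distrib, Finset.sum_add_distrib,
      ← Finset.sum_mul, ← Finset.sum_mul, hw, ih]
    push_cast; ring

theorem sum_mul_abs_le (w : S → ℝ) (hw0 : ∀ s, 0 ≤ w s) (hw : ∑ s, w s = 1) (u : S → ℝ) :
    ∑ s, w s * |u s| ≤ Real.sqrt (∑ s, w s * u s ^ 2) := by
  apply Real.le_sqrt_of_sq_le
  calc (∑ s, w s * |u s|) ^ 2 ≤ (∑ s, w s) * ∑ s, w s * u s ^ 2 := by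
        refine Finset.sum_sq_le_sum_mul_sum_of_sq_le_mul _ (fun s _ => hw0 s)
          (fun s _ => mul_nonneg (hw0 s) (sq_nonneg _)) fun s _ => le_of_eq ?_
        rw [mul_pow, sq_abs]; ring
    _ = _ := by rw [hw, one_mul]

/-- Chebyshev's inequality for sums of independent variables. -/
theorem chebyshev_pi (w : S → ℝ) (hw0 : ∀ s, 0 ≤ w s) (hw : ∑ s, w s = 1) (u : S → ℝ) (N : ℕ)
    (t : ℝ) (ht : 0 < t) :
    ∑ s : Fin N → S with t < |∑ i, u (s i) - N * ∑ s, w s * u s|, ∏ i, w (s i) ≤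
      N * (∑ s, w s * u s ^ 2 - (∑ s, w s * u s) ^ 2) / t ^ 2 := by
  set m := ∑ s, w s * u s with hm
  have hprod : ∀ s : Fin N → S, 0 ≤ ∏ i, w (s i) := fun s => Finset.prod_nonneg fun i _ => hw0 _
  have h1 : ∑ s : Fin N → S, (∏ i, w (s i)) * (∑ i, u (s i) - N * m) ^ 2 =
      N * (∑ s, w s * u s ^ 2 - m ^ 2) := by
    have h2 : ∀ s : Fin N → S, (∏ i, w (s i)) * (∑ i, u (s i) - N * m) ^ 2 =
        (∏ i, w (s i)) * (∑ i, u (s i)) ^ 2 - 2 * (N * m) * ((∏ i, w (s i)) * ∑ i, u (s i))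
          + (N * m) ^ 2 * ∏ i, w (s i) := fun s => by ring
    rw [Finset.sum_congr rfl fun s _ => h2 s, Finset.sum_add_distrib, Finset.sum_sub_distrib,
      ← Finset.mul_sum, ← Finset.mul_sum, sum_prod_pi w hw, sum_prod_pi_mul_sum w hw,
      sum_prod_pi_mul_sum_sq w hw, ← hm]
    ring
  rw [le_div_iff₀ (by positivity), ← h1, Finset.sum_mul, Finset.sum_filter]
  refine Finset.sum_le_sum fun s _ => ?_
  split_ifs with h
  · refine mul_le_mul_of_nonneg_left ?_ (hprod s)
    rw [← sq_abs (_ - _)]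
    exact pow_le_pow_left₀ ht.le h.le 2
  · exact mul_nonneg (hprod s) (sq_nonneg _)

end moments

/-! ### Smoothness of the laws of sums of independent variables -/

section smooth

variable {S : Type*} [Fintype S]

/-- The summand `u (s i)` reweights the `i`-th factor alone, and all `N + 1` positions give the same
product. -/
theorem law_prod_mul_sum (w u : S → ℝ) (n : S → ℤ) (N : ℕ) :
    law (fun s : Fin (N + 1) → S => (∏ i, w (s i)) * ∑ i, u (s i)) (fun s => ∑ i, n (s i)) =
      ((N + 1 : ℕ) : ℝ) • (law (fun s => w s * u s) n * law w n ^ N) := by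
  classical
  have h : ∀ s : Fin (N + 1) → S, (∏ i, w (s i)) * ∑ i, u (s i) =
      ∑ i, ∏ j, (if j = i then w (s j) * u (s j) else w (s j)) := by
    intro s
    rw [Finset.mul_sum]
    refine Finset.sum_congr rfl fun i _ => ?_
    rw [← Finset.mul_prod_erase _ _ (Finset.mem_univ i), ← Finset.mul_prod_erase _ _
      (Finset.mem_univ i), if_pos rfl]
    have : ∏ j ∈ Finset.univ.erase i, (if j = i then w (s j) * u (s j) else w (s j)) =
        ∏ j ∈ Finset.univ.erase i, w (s j) :=
      Finset.prod_congr rfl fun j hj => if_neg (Finset.ne_of_mem_erase hj)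
    rw [this]; ring
  simp only [h]
  rw [law_sum]
  have h2 : ∀ i : Fin (N + 1),
      law (fun s : Fin (N + 1) → S => ∏ j, (if j = i then w (s j) * u (s j) else w (s j)))
        (fun s => ∑ i, n (s i)) = law (fun s => w s * u s) n * law w n ^ N := by
    intro i
    rw [prod_law (fun j s => if j = i then w s * u s else w s) n,
      ← Finset.mul_prod_erase _ _ (Finset.mem_univ i)]
    congr 1
    · simp
    · have : ∀ j ∈ Finset.univ.erase i, law (fun s => if j = i then w s * u s else w s) n =
          law w n := fun j hj => by simp only [if_neg (Finset.ne_of_mem_erase hj)]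
      rw [Finset.prod_congr rfl this]; simp
  rw [Finset.sum_congr rfl fun i _ => h2 i]
  rw [Finset.sum_const, Finset.card_univ, Fintype.card_fin, Nat.cast_smul_eq_nsmul]

/-- `N + 1` times the left side is at most the mean of `|∑ u (s i)|` over `N + 1` independent terms.
As `u` is centred, this is bounded by a standard deviation of order `√(N + 1)`. -/
theorem l1_mul_law_pow_le (w : S → ℝ) (hw0 : ∀ s, 0 ≤ w s) (hw : ∑ s, w s = 1) (u : S → ℝ)
    (hu : ∑ s, w s * u s = 0) (n : S → ℤ) (N : ℕ) :
    l1 (law (fun s => w s * u s) n * law w n ^ N) ≤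
      Real.sqrt (∑ s, w s * u s ^ 2) / Real.sqrt (N + 1) := by
  have h1 := law_prod_mul_sum w u n N
  have hN : (0 : ℝ) < (N + 1 : ℕ) := by positivity
  have h2 : ((N + 1 : ℕ) : ℝ) * l1 (law (fun s => w s * u s) n * law w n ^ N) ≤
      Real.sqrt ((N + 1 : ℕ) * ∑ s, w s * u s ^ 2) := by
    rw [← abs_of_pos hN, ← l1_smul, ← h1, abs_of_pos hN]
    refine (l1_law_le _ _).trans ?_
    have h3 := sum_mul_abs_le (fun s : Fin (N + 1) → S => ∏ i, w (s i))
      (fun s => Finset.prod_nonneg fun i _ => hw0 _) (sum_prod_pi w hw _)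
      (fun s => ∑ i, u (s i))
    rw [sum_prod_pi_mul_sum_sq w hw, hu] at h3
    simp only [mul_zero, ne_eq, OfNat.ofNat_ne_zero, not_false_eq_true, zero_pow, sub_zero,
      add_zero] at h3
    refine le_trans (le_of_eq (Finset.sum_congr rfl fun s _ => ?_)) h3
    rw [abs_mul, abs_of_nonneg (Finset.prod_nonneg fun i _ => hw0 _)]
  rw [Real.sqrt_mul hN.le] at h2
  push_cast at h2 hN
  have h4 := Real.mul_self_sqrt hN.le
  have h5 := Real.sqrt_pos.2 hN
  rw [le_div_iff₀ h5]
  refine le_of_mul_le_mul_left (le_trans (le_of_eq ?_) h2) h5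
  linear_combination (l1 (law (fun s => w s * u s) n * law w n ^ N)) * h4

/-- Take `u` equal to `1 / w s` at `s`, to `-1 / w s'` at `s'`, and zero elsewhere. It is centred,
and the law reweighted by it is the difference of two monomials. -/
theorem l1_T_sub_T_mul_law_pow_le (w : S → ℝ) (hw0 : ∀ s, 0 ≤ w s) (hw : ∑ s, w s = 1)
    (n : S → ℤ) (s s' : S) (hs : 0 < w s) (hs' : 0 < w s') (N : ℕ) :
    l1 ((T (n s) - T (n s')) * law w n ^ N) ≤
      Real.sqrt (1 / w s + 1 / w s') / Real.sqrt (N + 1) := by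
  classical
  by_cases h : s = s'
  · subst h
    simp only [sub_self, zero_mul, l1_zero]
    positivity
  let u : S → ℝ := fun x => (if x = s then 1 / w s else 0) - (if x = s' then 1 / w s' else 0)
  have hne : s' ≠ s := fun h' => h h'.symm
  have hu : ∑ x, w x * u x = 0 := by
    simp [u, mul_sub, Finset.sum_sub_distrib, hs.ne', hs'.ne']
  have hu2 : ∑ x, w x * u x ^ 2 = 1 / w s + 1 / w s' := by
    have : ∀ x, w x * u x ^ 2 = (if x = s then 1 / w s else 0) + (if x = s' then 1 / w s' else 0) := by
      intro x
      by_cases h1 : x = s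
      · subst h1; simp only [u, if_true, if_neg h]; field_simp; ring
      · by_cases h2 : x = s'
        · subst h2; simp only [u, if_true, if_neg h1]; field_simp; ring
        · simp [u, h1, h2]
    simp [this, Finset.sum_add_distrib]
  have hlaw : law (fun x => w x * u x) n = T (n s) - T (n s') := by
    have h1 : ∀ x, (single (n x) (w x * u x) : ℝ[T;T⁻¹]) =
        (if x = s then T (n x) else 0) - (if x = s' then T (n x) else 0) := by
      intro x
      by_cases h1 : x = s
      · subst h1
        have : w x * u x = 1 := by simp only [u, if_true, if_neg h]; field_simp; ring
        rw [this, if_neg h, if_pos rfl, sub_zero, T]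
      · by_cases h2 : x = s'
        · subst h2
          have : w x * u x = -1 := by simp only [u, if_true, if_neg h1]; field_simp; ring
          rw [this, if_neg h1, if_pos rfl, zero_sub, T]
          ext z; simp [-single_eq_C_mul_T]
        · simp [u, h1, h2]
    simp [law, h1]
  rw [← hlaw, ← hu2]
  exact l1_mul_law_pow_le w hw0 hw u hu n N

/-- The shifts under which the powers of `p` are smooth at the scale of the central limit
theorem. -/
def smoothShifts (p : ℝ[T;T⁻¹]) : AddSubgroup ℤ where
  carrier := {g | ∃ C : ℝ, ∀ N : ℕ, l1 ((T g - 1) * p ^ N) ≤ C / Real.sqrt (N + 1)}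
  zero_mem' := ⟨0, fun N => by simp [l1_zero]⟩
  add_mem' := by
    rintro g h ⟨C, hC⟩ ⟨C', hC'⟩
    refine ⟨C + C', fun N => ?_⟩
    have : (T (g + h) - 1) * p ^ N = T g * ((T h - 1) * p ^ N) + (T g - 1) * p ^ N := by
      rw [T_add]; ring
    rw [this, add_div, add_comm (C / _)]
    refine (l1_add_le _ _).trans ?_
    rw [l1_T_mul]
    exact add_le_add (hC' N) (hC N)
  neg_mem' := by
    rintro g ⟨C, hC⟩
    refine ⟨C, fun N => ?_⟩
    have h : (T (-g) : ℝ[T;T⁻¹]) * T g = 1 := by rw [← T_add]; simp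
    have : (T (-g) - 1) * p ^ N = -(T (-g) * ((T g - 1) * p ^ N)) := by
      linear_combination (p ^ N) * h
    rw [this, l1_neg, l1_T_mul]
    exact hC N

theorem sub_mem_smoothShifts (w : S → ℝ) (hw0 : ∀ s, 0 ≤ w s) (hw : ∑ s, w s = 1)
    (n : S → ℤ) (s s' : S) (hs : 0 < w s) (hs' : 0 < w s') :
    n s - n s' ∈ smoothShifts (law w n) := by
  refine ⟨_, fun N => (le_of_eq ?_).trans (l1_T_sub_T_mul_law_pow_le w hw0 hw n s s' hs hs' N)⟩
  rw [← l1_T_mul (n s'), ← mul_assoc, mul_sub, ← T_add, mul_one]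
  congr 4
  omega

end smooth

/-! ### From distribution functions to the `ℓ¹` norm -/

/-- The distribution function. -/
def cdf (p : ℝ[T;T⁻¹]) (y : ℝ) : ℝ := p.coeff.sum fun z c => if (z : ℝ) ≤ y then c else 0

theorem cdf_eq_sum (p : ℝ[T;T⁻¹]) (y : ℝ) (s : Finset ℤ) (h : p.coeff.support ⊆ s) :
    cdf p y = ∑ z ∈ s, if (z : ℝ) ≤ y then p.coeff z else 0 :=
  Finsupp.sum_of_support_subset _ h _ (by simp)

theorem cdf_add (p q : ℝ[T;T⁻¹]) (y : ℝ) : cdf (p + q) y = cdf p y + cdf q y := by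
  rw [cdf, AddMonoidAlgebra.coeff_add]
  refine Finsupp.sum_add_index' (by simp) fun z b c => ?_
  split_ifs <;> simp

theorem cdf_sum {ι : Type*} (s : Finset ι) (p : ι → ℝ[T;T⁻¹]) (y : ℝ) :
    cdf (∑ i ∈ s, p i) y = ∑ i ∈ s, cdf (p i) y := by
  classical
  induction s using Finset.induction_on with
  | empty => simp [cdf]
  | insert a s ha ih => rw [Finset.sum_insert ha, Finset.sum_insert ha, cdf_add, ih]

theorem cdf_single (z : ℤ) (c y : ℝ) : cdf (single z c) y = if (z : ℝ) ≤ y then c else 0 := by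
  rw [cdf, AddMonoidAlgebra.coeff_single, Finsupp.sum_single_index (by simp)]

theorem cdf_law {S : Type*} [Fintype S] (w : S → ℝ) (n : S → ℤ) (y : ℝ) :
    cdf (law w n) y = ∑ s, if (n s : ℝ) ≤ y then w s else 0 := by
  rw [law, cdf_sum]
  exact Finset.sum_congr rfl fun s _ => cdf_single _ _ _

/-- Each value differs from the average over the interval by at most the variation there. Hence a
small block sum and a small variation force a small `ℓ¹` norm. -/
theorem sum_abs_Ioc_le (f : ℤ → ℝ) (a b : ℤ) (hab : a ≤ b) :
    ∑ z ∈ Finset.Ioc a b, |f z| ≤ |∑ z ∈ Finset.Ioc a b, f z| +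
      (b - a) * ∑ z ∈ Finset.Ioc a b, |f z - f (z - 1)| := by
  rcases hab.eq_or_lt with rfl | hab
  · simp
  set V := ∑ z ∈ Finset.Ioc a b, |f z - f (z - 1)| with hV
  have hba : (0 : ℝ) < b - a := by
    have : (a : ℝ) < b := by exact_mod_cast hab
    linarith
  have hosc' : ∀ (k : ℕ) (z : ℤ), a < z → z + k ≤ b → |f (z + k) - f z| ≤
      ∑ x ∈ Finset.Ioc z (z + k), |f x - f (x - 1)| := by
    intro k z hz
    induction k with
    | zero => simp
    | succ k ih =>
      intro hk
      push_cast at hk ⊢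
      have h1 : Finset.Ioc z (z + (k + 1)) = insert (z + (k + 1)) (Finset.Ioc z (z + k)) := by
        ext x; simp only [Finset.mem_Ioc, Finset.mem_insert]; omega
      rw [h1, Finset.sum_insert (by simp)]
      have h2 := ih (by omega)
      have h3 : z + ((k : ℤ) + 1) - 1 = z + k := by ring
      rw [h3]
      have h4 := abs_sub_le (f (z + (k + 1))) (f (z + k)) (f z)
      linarith
  have hosc : ∀ z ∈ Finset.Ioc a b, ∀ z' ∈ Finset.Ioc a b, |f z - f z'| ≤ V := by
    have h1 : ∀ z ∈ Finset.Ioc a b, ∀ z' ∈ Finset.Ioc a b, z' ≤ z → |f z - f z'| ≤ V := by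
      intro z hz z' hz' hle
      rw [Finset.mem_Ioc] at hz hz'
      have h2 := hosc' (z - z').toNat z' hz'.1 (by omega)
      have h3 : z' + ((z - z').toNat : ℤ) = z := by omega
      rw [h3] at h2
      refine h2.trans (Finset.sum_le_sum_of_subset_of_nonneg ?_ fun _ _ _ => abs_nonneg _)
      intro x hx
      rw [Finset.mem_Ioc] at hx ⊢
      omega
    intro z hz z' hz'
    rcases le_total z' z with h | h
    · exact h1 z hz z' hz' h
    · rw [abs_sub_comm]; exact h1 z' hz' z hz h
  have hcard : ((Finset.Ioc a b).card : ℝ) = b - a := by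
    rw [Int.card_Ioc]
    have : ((b - a).toNat : ℤ) = b - a := Int.toNat_of_nonneg (by omega)
    exact_mod_cast this
  have hpt : ∀ z ∈ Finset.Ioc a b, (b - a) * |f z| ≤ |∑ z ∈ Finset.Ioc a b, f z| + (b - a) * V := by
    intro z hz
    have h1 : (b - a) * f z = ∑ z' ∈ Finset.Ioc a b, f z' + ∑ z' ∈ Finset.Ioc a b, (f z - f z') := by
      rw [Finset.sum_sub_distrib, Finset.sum_const, nsmul_eq_mul, hcard]; ring
    calc (b - a) * |f z| = |(b - a) * f z| := by rw [abs_mul, abs_of_pos hba]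
      _ ≤ |∑ z' ∈ Finset.Ioc a b, f z'| + |∑ z' ∈ Finset.Ioc a b, (f z - f z')| := by
        rw [h1]; exact abs_add_le _ _
      _ ≤ |∑ z' ∈ Finset.Ioc a b, f z'| + ∑ z' ∈ Finset.Ioc a b, V := by
        gcongr
        exact (Finset.abs_sum_le_sum_abs _ _).trans (Finset.sum_le_sum fun z' hz' => hosc z hz z' hz')
      _ = _ := by rw [Finset.sum_const, nsmul_eq_mul, hcard]
  have hsum := Finset.sum_le_sum hpt
  rw [← Finset.mul_sum, Finset.sum_const, nsmul_eq_mul, hcard] at hsum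
  exact le_of_mul_le_mul_left hsum hba

theorem sum_Ioc_blocks (e : ℕ → ℤ) (he : Monotone e) (g : ℤ → ℝ) (m : ℕ) :
    ∑ i ∈ Finset.range m, ∑ z ∈ Finset.Ioc (e i) (e (i + 1)), g z =
      ∑ z ∈ Finset.Ioc (e 0) (e m), g z := by
  induction m with
  | zero => simp
  | succ m ih =>
    rw [Finset.sum_range_succ, ih, ← Finset.sum_union]
    · rw [Finset.Ioc_union_Ioc_eq_Ioc (he (Nat.zero_le _)) (he (Nat.le_succ _))]
    · exact Finset.Ioc_disjoint_Ioc_of_le le_rfl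

end SSR

namespace SSR

open LaurentPolynomial AddMonoidAlgebra Filter

/-! ### Total variation bounds from distribution functions and regularity. -/

theorem cdf_sub (p q : ℝ[T;T⁻¹]) (y : ℝ) : cdf (p - q) y = cdf p y - cdf q y := by
  have := cdf_add (p - q) q y
  rw [sub_add_cancel] at this
  linarith

theorem cdf_sub_cdf (p : ℝ[T;T⁻¹]) {y y' : ℝ} (h : y ≤ y') :
    cdf p y' - cdf p y = ∑ z ∈ Finset.Ioc ⌊y⌋ ⌊y'⌋, p.coeff z := by
  classical
  set s := p.coeff.support ∪ Finset.Ioc ⌊y⌋ ⌊y'⌋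
  rw [cdf_eq_sum p y' s Finset.subset_union_left, cdf_eq_sum p y s Finset.subset_union_left,
    ← Finset.sum_sub_distrib]
  rw [← Finset.sum_subset (Finset.subset_union_right : Finset.Ioc ⌊y⌋ ⌊y'⌋ ⊆ s)]
  · refine Finset.sum_congr rfl fun z hz => ?_
    rw [Finset.mem_Ioc, Int.floor_lt, Int.le_floor] at hz
    rw [if_pos hz.2, if_neg (not_le.2 hz.1), sub_zero]
  · intro z _ hz
    rw [Finset.mem_Ioc, Int.floor_lt, Int.le_floor, not_and_or, not_lt, not_le] at hz
    rcases hz with hz | hz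
    · rw [if_pos hz, if_pos (hz.trans h), sub_self]
    · rw [if_neg (not_le.2 hz), if_neg (not_le.2 (h.trans_lt hz)), sub_self]

theorem l1_eq_sum_add_tail (P : ℝ[T;T⁻¹]) (hP : ∀ z, 0 ≤ P.coeff z) (hP1 : l1 P = 1)
    (s U : Finset ℤ) (hU : P.coeff.support ⊆ U) (hs : s ⊆ U) :
    ∑ z ∈ U \ s, |P.coeff z| = 1 - ∑ z ∈ s, P.coeff z := by
  have h1 := Finset.sum_sdiff hs (f := fun z => |P.coeff z|)
  rw [← l1_eq_sum P U hU, hP1] at h1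
  have h2 : ∑ z ∈ s, |P.coeff z| = ∑ z ∈ s, P.coeff z :=
    Finset.sum_congr rfl fun z _ => abs_of_nonneg (hP z)
  linarith

/-- A window around `κ` is cut into `2 * K` blocks of length `η`. The three terms are the
discrepancy of the block masses, the oscillation inside blocks (at most `η + 1` integers each,
because of rounding), and the mass of both laws outside the window. -/
theorem l1_sub_le_blocks (P Q : ℝ[T;T⁻¹]) (hP : ∀ z, 0 ≤ P.coeff z) (hQ : ∀ z, 0 ≤ Q.coeff z)
    (hP1 : l1 P = 1) (hQ1 : l1 Q = 1) (κ η : ℝ) (hη : 0 ≤ η) (K : ℕ) :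
    l1 (P - Q) ≤ ∑ i ∈ Finset.range (2 * K),
        |cdf (P - Q) (κ + ((i + 1 : ℕ) - K : ℝ) * η) - cdf (P - Q) (κ + (i - K : ℝ) * η)| +
      (η + 1) * l1 ((1 - T 1) * (P - Q)) +
      ((1 - (cdf P (κ + K * η) - cdf P (κ + (-K) * η))) +
        (1 - (cdf Q (κ + K * η) - cdf Q (κ + (-K) * η)))) := by
  classical
  set f := P - Q with hf
  let y : ℕ → ℝ := fun i => κ + (i - K : ℝ) * η
  have hy : Monotone y := by
    intro i j hij
    have : (i : ℝ) ≤ j := by exact_mod_cast hij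
    simp only [y]
    gcongr
  let e : ℕ → ℤ := fun i => ⌊y i⌋
  have he : Monotone e := fun i j hij => Int.floor_le_floor (hy hij)
  have he' : ∀ i, (e (i + 1) : ℝ) - e i ≤ η + 1 := by
    intro i
    have h1 := Int.floor_le (y (i + 1))
    have h2 := Int.lt_floor_add_one (y i)
    have h3 : y (i + 1) = y i + η := by simp only [y]; push_cast; ring
    simp only [e]
    linarith
  set s := Finset.Ioc (e 0) (e (2 * K)) with hs
  set U := f.coeff.support ∪ P.coeff.support ∪ Q.coeff.support ∪ s
  have hsU : s ⊆ U := Finset.subset_union_right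
  have hfc : ∀ z, f.coeff z = P.coeff z - Q.coeff z := fun z => by simp [hf]
  have hcoef : ∀ z, ((1 - T 1) * f).coeff z = f.coeff z - f.coeff (z - 1) := by
    intro z
    rw [sub_mul, one_mul, AddMonoidAlgebra.coeff_sub, Finsupp.sub_apply, coeff_T_mul]
  have h1 : l1 f = ∑ z ∈ U \ s, |f.coeff z| + ∑ z ∈ s, |f.coeff z| := by
    rw [Finset.sum_sdiff hsU]
    exact l1_eq_sum f U (by intro z hz; simp only [U, Finset.mem_union]; tauto)
  have hmassP : ∑ z ∈ s, P.coeff z = cdf P (κ + K * η) - cdf P (κ + (-K) * η) := by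
    have h0 : κ + (-K : ℝ) * η = y 0 := by simp only [y]; push_cast; ring
    have h2 : κ + (K : ℝ) * η = y (2 * K) := by simp only [y]; push_cast; ring
    rw [h0, h2, cdf_sub_cdf P (hy (Nat.zero_le _))]
  have hmassQ : ∑ z ∈ s, Q.coeff z = cdf Q (κ + K * η) - cdf Q (κ + (-K) * η) := by
    have h0 : κ + (-K : ℝ) * η = y 0 := by simp only [y]; push_cast; ring
    have h2 : κ + (K : ℝ) * η = y (2 * K) := by simp only [y]; push_cast; ring
    rw [h0, h2, cdf_sub_cdf Q (hy (Nat.zero_le _))]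
  have h2 : ∑ z ∈ U \ s, |f.coeff z| ≤
      (1 - (cdf P (κ + K * η) - cdf P (κ + (-K) * η))) +
        (1 - (cdf Q (κ + K * η) - cdf Q (κ + (-K) * η))) := by
    rw [← hmassP, ← hmassQ, ← l1_eq_sum_add_tail P hP hP1 s U
        (by intro z hz; simp only [U, Finset.mem_union]; tauto) hsU,
      ← l1_eq_sum_add_tail Q hQ hQ1 s U
        (by intro z hz; simp only [U, Finset.mem_union]; tauto) hsU, ← Finset.sum_add_distrib]
    exact Finset.sum_le_sum fun z _ => by rw [hfc]; exact abs_sub _ _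
  have h3 : ∑ z ∈ s, |f.coeff z| ≤ ∑ i ∈ Finset.range (2 * K),
        |cdf f (κ + ((i + 1 : ℕ) - K : ℝ) * η) - cdf f (κ + (i - K : ℝ) * η)| +
      (η + 1) * l1 ((1 - T 1) * f) := by
    have h4 : ∑ i ∈ Finset.range (2 * K), ∑ z ∈ Finset.Ioc (e i) (e (i + 1)), |f.coeff z| ≤
        ∑ i ∈ Finset.range (2 * K), (|cdf f (y (i + 1)) - cdf f (y i)| +
          (η + 1) * ∑ z ∈ Finset.Ioc (e i) (e (i + 1)), |((1 - T 1) * f).coeff z|) := by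
      refine Finset.sum_le_sum fun i _ => ?_
      refine (sum_abs_Ioc_le f.coeff _ _ (he (Nat.le_succ i))).trans ?_
      rw [cdf_sub_cdf f (hy (Nat.le_succ i))]
      simp only [hcoef]
      gcongr
      exact he' i
    rw [sum_Ioc_blocks e he, Finset.sum_add_distrib, ← Finset.mul_sum,
      sum_Ioc_blocks e he] at h4
    refine h4.trans ?_
    gcongr
    exact sum_abs_coeff_le_l1 _ _
  rw [h1]
  linarith

/-- Two sequences of laws with the same limit in distribution at scale `√N`, both of which vary
slowly at this scale, approach each other in total variation. -/
theorem tendsto_l1_sub_of_cdf (P Q : ℕ → ℝ[T;T⁻¹]) (hP : ∀ N z, 0 ≤ (P N).coeff z)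
    (hQ : ∀ N z, 0 ≤ (Q N).coeff z) (hP1 : ∀ N, l1 (P N) = 1) (hQ1 : ∀ N, l1 (Q N) = 1)
    (κ : ℕ → ℝ) (Φ : ℝ → ℝ) (hbot : Tendsto Φ atBot (𝓝 0)) (htop : Tendsto Φ atTop (𝓝 1))
    (hPΦ : ∀ x, Tendsto (fun N : ℕ => cdf (P N) (κ N + x * Real.sqrt N)) atTop (𝓝 (Φ x)))
    (hQΦ : ∀ x, Tendsto (fun N : ℕ => cdf (Q N) (κ N + x * Real.sqrt N)) atTop (𝓝 (Φ x)))
    (C : ℝ) (hPC : ∀ᶠ N : ℕ in atTop, l1 ((1 - T 1) * P N) ≤ C / Real.sqrt N)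
    (hQC : ∀ᶠ N : ℕ in atTop, l1 ((1 - T 1) * Q N) ≤ C / Real.sqrt N) :
    Tendsto (fun N => l1 (P N - Q N)) atTop (𝓝 0) := by
  have hC : 0 ≤ C := by
    obtain ⟨N, h1, h2⟩ := (hPC.and (eventually_gt_atTop 0)).exists
    have h3 : (0 : ℝ) < Real.sqrt N := Real.sqrt_pos.2 (by exact_mod_cast h2)
    have := (l1_nonneg _).trans h1
    rw [le_div_iff₀ h3] at this
    linarith
  rw [Metric.tendsto_nhds]
  intro δ hδ
  -- Blocks have length `ε √N` and the variation is at most `2 C / √N`, so the oscillation term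
  -- tends to `2 C ε`. Then `K` is fixed to make the tails small. The number of blocks no longer
  -- depends on `N`, and pointwise convergence of the distribution functions handles them.
  obtain ⟨ε, hε, hεC⟩ : ∃ ε : ℝ, 0 < ε ∧ 2 * C * ε < δ / 4 := by
    refine ⟨δ / (8 * (C + 1)) / 2, by positivity, ?_⟩
    have : 2 * C * (δ / (8 * (C + 1)) / 2) = δ / 8 * (C / (C + 1)) := by field_simp
    rw [this]
    have h2 : C / (C + 1) ≤ 1 := div_le_one_of_le₀ (by linarith) (by linarith)
    nlinarith
  have hKtop : Tendsto (fun K : ℕ => (K : ℝ) * ε) atTop atTop :=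
    tendsto_natCast_atTop_atTop.atTop_mul_const hε
  have hKbot : Tendsto (fun K : ℕ => (-K : ℝ) * ε) atTop atBot := by
    exact (tendsto_neg_atTop_atBot.comp hKtop).congr fun K => by simp
  obtain ⟨K, hK⟩ : ∃ K : ℕ, 1 - (Φ (K * ε) - Φ ((-K) * ε)) < δ / 8 := by
    have h1 : Tendsto (fun K : ℕ => 1 - (Φ (K * ε) - Φ ((-K) * ε))) atTop (𝓝 (1 - (1 - 0))) :=
      tendsto_const_nhds.sub ((htop.comp hKtop).sub (hbot.comp hKbot))
    simp only [sub_zero, sub_self] at h1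
    exact (h1.eventually (gt_mem_nhds (by positivity))).exists
  have hblocks : Tendsto (fun N : ℕ => ∑ i ∈ Finset.range (2 * K),
      |cdf (P N - Q N) (κ N + ((i + 1 : ℕ) - K : ℝ) * (ε * Real.sqrt N)) -
        cdf (P N - Q N) (κ N + (i - K : ℝ) * (ε * Real.sqrt N))|) atTop (𝓝 0) := by
    have h1 : ∀ x : ℝ, Tendsto (fun N : ℕ => cdf (P N - Q N) (κ N + x * (ε * Real.sqrt N)))
        atTop (𝓝 0) := by
      intro x
      have := (hPΦ (x * ε)).sub (hQΦ (x * ε))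
      rw [sub_self] at this
      refine this.congr fun N => ?_
      rw [cdf_sub, mul_assoc]
    have h2 := tendsto_finsetSum (Finset.range (2 * K)) fun i _ =>
      ((h1 ((i + 1 : ℕ) - K : ℝ)).sub (h1 (i - K : ℝ))).abs
    simpa using h2
  have htails : Tendsto (fun N : ℕ =>
      (1 - (cdf (P N) (κ N + K * (ε * Real.sqrt N)) -
        cdf (P N) (κ N + (-K) * (ε * Real.sqrt N)))) +
      (1 - (cdf (Q N) (κ N + K * (ε * Real.sqrt N)) -
        cdf (Q N) (κ N + (-K) * (ε * Real.sqrt N))))) atTop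
      (𝓝 ((1 - (Φ (K * ε) - Φ ((-K) * ε))) + (1 - (Φ (K * ε) - Φ ((-K) * ε))))) := by
    simp only [← mul_assoc]
    exact (tendsto_const_nhds.sub ((hPΦ _).sub (hPΦ _))).add
      (tendsto_const_nhds.sub ((hQΦ _).sub (hQΦ _)))
  have hsqrt : Tendsto (fun N : ℕ => 2 * C / Real.sqrt N) atTop (𝓝 0) :=
    tendsto_const_nhds.div_atTop (Real.tendsto_sqrt_atTop.comp tendsto_natCast_atTop_atTop)
  filter_upwards [hPC, hQC, hblocks.eventually (gt_mem_nhds (show (0 : ℝ) < δ / 4 by positivity)),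
    htails.eventually (gt_mem_nhds (show _ < δ / 4 by linarith)),
    hsqrt.eventually (gt_mem_nhds (show (0 : ℝ) < δ / 4 by positivity)),
    eventually_gt_atTop 0] with N h1 h2 h3 h4 h5 h6
  have h7 := l1_sub_le_blocks (P N) (Q N) (hP N) (hQ N) (hP1 N) (hQ1 N) (κ N) (ε * Real.sqrt N)
    (by positivity) K
  have h8 : l1 ((1 - T 1) * (P N - Q N)) ≤ 2 * C / Real.sqrt N := by
    rw [mul_sub]
    refine (l1_sub_le _ _).trans ?_
    rw [two_mul, add_div]
    exact add_le_add h1 h2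
  have h9 : (0 : ℝ) < Real.sqrt N := Real.sqrt_pos.2 (by exact_mod_cast h6)
  have h10 : (ε * Real.sqrt N + 1) * l1 ((1 - T 1) * (P N - Q N)) ≤
      2 * C * ε + 2 * C / Real.sqrt N := by
    calc _ ≤ (ε * Real.sqrt N + 1) * (2 * C / Real.sqrt N) := by gcongr
      _ = _ := by field_simp
  rw [Real.dist_eq, sub_zero, abs_of_nonneg (l1_nonneg _)]
  linarith

end SSR

namespace SSR

open LaurentPolynomial AddMonoidAlgebra Filter MeasureTheory

/-! ### The central limit theorem for sums over finite index sets -/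

/-- The measure with mass `w s` at the point `x s`. -/
def pointMasses {S : Type*} [Fintype S] (w : S → ℝ) (x : S → ℝ) : Measure ℝ :=
  ∑ s, ENNReal.ofReal (w s) • Measure.dirac (x s)

section pointMasses

variable {S : Type*} [Fintype S]

theorem integral_pointMasses {E : Type*} [NormedAddCommGroup E] [NormedSpace ℝ E] [CompleteSpace E]
    (w : S → ℝ)
    (hw : ∀ s, 0 ≤ w s) (x : S → ℝ) (f : ℝ → E) :
    ∫ y, f y ∂(pointMasses w x) = ∑ s, w s • f (x s) := by
  rw [pointMasses, integral_finsetSum_measure]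
  · refine Finset.sum_congr rfl fun s _ => ?_
    rw [integral_smul_measure, integral_dirac, ENNReal.toReal_ofReal (hw s)]
  · intro s _
    exact (integrable_dirac (by simp)).smul_measure ENNReal.ofReal_ne_top

theorem isProbabilityMeasure_pointMasses (w : S → ℝ) (hw : ∀ s, 0 ≤ w s) (hw1 : ∑ s, w s = 1)
    (x : S → ℝ) : IsProbabilityMeasure (pointMasses w x) := by
  constructor
  simp only [pointMasses, Measure.coe_finsetSum, Finset.sum_apply, Measure.smul_apply,
    measure_univ, smul_eq_mul, mul_one]
  rw [← ENNReal.ofReal_sum_of_nonneg fun s _ => hw s, hw1, ENNReal.ofReal_one]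

theorem real_pointMasses_Iic (w : S → ℝ) (hw : ∀ s, 0 ≤ w s) (x : S → ℝ) (a : ℝ) :
    (pointMasses w x).real (Set.Iic a) = ∑ s, if x s ≤ a then w s else 0 := by
  have h := integral_pointMasses w hw x (Set.indicator (Set.Iic a) (1 : ℝ → ℝ))
  rw [integral_indicator_one measurableSet_Iic] at h
  rw [h]
  refine Finset.sum_congr rfl fun s _ => ?_
  by_cases h1 : x s ≤ a <;> simp [h1]

/-- The characteristic function of the centred sum divided by `√N` is an `N`-th power of that of a
standardized summand. As `v > 0`, the limit has no atoms, so half-lines are continuity sets. -/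
theorem tendsto_real_Iic_gaussian (w : S → ℝ) (hw : ∀ s, 0 ≤ w s) (hw1 : ∑ s, w s = 1) (n : S → ℝ)
    (v : ℝ) (hv : ∑ s, w s * n s ^ 2 - (∑ s, w s * n s) ^ 2 = v) (hv0 : 0 < v) (x : ℝ) :
    Tendsto (fun N : ℕ => ∑ s : Fin N → S,
        if (∑ i, n (s i)) ≤ N * (∑ s, w s * n s) + x * Real.sqrt N then ∏ i, w (s i) else 0) atTop
      (𝓝 ((ProbabilityTheory.gaussianReal 0 v.toNNReal).real (Set.Iic x))) := by
  set m := ∑ s, w s * n s with hm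
  have hprod : ∀ (N : ℕ) (s : Fin N → S), 0 ≤ ∏ i, w (s i) :=
    fun N s => Finset.prod_nonneg fun i _ => hw _
  have hsv : 0 < Real.sqrt v := Real.sqrt_pos.2 hv0
  let μ : ∀ N : ℕ, Measure ℝ := fun N =>
    pointMasses (fun s : Fin N → S => ∏ i, w (s i)) (fun s => (∑ i, (n (s i) - m)) / Real.sqrt N)
  have hμ : ∀ N, IsProbabilityMeasure (μ N) := fun N =>
    isProbabilityMeasure_pointMasses _ (hprod N) (sum_prod_pi w hw1 N) _
  let ν : Measure ℝ := pointMasses w (fun s => (n s - m) / Real.sqrt v)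
  have hν : IsProbabilityMeasure ν := isProbabilityMeasure_pointMasses _ hw hw1 _
  have h0 : ∫ y, id y ∂ν = 0 := by
    rw [integral_pointMasses w hw]
    simp only [id, smul_eq_mul, mul_div_assoc', ← Finset.sum_div, mul_sub, Finset.sum_sub_distrib,
      ← Finset.sum_mul, hw1]
    rw [← hm]; simp
  have h1 : ∫ y, ((id : ℝ → ℝ) ^ 2) y ∂ν = 1 := by
    rw [integral_pointMasses w hw]
    have h2 : ∀ s, w s • ((id : ℝ → ℝ) ^ 2) ((n s - m) / Real.sqrt v) =
        (w s * n s ^ 2 - 2 * m * (w s * n s) + m ^ 2 * w s) / v := by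
      intro s
      simp only [Pi.pow_apply, id, smul_eq_mul, div_pow, Real.sq_sqrt hv0.le]
      ring
    rw [Finset.sum_congr rfl fun s _ => h2 s, ← Finset.sum_div, Finset.sum_add_distrib,
      Finset.sum_sub_distrib, ← Finset.mul_sum, ← Finset.mul_sum, hw1, ← hm, div_eq_one_iff_eq hv0.ne',
      ← hv]
    ring
  have hchar : ∀ t : ℝ, ∀ N : ℕ, charFun (μ N) t =
      charFun (ν.map id) ((Real.sqrt N)⁻¹ * (Real.sqrt v * t)) ^ N := by
    intro t N
    rw [Measure.map_id, charFun_apply_real, charFun_apply_real, integral_pointMasses _ (hprod N),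
      integral_pointMasses w hw]
    have h3 := Finset.prod_univ_sum (fun _ : Fin N => (Finset.univ : Finset S)) (fun _ s => w s •
      Complex.exp (((Real.sqrt N)⁻¹ * (Real.sqrt v * t) : ℝ) * ((n s - m) / Real.sqrt v : ℝ) *
        Complex.I))
    rw [Finset.prod_const, Finset.card_univ, Fintype.card_fin, Fintype.piFinset_univ] at h3
    rw [h3]
    refine Finset.sum_congr rfl fun s _ => ?_
    have h4 : ∀ i, (w (s i) • Complex.exp (((Real.sqrt N)⁻¹ * (Real.sqrt v * t) : ℝ) *
        ((n (s i) - m) / Real.sqrt v : ℝ) * Complex.I)) =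
        (w (s i) : ℂ) * Complex.exp (((Real.sqrt N)⁻¹ * t * (n (s i) - m) : ℝ) * Complex.I) := by
      intro i
      rw [Complex.real_smul, ← Complex.ofReal_mul]
      congr 4
      field_simp
    rw [Finset.prod_congr rfl fun i _ => h4 i, Finset.prod_mul_distrib, ← Complex.exp_sum,
      Complex.real_smul, Complex.ofReal_prod, ← Finset.sum_mul, ← Complex.ofReal_sum,
      ← Complex.ofReal_mul, ← Finset.mul_sum]
    congr 4
    ring
  let μs : ℕ → ProbabilityMeasure ℝ := fun N => ⟨μ N, hμ N⟩
  let γ : ProbabilityMeasure ℝ := ⟨ProbabilityTheory.gaussianReal 0 v.toNNReal, inferInstance⟩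
  have htend : Tendsto μs atTop (𝓝 γ) := by
    rw [ProbabilityMeasure.tendsto_iff_tendsto_charFun]
    intro t
    have h5 := ProbabilityTheory.tendsto_charFun_inv_sqrt_mul_pow (P := ν) (X := id)
      aemeasurable_id h0 h1 (Real.sqrt v * t)
    simp only [μs, γ, ProbabilityMeasure.coe_mk, hchar, ProbabilityTheory.charFun_gaussianReal]
    convert h5 using 2
    congr 1
    have h6 : (Real.sqrt v * t) ^ 2 = v * t ^ 2 := by rw [mul_pow, Real.sq_sqrt hv0.le]
    rw [Real.coe_toNNReal v hv0.le, ← Complex.ofReal_pow (Real.sqrt v * t), h6]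
    push_cast
    ring
  have hvne : v.toNNReal ≠ 0 := by
    rw [Ne, Real.toNNReal_eq_zero]; exact not_le.2 hv0
  have hna := ProbabilityTheory.nullSingletonClass_gaussianReal (μ := 0) hvne
  have hfr : (ProbabilityTheory.gaussianReal 0 v.toNNReal) (frontier (Set.Iic x)) = 0 := by
    rw [frontier_Iic]; exact measure_singleton x
  have h7 := ProbabilityMeasure.tendsto_measure_of_null_frontier_of_tendsto' htend hfr
  have h8 := (ENNReal.tendsto_toReal (measure_ne_top (ProbabilityTheory.gaussianReal 0 v.toNNReal)
    (Set.Iic x))).comp h7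
  refine h8.congr' ?_
  filter_upwards [eventually_gt_atTop 0] with N hN
  have hN' : 0 < Real.sqrt N := Real.sqrt_pos.2 (by exact_mod_cast hN)
  change (μ N).real (Set.Iic x) = _
  rw [real_pointMasses_Iic _ (hprod N)]
  refine Finset.sum_congr rfl fun s _ => ?_
  congr 1
  rw [div_le_iff₀ hN', Finset.sum_sub_distrib]
  simp only [Finset.sum_const, Finset.card_univ, Fintype.card_fin, nsmul_eq_mul, eq_iff_iff]
  constructor <;> intro h <;> linarith

theorem tendsto_cdf_law_pow (w : S → ℝ) (hw : ∀ s, 0 ≤ w s) (hw1 : ∑ s, w s = 1) (n : S → ℤ)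
    (v : ℝ) (hv : ∑ s, w s * (n s : ℝ) ^ 2 - (∑ s, w s * n s) ^ 2 = v) (hv0 : 0 < v) (x : ℝ) :
    Tendsto (fun N : ℕ => cdf (law w n ^ N) (N * (∑ s, w s * n s) + x * Real.sqrt N)) atTop
      (𝓝 ((ProbabilityTheory.gaussianReal 0 v.toNNReal).real (Set.Iic x))) := by
  refine (tendsto_real_Iic_gaussian w hw hw1 (fun s => (n s : ℝ)) v hv hv0 x).congr fun N => ?_
  rw [← law_pow, cdf_law]
  push_cast
  rfl

end pointMasses

/-! ### Riemann sums of Gaussians -/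

/-- With `t = y ^ 2 / (2 v)`, expand `(1 + 2 v t) ^ 2` and use `t ≤ exp t` and `t ^ 2 / 2 ≤ exp t`.
The right side is the integrable majorant for Riemann sums of functions with quadratic growth. -/
theorem one_add_sq_mul_exp_le (v : ℝ) (hv : 0 < v) (y : ℝ) :
    (1 + y ^ 2) * Real.exp (-y ^ 2 / (2 * v)) ≤ (1 + 4 * v + 8 * v ^ 2) * (1 + y ^ 2)⁻¹ := by
  set t := y ^ 2 / (2 * v) with ht
  have ht0 : 0 ≤ t := by positivity
  have hy : y ^ 2 = 2 * v * t := by rw [ht]; field_simp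
  have h1 : t ≤ Real.exp t := by simpa using Real.pow_div_factorial_le_exp t ht0 1
  have h2 : t ^ 2 / 2 ≤ Real.exp t := by
    simpa [Nat.factorial] using Real.pow_div_factorial_le_exp t ht0 2
  have h3 : 1 ≤ Real.exp t := Real.one_le_exp ht0
  have h4 : Real.exp (-y ^ 2 / (2 * v)) = (Real.exp t)⁻¹ := by
    rw [← Real.exp_neg, ht, neg_div]
  have h5 : (1 + y ^ 2) ^ 2 ≤ (1 + 4 * v + 8 * v ^ 2) * Real.exp t := by
    rw [hy]
    nlinarith [mul_le_mul_of_nonneg_left h1 hv.le, mul_le_mul_of_nonneg_left h2 (sq_nonneg v)]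
  rw [h4, ← div_eq_mul_inv, ← div_eq_mul_inv, div_le_div_iff₀ (Real.exp_pos t) (by positivity)]
  nlinarith

theorem tendsto_riemann_sum (v : ℝ) (hv : 0 < v) (h : ℝ → ℝ)
    (hc : ∀ᵐ u : ℝ, ContinuousAt h u)
    (hb : ∀ y, |h y| ≤ (1 + y ^ 2) * Real.exp (-y ^ 2 / (2 * v))) :
    Tendsto (fun N : ℕ => (Real.sqrt N)⁻¹ *
      ∑ j ∈ Finset.range (N + 1), h (((j : ℝ) - (N / 2 : ℕ)) / Real.sqrt N)) atTop
      (𝓝 (∫ u, h u)) := by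
  let J : ℕ → ℕ → Set ℝ := fun N j =>
    Set.Ico (((j : ℝ) - (N / 2 : ℕ)) / Real.sqrt N) (((j : ℝ) + 1 - (N / 2 : ℕ)) / Real.sqrt N)
  let F : ℕ → ℝ → ℝ := fun N u => ∑ j ∈ Finset.range (N + 1),
    (J N j).indicator (fun _ => h (((j : ℝ) - (N / 2 : ℕ)) / Real.sqrt N)) u
  have hmem : ∀ N : ℕ, 0 < N → ∀ j u, u ∈ J N j ↔ ⌊u * Real.sqrt N⌋ = (j : ℤ) - (N / 2 : ℕ) := by
    intro N hN j u
    have hN' : 0 < Real.sqrt N := Real.sqrt_pos.2 (by exact_mod_cast hN)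
    simp only [J, Set.mem_Ico]
    rw [div_le_iff₀ hN', lt_div_iff₀ hN', Int.floor_eq_iff]
    simp only [Int.cast_sub, Int.cast_natCast]
    constructor <;> rintro ⟨h1, h2⟩ <;> constructor <;> linarith
  have hF : ∀ N : ℕ, 0 < N → ∀ u, F N u = 0 ∨
      F N u = h (⌊u * Real.sqrt N⌋ / Real.sqrt N) := by
    intro N hN u
    by_cases hex : ∃ j ∈ Finset.range (N + 1), u ∈ J N j
    · obtain ⟨j, hj, hju⟩ := hex
      right
      simp only [F]
      rw [Finset.sum_eq_single j]
      · rw [Set.indicator_of_mem hju, (hmem N hN j u).1 hju]; simp only [Int.cast_sub, Int.cast_natCast]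
      · intro j' _ hne
        apply Set.indicator_of_notMem
        intro h1
        have h2 := (hmem N hN j u).1 hju
        have h3 := (hmem N hN j' u).1 h1
        omega
      · exact fun h1 => absurd hj h1
    · left
      push Not at hex
      exact Finset.sum_eq_zero fun j hj => Set.indicator_of_notMem (hex j hj) _
  have hfl : ∀ N : ℕ, 0 < N → ∀ u : ℝ, |⌊u * Real.sqrt N⌋ / Real.sqrt N - u| ≤
      (Real.sqrt N)⁻¹ := by
    intro N hN u
    have hN' : 0 < Real.sqrt N := Real.sqrt_pos.2 (by exact_mod_cast hN)
    have h1 := Int.floor_le (u * Real.sqrt N)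
    have h2 := Int.lt_floor_add_one (u * Real.sqrt N)
    have h3 : (⌊u * Real.sqrt N⌋ : ℝ) / Real.sqrt N - u =
        (⌊u * Real.sqrt N⌋ - u * Real.sqrt N) * (Real.sqrt N)⁻¹ := by field_simp
    rw [h3, abs_mul, abs_of_pos (inv_pos.2 hN')]
    refine mul_le_of_le_one_left (inv_pos.2 hN').le ?_
    rw [abs_le]; constructor <;> linarith
  have hintegral : ∀ N : ℕ, ∫ u, F N u = (Real.sqrt N)⁻¹ *
      ∑ j ∈ Finset.range (N + 1), h (((j : ℝ) - (N / 2 : ℕ)) / Real.sqrt N) := by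
    intro N
    simp only [F]
    rw [integral_finsetSum, Finset.mul_sum]
    · refine Finset.sum_congr rfl fun j _ => ?_
      rw [integral_indicator_const _ measurableSet_Ico, Measure.real, Real.volume_Ico, smul_eq_mul,
        ENNReal.toReal_ofReal]
      · congr 1; rw [← sub_div, inv_eq_one_div]; congr 1; ring
      · rw [← sub_div]
        exact div_nonneg (by linarith) (Real.sqrt_nonneg _)
    · intro j _
      exact (integrableOn_const (by simp [J])).integrable_indicator measurableSet_Ico
  simp only [← hintegral]
  refine tendsto_integral_of_dominated_convergence
    (fun u => 3 * (1 + 4 * v + 8 * v ^ 2) * (1 + u ^ 2)⁻¹) ?_ ?_ ?_ ?_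
  · intro N
    refine Measurable.aestronglyMeasurable ?_
    exact Finset.measurable_fun_sum _ fun j _ => measurable_const.indicator measurableSet_Ico
  · exact integrable_inv_one_add_sq.const_mul _
  · intro N
    refine Eventually.of_forall fun u => ?_
    have hpos : 0 ≤ 3 * (1 + 4 * v + 8 * v ^ 2) * (1 + u ^ 2)⁻¹ := by positivity
    -- For `N = 0` division by `√0 = 0` gives zero, so the cells `J 0 j` are empty.
    rcases Nat.eq_zero_or_pos N with rfl | hN
    · simpa [F, J] using hpos
    · rcases hF N hN u with h1 | h1
      · rw [h1, norm_zero]; exact hpos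
      · rw [h1, Real.norm_eq_abs]
        set y : ℝ := ⌊u * Real.sqrt N⌋ / Real.sqrt N with hy
        refine ((hb y).trans (one_add_sq_mul_exp_le v hv y)).trans ?_
        have h2 := hfl N hN u
        rw [← hy] at h2
        have h3 : (Real.sqrt N)⁻¹ ≤ 1 := by
          apply inv_le_one_of_one_le₀
          rw [Real.one_le_sqrt]
          exact_mod_cast hN
        have h4 := abs_le.1 (h2.trans h3)
        -- The grid point `y` lies within distance 1 of `u`, so `u ^ 2 ≤ 2 * y ^ 2 + 2`.
        have h5 : 1 + u ^ 2 ≤ 3 * (1 + y ^ 2) := by nlinarith [sq_nonneg (y - u), sq_nonneg (2 * y - u)]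
        have h6 : (1 + y ^ 2)⁻¹ ≤ 3 * (1 + u ^ 2)⁻¹ := by
          rw [inv_eq_one_div, inv_eq_one_div, mul_one_div, div_le_div_iff₀ (by positivity)
            (by positivity)]
          linarith
        calc (1 + 4 * v + 8 * v ^ 2) * (1 + y ^ 2)⁻¹
            ≤ (1 + 4 * v + 8 * v ^ 2) * (3 * (1 + u ^ 2)⁻¹) := by gcongr
          _ = _ := by ring
  · filter_upwards [hc] with u hu
    have h1 : Tendsto (fun N : ℕ => (⌊u * Real.sqrt N⌋ / Real.sqrt N : ℝ)) atTop (𝓝 u) := by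
      rw [tendsto_iff_dist_tendsto_zero]
      refine squeeze_zero' (Eventually.of_forall fun _ => dist_nonneg) ?_
        (tendsto_inv_atTop_zero.comp (Real.tendsto_sqrt_atTop.comp tendsto_natCast_atTop_atTop))
      filter_upwards [eventually_gt_atTop 0] with N hN
      exact hfl N hN u
    refine (hu.tendsto.comp h1).congr' ?_
    -- For such `N` the cell that contains `u` has an index between `0` and `N`, so the finite range
    -- of the sum does not cut it off.
    have hlarge : ∀ᶠ N : ℕ in atTop, (2 * |u| + 4) ≤ Real.sqrt N :=
      (Real.tendsto_sqrt_atTop.comp tendsto_natCast_atTop_atTop).eventually_ge_atTop _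
    filter_upwards [hlarge, eventually_gt_atTop 0] with N hN hN0
    have h2 : (N : ℝ) = Real.sqrt N * Real.sqrt N := (Real.mul_self_sqrt (Nat.cast_nonneg N)).symm
    have h3 : |u| * Real.sqrt N + 2 ≤ (N : ℝ) / 2 := by
      have := abs_nonneg u
      nlinarith
    have h4 : |u * Real.sqrt N| ≤ (N : ℝ) / 2 - 2 := by
      rw [abs_mul, abs_of_nonneg (Real.sqrt_nonneg _)]; linarith
    have h5 := abs_le.1 h4
    have h6 := Int.floor_le (u * Real.sqrt N)
    have h7 := Int.lt_floor_add_one (u * Real.sqrt N)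
    have h8 : (N : ℝ) / 2 - 1 ≤ ((N / 2 : ℕ) : ℝ) := by
      have : N ≤ 2 * (N / 2) + 1 := by omega
      have : (N : ℝ) ≤ 2 * ((N / 2 : ℕ) : ℝ) + 1 := by exact_mod_cast this
      linarith
    have h9 : ((N / 2 : ℕ) : ℝ) ≤ (N : ℝ) / 2 := by
      have : 2 * (N / 2) ≤ N := by omega
      have : 2 * ((N / 2 : ℕ) : ℝ) ≤ N := by exact_mod_cast this
      linarith
    have h10 : (-(N / 2 : ℕ) : ℤ) ≤ ⌊u * Real.sqrt N⌋ := by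
      have : (-(N / 2 : ℕ) : ℝ) < (⌊u * Real.sqrt N⌋ : ℝ) + 1 := by linarith
      have : (-(N / 2 : ℕ) : ℤ) < ⌊u * Real.sqrt N⌋ + 1 := by exact_mod_cast this
      omega
    have h11 : ⌊u * Real.sqrt N⌋ ≤ (N : ℤ) - (N / 2 : ℕ) := by
      have : (⌊u * Real.sqrt N⌋ : ℝ) ≤ (N : ℝ) - (N / 2 : ℕ) := by linarith
      exact_mod_cast this
    obtain ⟨j, hj⟩ : ∃ j : ℕ, ⌊u * Real.sqrt N⌋ = (j : ℤ) - (N / 2 : ℕ) :=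
      ⟨(⌊u * Real.sqrt N⌋ + (N / 2 : ℕ)).toNat, by omega⟩
    have hjN : j ∈ Finset.range (N + 1) := by rw [Finset.mem_range]; omega
    simp only [F, Function.comp]
    rw [Finset.sum_eq_single j]
    · rw [Set.indicator_of_mem ((hmem N hN0 j u).2 hj), hj]; simp only [Int.cast_sub, Int.cast_natCast]
    · intro j' _ hne
      apply Set.indicator_of_notMem
      intro h1
      have h3 := (hmem N hN0 j' u).1 h1
      omega
    · exact fun h1 => absurd hjN h1

end SSR

namespace SSR

open LaurentPolynomial AddMonoidAlgebra Filter MeasureTheory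

theorem coeff_law_nonneg {S : Type*} [Fintype S] (w : S → ℝ) (hw : ∀ s, 0 ≤ w s) (n : S → ℤ)
    (z : ℤ) : 0 ≤ (law w n).coeff z := by
  rw [coeff_law]; exact Finset.sum_nonneg fun s _ => hw s

theorem l1_law_eq {S : Type*} [Fintype S] (w : S → ℝ) (hw : ∀ s, 0 ≤ w s) (n : S → ℤ) :
    l1 (law w n) = ∑ s, w s := by
  classical
  rw [l1_eq_sum _ (Finset.univ.image n)]
  · rw [← Finset.sum_fiberwise_of_maps_to (g := n) (t := Finset.univ.image n)
      (fun s _ => Finset.mem_image_of_mem n (Finset.mem_univ s))]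
    refine Finset.sum_congr rfl fun z _ => ?_
    rw [abs_of_nonneg (coeff_law_nonneg w hw n z), coeff_law]
  · intro z hz
    rw [Finsupp.mem_support_iff, coeff_law] at hz
    obtain ⟨s, hs, -⟩ := Finset.exists_ne_zero_of_sum_ne_zero hz
    exact Finset.mem_image.2 ⟨s, Finset.mem_univ _, (Finset.mem_filter.1 hs).2⟩

/-! ### The discretized Gaussian law -/

theorem gaussWeight_nonneg (μ : ℕ) (v : ℝ) (n : ℕ) : 0 ≤ gaussWeight μ v n := by
  unfold gaussWeight
  split_ifs
  · exact zero_le_one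
  · exact le_rfl
  · exact (Real.exp_pos _).le

theorem gaussWeight_self (μ : ℕ) (v : ℝ) : gaussWeight μ v μ = 1 := by
  by_cases h : v = 0 <;> simp [gaussWeight, h]

theorem sum_gaussWeight_pos (K : ℕ) (v : ℝ) : 0 < ∑ j : Fin (K + 1), gaussWeight (K / 2) v j := by
  refine Finset.sum_pos' (fun j _ => gaussWeight_nonneg _ _ _)
    ⟨⟨K / 2, by omega⟩, Finset.mem_univ _, ?_⟩
  rw [gaussWeight_self]; exact zero_lt_one

theorem gaussCoeff_nonneg (K : ℕ) (s : ℝ) (j : Fin (K + 1)) : 0 ≤ gaussCoeff K s j :=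
  Real.sqrt_nonneg _

theorem gaussCoeff_sq (K : ℕ) (s : ℝ) (j : Fin (K + 1)) : gaussCoeff K s j ^ 2 =
    gaussWeight (K / 2) (s / 4) j / ∑ j : Fin (K + 1), gaussWeight (K / 2) (s / 4) j :=
  Real.sq_sqrt (div_nonneg (gaussWeight_nonneg _ _ _) (sum_gaussWeight_pos _ _).le)

theorem sum_gaussCoeff_sq (K : ℕ) (s : ℝ) : ∑ j, gaussCoeff K s j ^ 2 = 1 := by
  simp only [gaussCoeff_sq]
  rw [← Finset.sum_div, div_self (sum_gaussWeight_pos _ _).ne']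

/-- The law of Alice's particle number in the Gaussian state. -/
def gaussLaw (K : ℕ) (s : ℝ) : ℝ[T;T⁻¹] :=
  law (fun j : Fin (K + 1) => gaussCoeff K s j ^ 2) (fun j => ((j : ℕ) : ℤ))

theorem gaussWeight_scaled (V : ℝ) (hV : 0 < V) (N : ℕ) (hN : 0 < N) (n : ℕ) :
    gaussWeight (N / 2) (N * V / 4) n =
      Real.exp (-(((n : ℝ) - (N / 2 : ℕ)) / Real.sqrt N) ^ 2 / (2 * (V / 4))) := by
  have hN' : (0 : ℝ) < N := by exact_mod_cast hN
  unfold gaussWeight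
  rw [if_neg (by positivity), div_pow, Real.sq_sqrt hN'.le]
  congr 1
  field_simp

theorem tendsto_sum_gaussWeight (V : ℝ) (hV : 0 < V) (g : ℝ → ℝ)
    (hc : ∀ᵐ u : ℝ, ContinuousAt g u) (hb : ∀ y, |g y| ≤ 1 + y ^ 2) :
    Tendsto (fun N : ℕ => (Real.sqrt N)⁻¹ * ∑ j : Fin (N + 1),
      gaussWeight (N / 2) (N * V / 4) j * g (((j : ℕ) - (N / 2 : ℕ) : ℝ) / Real.sqrt N)) atTop
      (𝓝 (∫ y, Real.exp (-y ^ 2 / (2 * (V / 4))) * g y)) := by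
  have h := tendsto_riemann_sum (V / 4) (by positivity)
    (fun y => Real.exp (-y ^ 2 / (2 * (V / 4))) * g y)
    (by
      filter_upwards [hc] with u hu
      exact ContinuousAt.mul (by fun_prop) hu)
    (fun y => by
      rw [abs_mul, abs_of_pos (Real.exp_pos _), mul_comm]
      gcongr
      exact hb y)
  refine h.congr' ?_
  filter_upwards [eventually_gt_atTop 0] with N hN
  rw [Finset.sum_range]
  congr 1
  refine Finset.sum_congr rfl fun j _ => ?_
  rw [gaussWeight_scaled V hV N hN]

theorem integral_gaussian_eq (V : ℝ) (hV : 0 < V) (g : ℝ → ℝ) :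
    ∫ y, g y ∂(ProbabilityTheory.gaussianReal 0 (V / 4).toNNReal) =
      (∫ y, Real.exp (-y ^ 2 / (2 * (V / 4))) * g y) /
        Real.sqrt (2 * Real.pi * (V / 4)) := by
  have hv : (V / 4).toNNReal ≠ 0 := by
    rw [Ne, Real.toNNReal_eq_zero]; exact not_le.2 (by positivity)
  rw [ProbabilityTheory.integral_gaussianReal_eq_integral_smul hv, ← integral_div]
  refine integral_congr_ae (Eventually.of_forall fun y => ?_)
  simp only [ProbabilityTheory.gaussianPDFReal, smul_eq_mul, sub_zero,
    Real.coe_toNNReal _ (show 0 ≤ V / 4 by positivity)]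
  ring

theorem integral_exp_gaussian (V : ℝ) (hV : 0 < V) :
    ∫ y : ℝ, Real.exp (-y ^ 2 / (2 * (V / 4))) = Real.sqrt (2 * Real.pi * (V / 4)) := by
  have h := integral_gaussian_eq V hV (fun _ => 1)
  have hpos : 0 < Real.sqrt (2 * Real.pi * (V / 4)) := Real.sqrt_pos.2 (by positivity)
  simp only [integral_const, probReal_univ, smul_eq_mul, mul_one] at h
  rw [eq_div_iff hpos.ne', one_mul] at h
  exact h.symm

theorem tendsto_gaussWeight_mass (V : ℝ) (hV : 0 < V) :
    Tendsto (fun N : ℕ => (Real.sqrt N)⁻¹ * ∑ j : Fin (N + 1),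
      gaussWeight (N / 2) (N * V / 4) j) atTop (𝓝 (Real.sqrt (2 * Real.pi * (V / 4)))) := by
  have h := tendsto_sum_gaussWeight V hV (fun _ => 1)
    (Eventually.of_forall fun _ => continuousAt_const) (fun y => by simp; positivity)
  simpa only [mul_one, integral_exp_gaussian V hV] using h

/-- Expectations under the discretized Gaussian law converge to Gaussian expectations. -/
theorem tendsto_sum_gaussCoeff_sq (V : ℝ) (hV : 0 < V) (g : ℝ → ℝ)
    (hc : ∀ᵐ u : ℝ, ContinuousAt g u) (hb : ∀ y, |g y| ≤ 1 + y ^ 2) :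
    Tendsto (fun N : ℕ => ∑ j : Fin (N + 1),
      gaussCoeff N (N * V) j ^ 2 * g (((j : ℕ) - (N / 2 : ℕ) : ℝ) / Real.sqrt N)) atTop
      (𝓝 (∫ y, g y ∂(ProbabilityTheory.gaussianReal 0 (V / 4).toNNReal))) := by
  rw [integral_gaussian_eq V hV]
  refine ((tendsto_sum_gaussWeight V hV g hc hb).div (tendsto_gaussWeight_mass V hV)
    (Real.sqrt_pos.2 (by positivity)).ne').congr' ?_
  filter_upwards [eventually_gt_atTop 0] with N hN
  have hN' : 0 < Real.sqrt N := Real.sqrt_pos.2 (by exact_mod_cast hN)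
  rw [Pi.div_apply, mul_div_mul_left _ _ (inv_pos.2 hN').ne', Finset.sum_div]
  refine Finset.sum_congr rfl fun j _ => ?_
  rw [gaussCoeff_sq]; ring

theorem tendsto_cdf_gaussLaw (V : ℝ) (hV : 0 < V) (x : ℝ) :
    Tendsto (fun N : ℕ => cdf (gaussLaw N (N * V)) ((N / 2 : ℕ) + x * Real.sqrt N)) atTop
      (𝓝 ((ProbabilityTheory.gaussianReal 0 (V / 4).toNNReal).real (Set.Iic x))) := by
  have h := tendsto_sum_gaussCoeff_sq V hV (Set.indicator (Set.Iic x) 1) ?_ ?_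
  · rw [integral_indicator_one measurableSet_Iic] at h
    refine h.congr' ?_
    filter_upwards [eventually_gt_atTop 0] with N hN
    have hN' : 0 < Real.sqrt N := Real.sqrt_pos.2 (by exact_mod_cast hN)
    rw [gaussLaw, cdf_law]
    refine Finset.sum_congr rfl fun j _ => ?_
    have : ((j : ℕ) - (N / 2 : ℕ) : ℝ) / Real.sqrt N ∈ Set.Iic x ↔
        (((j : ℕ) : ℤ) : ℝ) ≤ (N / 2 : ℕ) + x * Real.sqrt N := by
      rw [Set.mem_Iic, div_le_iff₀ hN', Int.cast_natCast]
      constructor <;> intro h <;> linarith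
    by_cases h1 : (((j : ℕ) : ℤ) : ℝ) ≤ (N / 2 : ℕ) + x * Real.sqrt N
    · rw [if_pos h1, Set.indicator_of_mem (this.2 h1), Pi.one_apply, mul_one]
    · rw [if_neg h1, Set.indicator_of_notMem (fun h2 => h1 (this.1 h2)), mul_zero]
  · have : ∀ᵐ u : ℝ, u ≠ x := by
      rw [ae_iff]; simp
    filter_upwards [this] with u hu
    rcases lt_or_gt_of_ne hu with h1 | h1
    · refine (continuousAt_const (y := (1 : ℝ))).congr ?_
      filter_upwards [gt_mem_nhds h1] with y hy
      rw [Set.indicator_of_mem (show y ∈ Set.Iic x from le_of_lt hy)]; rfl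
    · refine (continuousAt_const (y := (0 : ℝ))).congr ?_
      filter_upwards [lt_mem_nhds h1] with y hy
      rw [Set.indicator_of_notMem (show y ∉ Set.Iic x from not_le.2 hy)]
  · intro y
    by_cases hy : y ∈ Set.Iic x
    · rw [Set.indicator_of_mem hy, Pi.one_apply, abs_one]; nlinarith [sq_nonneg y]
    · rw [Set.indicator_of_notMem hy, abs_zero]; positivity

/-- Centring at `⌊N / 2⌋` leaves the variance unchanged and scaling by `√N` divides it by `N`, so it
suffices that the first two scaled moments converge. -/
theorem tendsto_gauss_variance (V : ℝ) (hV : 0 < V) :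
    Tendsto (fun N : ℕ => 4 * (∑ j : Fin (N + 1), gaussCoeff N (N * V) j ^ 2 * ((j : ℕ) : ℝ) ^ 2 -
      (∑ j : Fin (N + 1), gaussCoeff N (N * V) j ^ 2 * ((j : ℕ) : ℝ)) ^ 2) / N) atTop (𝓝 V) := by
  have h2 := tendsto_sum_gaussCoeff_sq V hV (fun y => y ^ 2)
    (Eventually.of_forall fun _ => by fun_prop)
    (fun y => by rw [abs_of_nonneg (sq_nonneg y)]; linarith)
  have h1 := tendsto_sum_gaussCoeff_sq V hV (fun y => y)
    (Eventually.of_forall fun _ => by fun_prop)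
    (fun y => by rw [abs_le]; constructor <;> nlinarith [sq_nonneg (y - 1), sq_nonneg (y + 1)])
  rw [ProbabilityTheory.integral_id_gaussianReal] at h1
  have hvar : ∫ y, y ^ 2 ∂(ProbabilityTheory.gaussianReal 0 (V / 4).toNNReal) = V / 4 := by
    have h3 := ProbabilityTheory.variance_id_gaussianReal (μ := 0) (v := (V / 4).toNNReal)
    rw [ProbabilityTheory.variance_eq_sub (ProbabilityTheory.memLp_id_gaussianReal 2)] at h3
    simp only [Pi.pow_apply, id, ProbabilityTheory.integral_id_gaussianReal] at h3
    rw [Real.coe_toNNReal _ (show 0 ≤ V / 4 by positivity)] at h3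
    linarith
  rw [hvar] at h2
  have h4 := (h2.sub (h1.pow 2)).const_mul 4
  have h5 : 4 * (V / 4 - 0 ^ 2) = V := by ring
  rw [h5] at h4
  refine h4.congr' ?_
  filter_upwards [eventually_gt_atTop 0] with N hN
  have hN' : 0 < Real.sqrt N := Real.sqrt_pos.2 (by exact_mod_cast hN)
  have hNN : Real.sqrt N ^ 2 = N := Real.sq_sqrt (Nat.cast_nonneg N)
  set μ : ℝ := ((N / 2 : ℕ) : ℝ)
  have e1 : ∑ j : Fin (N + 1), gaussCoeff N (N * V) j ^ 2 * ((((j : ℕ) : ℝ) - μ) / Real.sqrt N) =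
      (∑ j : Fin (N + 1), gaussCoeff N (N * V) j ^ 2 * ((j : ℕ) : ℝ) - μ) / Real.sqrt N := by
    have : ∀ j : Fin (N + 1), gaussCoeff N (N * V) j ^ 2 * ((((j : ℕ) : ℝ) - μ) / Real.sqrt N) =
      (gaussCoeff N (N * V) j ^ 2 * ((j : ℕ) : ℝ) - μ * gaussCoeff N (N * V) j ^ 2) /
        Real.sqrt N := fun j => by ring
    rw [Finset.sum_congr rfl fun j _ => this j, ← Finset.sum_div, Finset.sum_sub_distrib,
      ← Finset.mul_sum, sum_gaussCoeff_sq, mul_one]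
  have e2 : ∑ j : Fin (N + 1), gaussCoeff N (N * V) j ^ 2 *
      ((((j : ℕ) : ℝ) - μ) / Real.sqrt N) ^ 2 =
      (∑ j : Fin (N + 1), gaussCoeff N (N * V) j ^ 2 * ((j : ℕ) : ℝ) ^ 2 -
        2 * μ * ∑ j : Fin (N + 1), gaussCoeff N (N * V) j ^ 2 * ((j : ℕ) : ℝ) + μ ^ 2) / N := by
    have : ∀ j : Fin (N + 1), gaussCoeff N (N * V) j ^ 2 *
      ((((j : ℕ) : ℝ) - μ) / Real.sqrt N) ^ 2 =
      (gaussCoeff N (N * V) j ^ 2 * ((j : ℕ) : ℝ) ^ 2 -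
        2 * μ * (gaussCoeff N (N * V) j ^ 2 * ((j : ℕ) : ℝ)) +
        μ ^ 2 * gaussCoeff N (N * V) j ^ 2) / N := fun j => by rw [div_pow, hNN]; ring
    rw [Finset.sum_congr rfl fun j _ => this j, ← Finset.sum_div, Finset.sum_add_distrib,
      Finset.sum_sub_distrib, ← Finset.mul_sum, ← Finset.mul_sum, sum_gaussCoeff_sq, mul_one]
  rw [e1, e2, div_pow, hNN]
  ring

theorem sum_Ioc_telescope (f : ℤ → ℝ) (a : ℤ) (k : ℕ) :
    ∑ z ∈ Finset.Ioc a (a + k), (f z - f (z - 1)) = f (a + k) - f a := by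
  induction k with
  | zero => simp
  | succ k ih =>
    have h1 : Finset.Ioc a (a + (k + 1 : ℕ)) = insert (a + (k + 1 : ℕ)) (Finset.Ioc a (a + k)) := by
      ext x; simp only [Finset.mem_Ioc, Finset.mem_insert]; omega
    rw [h1, Finset.sum_insert (by simp), ih]
    have : a + ((k + 1 : ℕ) : ℤ) - 1 = a + k := by push_cast; ring
    rw [this]; ring

/-- The law is unimodal, so its variation telescopes to twice the peak. The peak weight is 1 before
normalization. -/
theorem l1_one_sub_T_mul_gaussLaw (N : ℕ) (s : ℝ) (hs : 0 ≤ s) :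
    l1 ((1 - T 1) * gaussLaw N s) ≤
      2 / ∑ j : Fin (N + 1), gaussWeight (N / 2) (s / 4) j := by
  set W := ∑ j : Fin (N + 1), gaussWeight (N / 2) (s / 4) j with hW
  have hWpos : 0 < W := sum_gaussWeight_pos N (s / 4)
  set f : ℤ → ℝ := fun z => (gaussLaw N s).coeff z with hf
  have hfin : ∀ j : ℕ, j ≤ N → f j = gaussWeight (N / 2) (s / 4) j / W := by
    intro j hj
    simp only [hf, gaussLaw]
    rw [coeff_law, Finset.sum_eq_single (⟨j, by omega⟩ : Fin (N + 1))]
    · rw [gaussCoeff_sq]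
    · intro j' hj' hne
      rw [Finset.mem_filter] at hj'
      exact absurd (Fin.ext (by simpa using hj'.2)) hne
    · intro h
      exact (h (Finset.mem_filter.2 ⟨Finset.mem_univ _, rfl⟩)).elim
  have hfout : ∀ z : ℤ, z < 0 ∨ (N : ℤ) < z → f z = 0 := by
    intro z hz
    simp only [hf, gaussLaw]
    rw [coeff_law, Finset.sum_eq_zero]
    intro j hj
    rw [Finset.mem_filter] at hj
    have := j.2
    omega
  have hfnn : ∀ z, 0 ≤ f z := coeff_law_nonneg _ (fun j => sq_nonneg _) _
  have hmono : ∀ i j : ℕ, (i ≤ j ∧ j ≤ N / 2) ∨ (j ≤ i ∧ N / 2 ≤ j) →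
      gaussWeight (N / 2) (s / 4) i ≤ gaussWeight (N / 2) (s / 4) j := by
    intro i j hij
    unfold gaussWeight
    split_ifs with h1 h2 h3
    · exact le_rfl
    · omega
    · exact zero_le_one
    · exact le_rfl
    · apply Real.exp_le_exp.2
      apply div_le_div_of_nonneg_right _ (by positivity)
      rw [neg_le_neg_iff]
      have h4 : ∀ x y : ℕ, x ≤ y → (x : ℝ) ≤ y := fun x y h => by exact_mod_cast h
      rcases hij with ⟨h5, h6⟩ | ⟨h5, h6⟩ <;> nlinarith [h4 _ _ h5, h4 _ _ h6]
  have hup : ∀ z ∈ Finset.Ioc (-1 : ℤ) ((N / 2 : ℕ) : ℤ), f (z - 1) ≤ f z := by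
    intro z hz
    rw [Finset.mem_Ioc] at hz
    rcases eq_or_lt_of_le (show 0 ≤ z by omega) with h0 | h0
    · rw [hfout (z - 1) (by omega)]; exact hfnn z
    · obtain ⟨k, rfl⟩ : ∃ k : ℕ, z = k + 1 := ⟨(z - 1).toNat, by omega⟩
      have e1 := hfin k (by omega)
      have e2 := hfin (k + 1) (by omega)
      push_cast at e2
      rw [add_sub_cancel_right, e1, e2]
      exact div_le_div_of_nonneg_right (hmono k (k + 1) (by omega)) hWpos.le
  have hdown : ∀ z ∈ Finset.Ioc ((N / 2 : ℕ) : ℤ) (N + 1), f z ≤ f (z - 1) := by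
    intro z hz
    rw [Finset.mem_Ioc] at hz
    rcases eq_or_lt_of_le (show z ≤ N + 1 by omega) with h0 | h0
    · rw [hfout z (by omega)]; exact hfnn _
    · obtain ⟨k, rfl⟩ : ∃ k : ℕ, z = k + 1 := ⟨(z - 1).toNat, by omega⟩
      have e1 := hfin k (by omega)
      have e2 := hfin (k + 1) (by omega)
      push_cast at e2
      rw [add_sub_cancel_right, e1, e2]
      exact div_le_div_of_nonneg_right (hmono (k + 1) k (by omega)) hWpos.le
  have hcoef : ∀ z, ((1 - T 1) * gaussLaw N s).coeff z = f z - f (z - 1) := by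
    intro z
    rw [sub_mul, one_mul, AddMonoidAlgebra.coeff_sub, Finsupp.sub_apply, coeff_T_mul]
  have hfmid : f ((N / 2 : ℕ) : ℤ) = 1 / W := by
    rw [hfin (N / 2) (by omega), gaussWeight_self]
  rw [l1_eq_sum _ (Finset.Ioc (-1 : ℤ) ((N / 2 : ℕ) : ℤ) ∪ Finset.Ioc ((N / 2 : ℕ) : ℤ) (N + 1)),
    Finset.sum_union (Finset.Ioc_disjoint_Ioc_of_le le_rfl)]
  · have s1 : ∑ z ∈ Finset.Ioc (-1 : ℤ) ((N / 2 : ℕ) : ℤ),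
        |((1 - T 1) * gaussLaw N s).coeff z| = 1 / W := by
      have h1 : ∀ z ∈ Finset.Ioc (-1 : ℤ) ((N / 2 : ℕ) : ℤ),
          |((1 - T 1) * gaussLaw N s).coeff z| = f z - f (z - 1) := fun z hz => by
        rw [hcoef, abs_of_nonneg (sub_nonneg.2 (hup z hz))]
      rw [Finset.sum_congr rfl h1]
      have h2 := sum_Ioc_telescope f (-1) (N / 2 + 1)
      have h3 : (-1 : ℤ) + ((N / 2 + 1 : ℕ) : ℤ) = ((N / 2 : ℕ) : ℤ) := by omega
      rw [h3, hfmid, hfout (-1) (by omega), sub_zero] at h2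
      exact h2
    have s2 : ∑ z ∈ Finset.Ioc ((N / 2 : ℕ) : ℤ) (N + 1),
        |((1 - T 1) * gaussLaw N s).coeff z| = 1 / W := by
      have h1 : ∀ z ∈ Finset.Ioc ((N / 2 : ℕ) : ℤ) (N + 1),
          |((1 - T 1) * gaussLaw N s).coeff z| = -(f z - f (z - 1)) := fun z hz => by
        rw [hcoef, abs_of_nonpos (sub_nonpos.2 (hdown z hz))]
      rw [Finset.sum_congr rfl h1, Finset.sum_neg_distrib]
      have h2 := sum_Ioc_telescope f ((N / 2 : ℕ) : ℤ) (N + 1 - N / 2)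
      have h3 : ((N / 2 : ℕ) : ℤ) + ((N + 1 - N / 2 : ℕ) : ℤ) = N + 1 := by omega
      rw [h3, hfmid, hfout (N + 1) (by omega), zero_sub] at h2
      rw [h2, neg_neg]
    rw [s1, s2]
    apply le_of_eq; ring
  · intro z hz
    rw [Finsupp.mem_support_iff, hcoef] at hz
    by_contra hno
    apply hz
    rw [Finset.mem_union, Finset.mem_Ioc, Finset.mem_Ioc] at hno
    rw [hfout z (by omega), hfout (z - 1) (by omega), sub_zero]

theorem exists_l1_gaussLaw_le (V : ℝ) (hV : 0 < V) :
    ∃ C : ℝ, 0 ≤ C ∧ ∀ᶠ N : ℕ in atTop, l1 ((1 - T 1) * gaussLaw N (N * V)) ≤ C / Real.sqrt N := by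
  set Z := Real.sqrt (2 * Real.pi * (V / 4)) with hZ
  have hZ0 : 0 < Z := Real.sqrt_pos.2 (by positivity)
  -- The normalizing sum is asymptotic to `Z √N`, hence eventually at least half of that.
  refine ⟨2 / (Z / 2), by positivity, ?_⟩
  filter_upwards [(tendsto_gaussWeight_mass V hV).eventually (lt_mem_nhds (show Z / 2 < Z by linarith)),
    eventually_gt_atTop 0] with N h1 hN
  have hN' : 0 < Real.sqrt N := Real.sqrt_pos.2 (by exact_mod_cast hN)
  refine (l1_one_sub_T_mul_gaussLaw N (N * V) (by positivity)).trans ?_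
  rw [div_div]
  gcongr
  rw [← div_eq_inv_mul, lt_div_iff₀ hN'] at h1
  exact h1.le

end SSR

namespace SSR

open LaurentPolynomial AddMonoidAlgebra Filter MeasureTheory

/-! ### Convergence to the discretized Gaussian in total variation -/

theorem cdf_T_mul (m : ℤ) (p : ℝ[T;T⁻¹]) (y : ℝ) : cdf (T m * p) y = cdf p (y - m) := by
  induction p using AddMonoidAlgebra.induction_linear with
  | zero => simp [cdf]
  | add p q hp hq => rw [mul_add, cdf_add, cdf_add, hp, hq]
  | single z c =>
    rw [T, AddMonoidAlgebra.single_mul_single, cdf_single, cdf_single, one_mul]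
    have : ((m + z : ℤ) : ℝ) ≤ y ↔ (z : ℝ) ≤ y - m := by
      push_cast
      constructor <;> intro h <;> linarith
    simp only [this]

theorem cdf_smul (c : ℝ) (p : ℝ[T;T⁻¹]) (y : ℝ) : cdf (c • p) y = c * cdf p y := by
  rw [cdf_eq_sum (c • p) y p.coeff.support (by
    rw [AddMonoidAlgebra.coeff_smul]; exact Finsupp.support_smul), cdf, Finsupp.sum, Finset.mul_sum]
  refine Finset.sum_congr rfl fun z _ => ?_
  split_ifs <;> simp

theorem cdf_mono (p : ℝ[T;T⁻¹]) (hp : ∀ z, 0 ≤ p.coeff z) : Monotone (cdf p) := by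
  intro y y' h
  have := cdf_sub_cdf p h
  have h2 : 0 ≤ ∑ z ∈ Finset.Ioc ⌊y⌋ ⌊y'⌋, p.coeff z := Finset.sum_nonneg fun z _ => hp z
  linarith

/-- The uniform law on `0, …, d - 1`. -/
def unifLaw (d : ℕ) : ℝ[T;T⁻¹] := law (fun _ : Fin d => (1 / d : ℝ)) (fun j => ((j : ℕ) : ℤ))

theorem unifLaw_eq (d : ℕ) : unifLaw d = (1 / d : ℝ) • ∑ j ∈ Finset.range d, T (j : ℤ) := by
  rw [unifLaw, law, Finset.smul_sum, Finset.sum_range]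
  refine Finset.sum_congr rfl fun j _ => ?_
  rw [T, AddMonoidAlgebra.smul_single, smul_eq_mul, mul_one]

/-- A telescoping sum. It trades regularity under the shift `d` for regularity under the unit shift.
-/
theorem one_sub_T_mul_unifLaw (d : ℕ) : (1 - T 1) * unifLaw d = (1 / d : ℝ) • (1 - T (d : ℤ)) := by
  rw [unifLaw_eq, mul_smul_comm]
  congr 1
  induction d with
  | zero => simp
  | succ d ih =>
    rw [Finset.sum_range_succ, mul_add, ih]
    push_cast
    rw [T_add]
    ring

/-- By monotonicity, `F N (u N)` is squeezed between values at `x ± δ / 2`. This absorbs the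
perturbation of order `1 / √N` that comes from rounding the mean and from the offsets inside one
period. -/
theorem tendsto_of_monotone_of_tendsto (F : ℕ → ℝ → ℝ) (hF : ∀ N, Monotone (F N)) (Φ : ℝ → ℝ)
    (hΦ : ∀ y, Tendsto (fun N => F N y) atTop (𝓝 (Φ y))) (x : ℝ) (hx : ContinuousAt Φ x)
    (u : ℕ → ℝ) (hu : Tendsto u atTop (𝓝 x)) : Tendsto (fun N => F N (u N)) atTop (𝓝 (Φ x)) := by
  rw [Metric.tendsto_nhds]
  intro ε hε
  obtain ⟨δ, hδ, hδΦ⟩ := Metric.continuousAt_iff.1 hx (ε / 2) (by positivity)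
  have h1 := hδΦ (x := x + δ / 2) (by rw [Real.dist_eq, add_sub_cancel_left, abs_of_pos] <;> linarith)
  have h2 := hδΦ (x := x - δ / 2) (by
    rw [Real.dist_eq, sub_sub_cancel_left, abs_neg, abs_of_pos] <;> linarith)
  rw [Real.dist_eq, abs_lt] at h1 h2
  filter_upwards [(hΦ (x + δ / 2)).eventually (gt_mem_nhds (show _ < Φ x + ε by linarith)),
    (hΦ (x - δ / 2)).eventually (lt_mem_nhds (show Φ x - ε < _ by linarith)),
    hu.eventually (gt_mem_nhds (show x < x + δ / 2 by linarith)),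
    hu.eventually (lt_mem_nhds (show x - δ / 2 < x by linarith))] with N h3 h4 h5 h6
  have h7 := hF N h5.le
  have h8 := hF N h6.le
  rw [Real.dist_eq, abs_lt]
  constructor <;> linarith

theorem continuousAt_real_Iic (μ : Measure ℝ) [IsProbabilityMeasure μ] (x : ℝ) (hx : μ {x} = 0) :
    ContinuousAt (fun y => μ.real (Set.Iic y)) x := by
  have h1 : (fun y => μ.real (Set.Iic y)) = ProbabilityTheory.cdf μ := by
    ext y; rw [ProbabilityTheory.cdf_eq_real]
  rw [h1]
  rw [(ProbabilityTheory.monotone_cdf μ).continuousAt_iff_leftLim_eq_rightLim,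
    StieltjesFunction.rightLim_eq]
  rw [← ProbabilityTheory.measure_cdf μ, StieltjesFunction.measure_singleton,
    ENNReal.ofReal_eq_zero] at hx
  exact le_antisymm ((ProbabilityTheory.monotone_cdf μ).leftLim_le le_rfl) (by linarith)

section period

variable {S : Type*} [Fintype S]

theorem exists_ne_of_variance_pos (w : S → ℝ) (hw : ∀ s, 0 ≤ w s) (hw1 : ∑ s, w s = 1)
    (n : S → ℤ) (hv : 0 < ∑ s, w s * (n s : ℝ) ^ 2 - (∑ s, w s * n s) ^ 2) :
    ∃ s s', 0 < w s ∧ 0 < w s' ∧ n s ≠ n s' := by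
  by_contra hno
  push Not at hno
  obtain ⟨s₀, -, hs₀⟩ : ∃ s ∈ Finset.univ, 0 < w s := by
    by_contra h
    push Not at h
    have := Finset.sum_nonpos h
    linarith
  have h1 : ∀ s, w s * (n s : ℝ) = n s₀ * w s := by
    intro s
    rcases eq_or_lt_of_le (hw s) with h | h
    · rw [← h]; ring
    · rw [hno s s₀ h hs₀]; ring
  have h2 : ∀ s, w s * (n s : ℝ) ^ 2 = n s₀ ^ 2 * w s := by
    intro s
    rw [pow_two, ← mul_assoc, h1, mul_assoc, h1]; ring
  simp only [h1, h2, ← Finset.mul_sum, hw1] at hv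
  linarith

/-- Sums of independent variables, spread out uniformly over one period of their lattice, are close
to the discretized Gaussian in total variation. -/
theorem exists_period_tendsto_gauss (w : S → ℝ) (hw : ∀ s, 0 ≤ w s) (hw1 : ∑ s, w s = 1)
    (n : S → ℤ) (V : ℝ) (hV : 4 * (∑ s, w s * (n s : ℝ) ^ 2 - (∑ s, w s * n s) ^ 2) = V)
    (hV0 : 0 < V) :
    ∃ d : ℕ, 0 < d ∧ (∀ s s', 0 < w s → 0 < w s' → (d : ℤ) ∣ n s - n s') ∧ ∃ Δ : ℕ → ℤ,
      Tendsto (fun N : ℕ => l1 (T (Δ N) * (unifLaw d * law w n ^ N) - gaussLaw N (N * V))) atTop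
        (𝓝 0) := by
  set v := V / 4 with hv
  have hvar : ∑ s, w s * (n s : ℝ) ^ 2 - (∑ s, w s * n s) ^ 2 = v := by rw [hv]; linarith
  have hv0 : 0 < v := by positivity
  set m := ∑ s, w s * (n s : ℝ) with hm
  -- The period is the generator of the group of all smooth shifts. It divides every difference of
  -- occurring numbers and is itself a smooth shift; positive variance makes it nonzero.
  obtain ⟨g, hg⟩ := Int.subgroup_cyclic (smoothShifts (law w n))
  rw [← AddSubgroup.zmultiples_eq_closure] at hg
  have hdiv : ∀ s s', 0 < w s → 0 < w s' → (g.natAbs : ℤ) ∣ n s - n s' := by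
    intro s s' hs hs'
    have h1 := sub_mem_smoothShifts w hw hw1 n s s' hs hs'
    rw [hg, Int.mem_zmultiples_iff] at h1
    rwa [Int.natAbs_dvd]
  have hd0 : 0 < g.natAbs := by
    rw [Nat.pos_iff_ne_zero]
    intro h0
    obtain ⟨s, s', hs, hs', hne⟩ := exists_ne_of_variance_pos w hw hw1 n (by rw [hvar]; exact hv0)
    have := hdiv s s' hs hs'
    rw [h0, Nat.cast_zero, zero_dvd_iff] at this
    omega
  set d := g.natAbs with hd
  have hdmem : (d : ℤ) ∈ smoothShifts (law w n) := by
    rw [hg, Int.mem_zmultiples_iff, hd, Int.dvd_natAbs]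
  obtain ⟨C₀, hC₀⟩ := hdmem
  obtain ⟨C₁, hC₁0, hC₁⟩ := exists_l1_gaussLaw_le V hV0
  -- The translation moves the rounded mean to the centre `⌊N / 2⌋` of the Gaussian.
  refine ⟨d, hd0, hdiv, fun N => ((N / 2 : ℕ) : ℤ) - ⌊(N : ℝ) * m⌋, ?_⟩
  set Δ : ℕ → ℤ := fun N => ((N / 2 : ℕ) : ℤ) - ⌊(N : ℝ) * m⌋ with hΔ
  set γ := ProbabilityTheory.gaussianReal 0 v.toNNReal with hγ
  have hvne : v.toNNReal ≠ 0 := by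
    rw [Ne, Real.toNNReal_eq_zero]; exact not_le.2 hv0
  have hna := ProbabilityTheory.nullSingletonClass_gaussianReal (μ := 0) hvne
  have hPlaw : ∀ N : ℕ, T (Δ N) * (unifLaw d * law w n ^ N) =
      law (fun p : Fin d × (Fin N → S) => (1 / d : ℝ) * ∏ i, w (p.2 i))
        (fun p => (Δ N + (p.1 : ℕ)) + ∑ i, n (p.2 i)) := by
    intro N
    rw [law_mul (fun _ : Fin d => (1 / d : ℝ)) (fun j => Δ N + ((j : ℕ) : ℤ)) (fun s : Fin N → S =>
      ∏ i, w (s i)) (fun s => ∑ i, n (s i)), law_pow, ← mul_assoc]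
    congr 1
    rw [unifLaw, law, law, Finset.mul_sum]
    refine Finset.sum_congr rfl fun j _ => ?_
    rw [T, AddMonoidAlgebra.single_mul_single, one_mul]
  have hPw : ∀ (N : ℕ) (p : Fin d × (Fin N → S)), 0 ≤ (1 / d : ℝ) * ∏ i, w (p.2 i) :=
    fun N p => mul_nonneg (by positivity) (Finset.prod_nonneg fun i _ => hw _)
  refine tendsto_l1_sub_of_cdf _ _ (fun N z => ?_) (fun N z => ?_) (fun N => ?_) (fun N => ?_)
    (fun N => ((N / 2 : ℕ) : ℝ)) (fun x => γ.real (Set.Iic x)) ?_ ?_ (fun x => ?_) (fun x => ?_)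
    (|C₀| + C₁) ?_ ?_
  · rw [hPlaw]; exact coeff_law_nonneg _ (hPw N) _ _
  · exact coeff_law_nonneg _ (fun j => sq_nonneg _) _ _
  · rw [hPlaw, l1_law_eq _ (hPw N), Fintype.sum_prod_type]
    simp only [← Finset.mul_sum, sum_prod_pi w hw1]
    simp [hd0.ne']
  · rw [gaussLaw, l1_law_eq _ (fun j => sq_nonneg _), sum_gaussCoeff_sq]
  · exact (ProbabilityTheory.tendsto_cdf_atBot γ).congr fun x => ProbabilityTheory.cdf_eq_real γ x
  · exact (ProbabilityTheory.tendsto_cdf_atTop γ).congr fun x => ProbabilityTheory.cdf_eq_real γ x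
  · have hcdf : ∀ N : ℕ, 0 < N → cdf (T (Δ N) * (unifLaw d * law w n ^ N))
        (((N / 2 : ℕ) : ℝ) + x * Real.sqrt N) = (1 / d : ℝ) * ∑ j ∈ Finset.range d,
          cdf (law w n ^ N) (N * m +
            (x + ((⌊(N : ℝ) * m⌋ - N * m) - j) / Real.sqrt N) * Real.sqrt N) := by
      intro N hN
      have hN' : 0 < Real.sqrt N := Real.sqrt_pos.2 (by exact_mod_cast hN)
      rw [cdf_T_mul, unifLaw_eq, smul_mul_assoc, cdf_smul, Finset.sum_mul, cdf_sum]
      congr 1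
      refine Finset.sum_congr rfl fun j _ => ?_
      rw [cdf_T_mul]
      congr 1
      simp only [hΔ, Int.cast_sub, Int.cast_natCast]
      field_simp
      ring
    have hlim : ∀ j ∈ Finset.range d, Tendsto (fun N : ℕ => cdf (law w n ^ N) (N * m +
            (x + ((⌊(N : ℝ) * m⌋ - N * m) - j) / Real.sqrt N) * Real.sqrt N)) atTop
            (𝓝 (γ.real (Set.Iic x))) := by
      intro j _
      refine tendsto_of_monotone_of_tendsto
        (fun N y => cdf (law w n ^ N) (N * m + y * Real.sqrt N)) (fun N => ?_)
        (fun y => γ.real (Set.Iic y))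
        (fun y => tendsto_cdf_law_pow w hw hw1 n v hvar hv0 y) x
        (continuousAt_real_Iic γ x (measure_singleton x)) _ ?_
      · intro y y' h
        refine cdf_mono _ (fun z => ?_) ?_
        · rw [← law_pow]
          exact coeff_law_nonneg _ (fun s => Finset.prod_nonneg fun i _ => hw _) _ _
        · gcongr
      · have h1 : Tendsto (fun N : ℕ => ((⌊(N : ℝ) * m⌋ - N * m) - j) / Real.sqrt N) atTop (𝓝 0) := by
          refine squeeze_zero_norm' (a := fun N : ℕ => (1 + j : ℝ) / Real.sqrt N) ?_
            (tendsto_const_nhds.div_atTop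
              (Real.tendsto_sqrt_atTop.comp tendsto_natCast_atTop_atTop))
          filter_upwards with N
          rw [norm_div, Real.norm_eq_abs, Real.norm_eq_abs, abs_of_nonneg (Real.sqrt_nonneg _)]
          gcongr
          have h2 := Int.floor_le ((N : ℝ) * m)
          have h3 := Int.lt_floor_add_one ((N : ℝ) * m)
          have h4 : (0 : ℝ) ≤ j := Nat.cast_nonneg j
          rw [abs_le]; constructor <;> linarith
        simpa using h1.const_add x
    have h2 := (tendsto_finsetSum _ hlim).const_mul (1 / d : ℝ)
    have h3 : (1 / d : ℝ) * ∑ j ∈ Finset.range d, γ.real (Set.Iic x) = γ.real (Set.Iic x) := by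
      rw [Finset.sum_const, Finset.card_range, nsmul_eq_mul]
      have : (d : ℝ) ≠ 0 := by exact_mod_cast hd0.ne'
      field_simp
    rw [h3] at h2
    refine h2.congr' ?_
    filter_upwards [eventually_gt_atTop 0] with N hN
    exact (hcdf N hN).symm
  · exact tendsto_cdf_gaussLaw V hV0 x
  · filter_upwards [eventually_gt_atTop 0] with N hN
    have hN' : 0 < Real.sqrt N := Real.sqrt_pos.2 (by exact_mod_cast hN)
    have h1 : (1 - T 1) * (T (Δ N) * (unifLaw d * law w n ^ N)) =
        T (Δ N) * ((-(1 / d : ℝ)) • ((T (d : ℤ) - 1) * law w n ^ N)) := by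
      calc _ = T (Δ N) * (((1 - T 1) * unifLaw d) * law w n ^ N) := by ring
        _ = _ := by
          rw [one_sub_T_mul_unifLaw, neg_smul, ← smul_neg, smul_mul_assoc]
          congr 2
          ring
    rw [h1, l1_T_mul, l1_smul, abs_neg, abs_of_nonneg (by positivity)]
    have h2 : (1 / d : ℝ) ≤ 1 := by
      rw [div_le_one (by exact_mod_cast hd0)]; exact_mod_cast hd0
    calc (1 / d : ℝ) * l1 ((T (d : ℤ) - 1) * law w n ^ N)
        ≤ 1 * (C₀ / Real.sqrt (N + 1)) := by
          gcongr
          · exact l1_nonneg _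
          · exact hC₀ N
      _ ≤ |C₀| / Real.sqrt N := by
          rw [one_mul]
          calc C₀ / Real.sqrt (N + 1) ≤ |C₀| / Real.sqrt (N + 1) := by
                gcongr; exact le_abs_self _
            _ ≤ |C₀| / Real.sqrt N := by gcongr; linarith
      _ ≤ _ := by gcongr; linarith
  · filter_upwards [hC₁] with N h1
    refine h1.trans ?_
    gcongr
    linarith [abs_nonneg C₀]

end period

end SSR

namespace SSR

open LocalSystem Matrix

/-! ### Schmidt decompositions of products, copies and the standard states. -/

namespace Schmidt

variable {A B C D : LocalSystem} {φ : BiVec A B} {χ : BiVec C D} {I J : ℕ}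

theorem apply_eq (F : Schmidt φ I) (i : A.ι) (j : B.ι) :
    φ (i, j) = ∑ s, F.a i s * ((Real.sqrt (F.w s) : ℝ) : ℂ) * F.b j s := by
  have h := congrFun (congrFun F.eq i) j
  rw [Matrix.mul_apply] at h
  simpa [toMat, Matrix.mul_diagonal] using h

/-- The Schmidt decomposition of a tensor product. -/
def tensor (F : Schmidt φ I) (G : Schmidt χ J) : Schmidt (tensorVec φ χ) (I + J) where
  S := F.S × G.S
  w p := F.w p.1 * G.w p.2
  a := F.a ⊗ₖ G.a
  b := F.b ⊗ₖ G.b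
  n p := F.n p.1 + G.n p.2
  w_nonneg p := mul_nonneg (F.w_nonneg _) (G.w_nonneg _)
  a_iso := by
    rw [conjTranspose_kronecker, ← mul_kronecker_mul, F.a_iso, G.a_iso, one_kronecker_one]
  b_iso := by
    rw [conjTranspose_kronecker, ← mul_kronecker_mul, F.b_iso, G.b_iso, one_kronecker_one]
  a_num i s h := by
    rw [kroneckerMap_apply] at h
    exact congrArg₂ _ (F.a_num _ _ (left_ne_zero_of_mul h)) (G.a_num _ _ (right_ne_zero_of_mul h))
  b_num j s h := by
    rw [kroneckerMap_apply] at h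
    have h1 := F.b_num _ _ (left_ne_zero_of_mul h)
    have h2 := G.b_num _ _ (right_ne_zero_of_mul h)
    change F.n s.1 + G.n s.2 + (B.num j.1 + D.num j.2) = _
    omega
  eq := by
    ext i j
    rw [Matrix.mul_apply]
    simp only [toMat, of_apply, tensorVec, F.apply_eq, G.apply_eq, mul_diagonal,
      kroneckerMap_apply, transpose_apply, Fintype.sum_prod_type, Finset.sum_mul_sum]
    refine Finset.sum_congr rfl fun s _ => Finset.sum_congr rfl fun t _ => ?_
    rw [Real.sqrt_mul (F.w_nonneg _)]
    push_cast
    ring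

theorem pi_iso {m S : Type} [Fintype m] [DecidableEq S] (a : Matrix m S ℂ)
    (ha : aᴴ * a = 1) (N : ℕ) :
    (Matrix.of fun (f : Fin N → m) (s : Fin N → S) => ∏ i, a (f i) (s i))ᴴ *
      (Matrix.of fun (f : Fin N → m) (s : Fin N → S) => ∏ i, a (f i) (s i)) = 1 := by
  classical
  ext s t
  have h : ∀ i, ∑ x, star (a x (s i)) * a x (t i) = if s i = t i then 1 else 0 := by
    intro i
    have := congrFun (congrFun ha (s i)) (t i)
    simpa [Matrix.mul_apply, Matrix.one_apply] using this
  rw [Matrix.mul_apply]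
  simp only [conjTranspose_apply, of_apply, star_prod, ← Finset.prod_mul_distrib]
  rw [← Fintype.piFinset_univ, ← Finset.prod_univ_sum (fun _ => Finset.univ)
    (fun i x => star (a x (s i)) * a x (t i))]
  simp only [h, Matrix.one_apply, funext_iff]
  rw [Finset.prod_ite_zero]
  simp

/-- The Schmidt decomposition of `N` copies. -/
def pow (F : Schmidt φ I) (N : ℕ) : Schmidt (powVec φ N) (I * N) where
  S := Fin N → F.S
  w s := ∏ i, F.w (s i)
  a := Matrix.of fun f s => ∏ i, F.a (f i) (s i)
  b := Matrix.of fun f s => ∏ i, F.b (f i) (s i)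
  n s := ∑ i, F.n (s i)
  w_nonneg s := Finset.prod_nonneg fun i _ => F.w_nonneg _
  a_iso := pi_iso F.a F.a_iso N
  b_iso := pi_iso F.b F.b_iso N
  a_num f s h := by
    rw [of_apply, Finset.prod_ne_zero_iff] at h
    change ∑ i, A.num (f i) = _
    exact Finset.sum_congr rfl fun i _ => F.a_num _ _ (h i (Finset.mem_univ i))
  b_num f s h := by
    rw [of_apply, Finset.prod_ne_zero_iff] at h
    change _ + ∑ i, B.num (f i) = _
    rw [← Finset.sum_add_distrib,
      Finset.sum_congr rfl fun i _ => F.b_num _ _ (h i (Finset.mem_univ i))]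
    simp [mul_comm]
  eq := by
    ext f g
    rw [Matrix.mul_apply]
    simp only [toMat, of_apply, powVec, F.apply_eq, mul_diagonal, transpose_apply]
    rw [Finset.prod_univ_sum, Fintype.piFinset_univ]
    refine Finset.sum_congr rfl fun s _ => ?_
    rw [Finset.prod_mul_distrib, Finset.prod_mul_distrib, Real.sqrt_eq_rpow,
      ← Real.finsetProd_rpow _ _ fun i _ => F.w_nonneg _]
    simp only [← Real.sqrt_eq_rpow]
    push_cast
    rfl

/-- The Schmidt decomposition of a superposition of product basis vectors. -/
def ofBasis {S : Type} [Fintype S] [DecidableEq S] (f : S → A.ι) (g : S → B.ι) (w : S → ℝ)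
    (hf : Function.Injective f) (hg : Function.Injective g) (hw : ∀ s, 0 ≤ w s)
    (hI : ∀ s, A.num (f s) + B.num (g s) = I)
    (h : ∀ i j, φ (i, j) = ∑ s, if f s = i ∧ g s = j then ((Real.sqrt (w s) : ℝ) : ℂ) else 0) :
    Schmidt φ I where
  S := S
  w := w
  a := Matrix.of fun i s => if f s = i then 1 else 0
  b := Matrix.of fun i s => if g s = i then 1 else 0
  n s := A.num (f s)
  w_nonneg := hw
  a_iso := by
    ext s t
    simp [Matrix.mul_apply, Matrix.one_apply, hf.eq_iff, eq_comm]
  b_iso := by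
    ext s t
    simp [Matrix.mul_apply, Matrix.one_apply, hg.eq_iff, eq_comm]
  a_num i s hs := by
    rw [of_apply, ne_eq, ite_eq_right_iff, not_forall] at hs
    rw [← hs.1]
  b_num i s hs := by
    rw [of_apply, ne_eq, ite_eq_right_iff, not_forall] at hs
    rw [← hs.1, hI]
  eq := by
    ext i j
    rw [Matrix.mul_apply]
    simp only [toMat, of_apply, h, mul_diagonal, transpose_apply]
    refine Finset.sum_congr rfl fun s _ => ?_
    by_cases h1 : f s = i <;> by_cases h2 : g s = j <;> simp [h1, h2]

/-- The Schmidt decomposition of `∑ n, c n |n⟩ |K - n⟩`. -/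
def ofNumberState (K : ℕ) (c : Fin (K + 1) → ℝ) (hc : ∀ n, 0 ≤ c n) :
    Schmidt (numberState K c) K :=
  ofBasis (A := register K) (B := register K) id Fin.rev (fun n => c n ^ 2) Function.injective_id
    Fin.rev_injective (fun n => sq_nonneg _) (fun n => by simp; omega) (fun i j => by
      simp only [Real.sqrt_sq (hc _), id_eq, numberState]
      rw [Finset.sum_eq_single i (fun s _ hs => if_neg fun h => hs h.1)
        (fun h => absurd (Finset.mem_univ _) h)]
      refine if_congr ?_ rfl rfl
      simp only [true_and, Fin.ext_iff, Fin.val_rev]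
      omega)

/-- The Schmidt decomposition of `|V-EPR⟩`. -/
def ofVEPR : Schmidt vEPR 1 :=
  ofBasis (A := mode) (B := mode) id Fin.rev (fun _ => 1 / 2) Function.injective_id
    Fin.rev_injective (fun n => by norm_num) (fun n => by simp; omega) (fun i j => by
      rw [Real.sqrt_div zero_le_one, Real.sqrt_one, vEPR]
      generalize ((1 / Real.sqrt 2 : ℝ) : ℂ) = x
      rw [Fin.sum_univ_two]
      fin_cases i <;> fin_cases j <;> simp +decide)

/-- The Schmidt decomposition of `|E-EPR⟩`. -/
def ofEEPR : Schmidt eEPR 2 :=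
  ofBasis (A := twoModes) (B := twoModes) (fun s : Fin 2 => (s, Fin.rev s))
    (fun s => (Fin.rev s, s)) (fun _ => 1 / 2) (fun s t h => congrArg Prod.fst h)
    (fun s t h => congrArg Prod.snd h) (fun n => by norm_num) (fun n => by simp; omega)
    (fun i j => by
      obtain ⟨i, i'⟩ := i
      obtain ⟨j, j'⟩ := j
      rw [Real.sqrt_div zero_le_one, Real.sqrt_one, eEPR]
      generalize ((1 / Real.sqrt 2 : ℝ) : ℂ) = x
      rw [Fin.sum_univ_two]
      fin_cases i <;> fin_cases j <;> fin_cases i' <;> fin_cases j' <;> simp +decide)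

/-- The Schmidt decomposition of `|0̂⟩|0̂⟩`. -/
def ofAncilla : Schmidt ancilla 2 :=
  ofBasis (A := twoModes) (B := twoModes) (fun _ : Unit => hat0)
    (fun _ => hat0) (fun _ => 1) (fun s t h => rfl)
    (fun s t h => rfl) (fun n => by norm_num) (fun n => by simp [hat0, ket0, ket1])
    (fun i j => by
      simp only [ancilla, Prod.mk.injEq, Finset.univ_unique, Real.sqrt_one, Finset.sum_const,
        Finset.card_singleton, one_smul, Complex.ofReal_one]
      exact if_congr (by tauto) rfl rfl)

end Schmidt

/-! ### Existence of Schmidt decompositions -/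

/-- A Hermitian matrix that respects the grading can be diagonalized block by block, which gives
eigenvectors of definite grade. -/
theorem exists_blockDiagonalization {ι κ : Type} [Fintype ι] [DecidableEq ι] [Fintype κ]
    [DecidableEq κ] (H : Matrix ι ι ℂ) (hH : H.IsHermitian) (num : ι → κ)
    (hnum : ∀ i j, H i j ≠ 0 → num i = num j) :
    ∃ (U : Matrix ι (Σ k, {i // num i = k}) ℂ) (lam : (Σ k, {i // num i = k}) → ℝ),
      Uᴴ * U = 1 ∧ U * Uᴴ = 1 ∧ (∀ i s, U i s ≠ 0 → num i = s.1) ∧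
      Uᴴ * H * U = diagonal fun s => (lam s : ℂ) := by
  let Hk : ∀ k, Matrix {i // num i = k} {i // num i = k} ℂ :=
    fun k => H.submatrix Subtype.val Subtype.val
  have hHk : ∀ k, (Hk k).IsHermitian := fun k => hH.submatrix _
  let V : ∀ k, Matrix {i // num i = k} {i // num i = k} ℂ := fun k => (hHk k).eigenvectorUnitary
  have hV1 : ∀ k, (V k)ᴴ * V k = 1 := fun k => Unitary.coe_star_mul_self (hHk k).eigenvectorUnitary
  have hV2 : ∀ k, V k * (V k)ᴴ = 1 := fun k => Unitary.coe_mul_star_self (hHk k).eigenvectorUnitary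
  have hV3 : ∀ k, (V k)ᴴ * Hk k * V k = diagonal fun s => ((hHk k).eigenvalues s : ℂ) := by
    intro k
    have := (hHk k).conjStarAlgAut_star_eigenvectorUnitary
    rw [Unitary.conjStarAlgAut_star_apply] at this
    exact this
  let e : (Σ k, {i // num i = k}) ≃ ι := Equiv.sigmaFiberEquiv num
  have hHe : H.submatrix e e = blockDiagonal' Hk := by
    ext ⟨k, i, hi⟩ ⟨l, j, hj⟩
    rw [blockDiagonal'_apply]
    split_ifs with h
    · dsimp only at h
      subst h
      rfl
    · simp only [submatrix_apply]
      by_contra hne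
      refine h ?_
      have := hnum i j hne
      simp only [← hi, ← hj, this]
  let W := blockDiagonal' V
  have hW : Wᴴ = blockDiagonal' fun k => (V k)ᴴ := blockDiagonal'_conjTranspose V
  refine ⟨W.submatrix e.symm id, fun s => (hHk s.1).eigenvalues s.2, ?_, ?_, ?_, ?_⟩
  · rw [conjTranspose_submatrix, submatrix_mul_equiv, hW,
      ← blockDiagonal'_mul]
    simp only [hV1]
    exact blockDiagonal'_one
  · rw [conjTranspose_submatrix]
    have : W.submatrix e.symm id * Wᴴ.submatrix id e.symm = (W * Wᴴ).submatrix e.symm e.symm :=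
      submatrix_mul_equiv W Wᴴ e.symm (Equiv.refl _) e.symm
    rw [this, hW, ← blockDiagonal'_mul]
    simp only [hV2]
    rw [show (blockDiagonal' fun k => (1 : Matrix {i // num i = k} {i // num i = k} ℂ)) = 1 from
      blockDiagonal'_one]
    simp
  · intro i s h
    simp only [submatrix_apply, id_eq, W, blockDiagonal'_apply] at h
    split_ifs at h with h1
    · exact h1
    · exact absurd rfl h
  · have : H = (H.submatrix e e).submatrix e.symm e.symm := by simp
    rw [this, hHe, conjTranspose_submatrix, submatrix_mul_equiv, submatrix_mul_equiv,
      hW, ← blockDiagonal'_mul, ← blockDiagonal'_mul]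
    simp only [hV3]
    rw [blockDiagonal'_diagonal]
    rfl

theorem reducedA_eq {A B : LocalSystem} (φ : BiVec A B) :
    reducedA φ = toMat φ * (toMat φ)ᴴ := by
  ext i j
  simp [reducedA, toMat, Matrix.mul_apply]

/-- The fixed total number makes the reduced state commute with Alice's number, so it has
eigenvectors `U` of definite number. The rows of `Uᴴ * toMat φ` are orthogonal with the eigenvalues
as squared norms; normalized, they are Bob's vectors. Zero eigenvalues are discarded, so all weights
are positive and their logarithms are meaningful. -/
theorem exists_schmidt {A B : LocalSystem} (φ : BiVec A B) (I : ℕ)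
    (hφ : ∀ a b, φ (a, b) ≠ 0 → A.num a + B.num b = I) :
    ∃ F : Schmidt φ I, ∀ s, 0 < F.w s := by
  let num : A.ι → ↥(Finset.univ.image A.num) :=
    fun a => ⟨A.num a, Finset.mem_image_of_mem _ (Finset.mem_univ a)⟩
  obtain ⟨U, lam, hU1, hU2, hU3, hU4⟩ := exists_blockDiagonalization (reducedA φ)
    (reducedA_isHermitian φ) num (by
      intro i j h
      simp only [reducedA, of_apply] at h
      obtain ⟨b, -, hb⟩ := Finset.exists_ne_zero_of_sum_ne_zero h
      have h1 := hφ i b (left_ne_zero_of_mul hb)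
      have h2 := hφ j b (star_ne_zero.1 (right_ne_zero_of_mul hb))
      exact Subtype.ext (by simp only [num]; omega))
  set Y := Uᴴ * toMat φ with hY
  have hYY : Y * Yᴴ = diagonal fun s => (lam s : ℂ) := by
    rw [← hU4, reducedA_eq, hY, conjTranspose_mul, conjTranspose_conjTranspose]
    simp only [Matrix.mul_assoc]
  have hXY : toMat φ = U * Y := by rw [hY, ← Matrix.mul_assoc, hU2, Matrix.one_mul]
  have hYs : ∀ s t, ∑ j, Y s j * star (Y t j) = if s = t then (lam s : ℂ) else 0 := by
    intro s t
    have := congrFun (congrFun hYY s) t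
    simpa [Matrix.mul_apply, diagonal_apply] using this
  have hlam : ∀ s, lam s = ∑ j, ‖Y s j‖ ^ 2 := by
    intro s
    have := hYs s s
    rw [if_pos rfl] at this
    have h2 : ((∑ j, ‖Y s j‖ ^ 2 : ℝ) : ℂ) = lam s := by
      rw [← this, Complex.ofReal_sum]
      exact Finset.sum_congr rfl fun j _ => by
        rw [Complex.star_def, Complex.mul_conj, Complex.normSq_eq_norm_sq]
    exact_mod_cast h2.symm
  have hlam0 : ∀ s, 0 ≤ lam s := fun s => by rw [hlam]; positivity
  have hY0 : ∀ s, lam s = 0 → ∀ j, Y s j = 0 := by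
    intro s hs j
    rw [hlam, Finset.sum_eq_zero_iff_of_nonneg (fun _ _ => by positivity)] at hs
    simpa using hs j (Finset.mem_univ j)
  have hsq : ∀ s : {s // lam s ≠ 0}, ((Real.sqrt (lam s) : ℝ) : ℂ) ≠ 0 := by
    intro s
    exact_mod_cast (Real.sqrt_pos.2 (lt_of_le_of_ne (hlam0 _) (Ne.symm s.2))).ne'
  have hsq2 : ∀ s, ((Real.sqrt (lam s) : ℝ) : ℂ) * ((Real.sqrt (lam s) : ℝ) : ℂ) = lam s := by
    intro s
    rw [← Complex.ofReal_mul, Real.mul_self_sqrt (hlam0 _)]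
  refine ⟨{ S := {s // lam s ≠ 0}
            w := fun s => lam s
            a := U.submatrix id Subtype.val
            b := Matrix.of fun j s => Y s j / ((Real.sqrt (lam s) : ℝ) : ℂ)
            n := fun s => s.1.1
            w_nonneg := fun s => hlam0 _
            a_iso := ?_, b_iso := ?_, a_num := ?_, b_num := ?_, eq := ?_ },
    fun s => lt_of_le_of_ne (hlam0 _) (Ne.symm s.2)⟩
  · ext s t
    have := congrFun (congrFun hU1 s) t
    simpa [Matrix.mul_apply, Matrix.one_apply, Subtype.ext_iff] using this
  · ext s t
    have h1 := hYs t s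
    rw [Matrix.mul_apply]
    simp only [conjTranspose_apply, of_apply, star_div₀, Complex.star_def, Complex.conj_ofReal,
      Matrix.one_apply, Subtype.ext_iff]
    have h2 : ∀ j, (starRingEnd ℂ) (Y s j) / ((Real.sqrt (lam s) : ℝ) : ℂ) *
        (Y t j / ((Real.sqrt (lam t) : ℝ) : ℂ)) = (Y t j * star (Y s j)) /
          (((Real.sqrt (lam s) : ℝ) : ℂ) * ((Real.sqrt (lam t) : ℝ) : ℂ)) := by
      intro j
      rw [Complex.star_def, div_mul_div_comm, mul_comm (Y t j)]
    rw [Finset.sum_congr rfl fun j _ => h2 j, ← Finset.sum_div, h1]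
    by_cases hst : s.1 = t.1
    · rw [if_pos hst, if_pos hst.symm, ← hst, hsq2, div_self]
      exact_mod_cast s.2
    · rw [if_neg hst, if_neg (Ne.symm hst), zero_div]
  · intro i s h
    exact congrArg Subtype.val (hU3 i s.1 h)
  · intro j s h
    have h1 : Y s j ≠ 0 := fun h0 => h (by simp [h0])
    rw [hY, Matrix.mul_apply] at h1
    obtain ⟨i, -, hi⟩ := Finset.exists_ne_zero_of_sum_ne_zero h1
    have h2 := congrArg Subtype.val (hU3 i s.1 (star_ne_zero.1 (left_ne_zero_of_mul hi)))
    rw [← h2]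
    exact hφ i j (right_ne_zero_of_mul hi)
  · rw [hXY]
    ext i j
    rw [Matrix.mul_apply, Matrix.mul_apply]
    simp only [mul_diagonal, submatrix_apply, id_eq, transpose_apply, of_apply]
    rw [← Finset.sum_filter_of_ne (p := fun s => lam s ≠ 0)
      (fun s _ hs h0 => hs (by rw [hY0 s h0, mul_zero]))]
    rw [Finset.sum_subtype _ (p := fun s => lam s ≠ 0) (fun s => by simp)]
    refine Finset.sum_congr rfl fun s _ => ?_
    rw [mul_assoc, mul_div_cancel₀ _ (hsq s)]

end SSR

namespace SSR

open LocalSystem Matrix LaurentPolynomial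

/-! ### Entropy, variance and particle number law in terms of Schmidt data. -/

namespace Schmidt

variable {A B C D : LocalSystem} {φ : BiVec A B} {χ : BiVec C D} {I J : ℕ}

theorem reducedA_eq_mul (F : Schmidt φ I) :
    reducedA φ = F.a * (diagonal (fun s => (F.w s : ℂ)) * F.aᴴ) := by
  have hb : F.bᵀ * (F.bᵀ)ᴴ = 1 := by
    have := congrArg Matrix.transpose F.b_iso
    rw [transpose_mul, transpose_one] at this
    rw [← this]
    rfl
  have hd : (diagonal fun s => ((Real.sqrt (F.w s) : ℝ) : ℂ)) *
      (diagonal fun s => ((Real.sqrt (F.w s) : ℝ) : ℂ))ᴴ = diagonal (fun s => (F.w s : ℂ)) := by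
    rw [diagonal_conjTranspose, diagonal_mul_diagonal]
    congr 1
    ext s
    simp only [Pi.star_apply, Complex.star_def, Complex.conj_ofReal]
    rw [← Complex.ofReal_mul, Real.mul_self_sqrt (F.w_nonneg _)]
  calc reducedA φ = F.a * (diagonal (fun s => ((Real.sqrt (F.w s) : ℝ) : ℂ)) *
        (F.bᵀ * (F.bᵀ)ᴴ) * (diagonal fun s => ((Real.sqrt (F.w s) : ℝ) : ℂ))ᴴ * F.aᴴ) := by
        rw [reducedA_eq, F.eq, conjTranspose_mul, conjTranspose_mul]
        simp only [Matrix.mul_assoc]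
    _ = _ := by rw [hb, Matrix.mul_one, hd]

/-- Each column of `a` is a unit vector inside one number sector, so functions of Alice's number may
be averaged over the Schmidt weights. -/
theorem sum_norm_sq_mul (F : Schmidt φ I) (g : ℕ → ℝ) :
    ∑ p, ‖φ p‖ ^ 2 * g (A.num p.1) = ∑ s, F.w s * g (F.n s) := by
  have h1 : ∀ i, ((∑ j, ‖φ (i, j)‖ ^ 2 : ℝ) : ℂ) = ∑ s, F.w s * (star (F.a i s) * F.a i s) := by
    intro i
    have := congrFun (congrFun F.reducedA_eq_mul i) i
    rw [Matrix.mul_apply] at this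
    simp only [reducedA, of_apply, diagonal_mul, conjTranspose_apply] at this
    rw [Complex.ofReal_sum]
    calc _ = ∑ b, φ (i, b) * star (φ (i, b)) := Finset.sum_congr rfl fun j _ => by
          rw [Complex.star_def, Complex.mul_conj, Complex.normSq_eq_norm_sq]
      _ = _ := by rw [this]; exact Finset.sum_congr rfl fun s _ => by ring
  have h2 : ((∑ p, ‖φ p‖ ^ 2 * g (A.num p.1) : ℝ) : ℂ) = ((∑ s, F.w s * g (F.n s) : ℝ) : ℂ) := by
    rw [Fintype.sum_prod_type]
    have h0 : ∀ i, ((∑ j, ‖φ (i, j)‖ ^ 2 * g (A.num i) : ℝ) : ℂ) =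
        ∑ s, F.w s * (star (F.a i s) * F.a i s) * (g (A.num i) : ℂ) := fun i => by
      rw [← Finset.sum_mul, Complex.ofReal_mul, h1, Finset.sum_mul]
    rw [Complex.ofReal_sum, Finset.sum_congr rfl fun i _ => h0 i, Finset.sum_comm, Complex.ofReal_sum]
    refine Finset.sum_congr rfl fun s _ => ?_
    have h3 : ∑ i, star (F.a i s) * F.a i s = 1 := by
      have := congrFun (congrFun F.a_iso s) s
      simpa [Matrix.mul_apply, Matrix.one_apply] using this
    have h4 : ∀ i, (F.w s : ℂ) * (star (F.a i s) * F.a i s) * (g (A.num i) : ℂ) =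
        (F.w s * g (F.n s) : ℂ) * (star (F.a i s) * F.a i s) := by
      intro i
      by_cases h : F.a i s = 0
      · simp [h]
      · rw [F.a_num i s h]; ring
    rw [Finset.sum_congr rfl fun i _ => h4 i, ← Finset.mul_sum, h3]
    simp
  exact_mod_cast h2

theorem sum_norm_sq (F : Schmidt φ I) : ∑ p, ‖φ p‖ ^ 2 = ∑ s, F.w s := by
  simpa using F.sum_norm_sq_mul fun _ => 1

theorem _root_.SSR.expect_diagonal {A B : LocalSystem} (φ : BiVec A B) (g : A.ι × B.ι → ℝ) :
    expect (diagonal fun p => (g p : ℂ)) φ = ∑ p, ‖φ p‖ ^ 2 * g p := by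
  simp only [expect, dotProduct, mulVec_diagonal, Complex.re_sum]
  refine Finset.sum_congr rfl fun p _ => ?_
  have : star φ p * ((g p : ℂ) * φ p) = ((‖φ p‖ ^ 2 * g p : ℝ) : ℂ) := by
    rw [Pi.star_apply, Complex.star_def, mul_left_comm, mul_comm _ (φ p), Complex.mul_conj,
      Complex.normSq_eq_norm_sq]
    push_cast
    ring
  rw [this, Complex.ofReal_re]

theorem _root_.SSR.numOpA_eq (A B : LocalSystem) :
    numOpA A B = diagonal fun p => (((A.num p.1 : ℝ)) : ℂ) := by
  rw [numOpA, ← diagonal_one, diagonal_kronecker_diagonal]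
  simp

theorem expect_numOpA (F : Schmidt φ I) :
    expect (numOpA A B) φ = ∑ s, F.w s * (F.n s : ℝ) := by
  rw [numOpA_eq, expect_diagonal]
  exact F.sum_norm_sq_mul fun n => n

theorem siV_eq (F : Schmidt φ I) :
    SiV φ = 4 * (∑ s, F.w s * (F.n s : ℝ) ^ 2 - (∑ s, F.w s * (F.n s : ℝ)) ^ 2) := by
  rw [SiV, F.expect_numOpA, numOpA_eq, diagonal_mul_diagonal]
  have := expect_diagonal φ (fun p => (A.num p.1 : ℝ) ^ 2)
  rw [F.sum_norm_sq_mul fun n => (n : ℝ) ^ 2] at this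
  rw [← this]
  simp [pow_two]

/-- The reduced state is `a * (W * aᴴ)`, and the swapped product is the diagonal matrix `W` of
weights. Their characteristic polynomials agree up to powers of `X`, and zero eigenvalues contribute
`0 * logb 2 0 = 0`. -/
theorem eoE_eq (F : Schmidt φ I) : EoE φ = -∑ s, F.w s * Real.logb 2 (F.w s) := by
  have h := Matrix.charpoly_mul_comm' F.a (diagonal (fun s => (F.w s : ℂ)) * F.aᴴ)
  rw [← F.reducedA_eq_mul, Matrix.mul_assoc, F.a_iso, Matrix.mul_one] at h
  have h1 := congrArg Polynomial.roots h
  have hne : (reducedA φ).charpoly ≠ 0 := (charpoly_monic _).ne_zero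
  have hne' : (diagonal (fun s => (F.w s : ℂ))).charpoly ≠ 0 := (charpoly_monic _).ne_zero
  rw [Polynomial.roots_mul (mul_ne_zero (pow_ne_zero _ Polynomial.X_ne_zero) hne),
    Polynomial.roots_mul (mul_ne_zero (pow_ne_zero _ Polynomial.X_ne_zero) hne'),
    Polynomial.roots_pow, Polynomial.roots_pow, Polynomial.roots_X,
    (reducedA_isHermitian φ).roots_charpoly_eq_eigenvalues, charpoly_diagonal,
    show ∏ i, (Polynomial.X - Polynomial.C (F.w i : ℂ)) = (Multiset.map (fun a => Polynomial.X -
      Polynomial.C a) (Finset.univ.val.map fun i => (F.w i : ℂ))).prod by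
      rw [Multiset.map_map]; rfl, Polynomial.roots_multiset_prod_X_sub_C] at h1
  have h2 := congrArg (fun m => (m.map fun z : ℂ => z.re * Real.logb 2 z.re).sum) h1
  simp only [Multiset.map_add, Multiset.sum_add, Multiset.map_nsmul, Multiset.sum_nsmul,
    Multiset.map_singleton, Multiset.sum_singleton, Complex.zero_re, zero_mul, smul_zero,
    zero_add, Multiset.map_map] at h2
  exact congrArg Neg.neg h2

theorem sum_w (F : Schmidt φ I) (hφ : IsPureState φ I) : ∑ s, F.w s = 1 := by
  rw [← F.sum_norm_sq, hφ.norm_eq]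

theorem n_le (F : Schmidt φ I) (s : F.S) : F.n s ≤ I := by
  by_contra h
  have h3 : ∑ j, star (F.b j s) * F.b j s = 1 := by
    have := congrFun (congrFun F.b_iso s) s
    simpa [Matrix.mul_apply, Matrix.one_apply] using this
  rw [Finset.sum_eq_zero] at h3
  · exact zero_ne_one h3
  · intro j _
    by_contra h0
    have := F.b_num j s (right_ne_zero_of_mul h0)
    omega

/-- The distribution of Alice's particle number. -/
def numLaw (F : Schmidt φ I) : ℝ[T;T⁻¹] := law F.w fun s => (F.n s : ℤ)

theorem coeff_numLaw (F : Schmidt φ I) (z : ℤ) : F.numLaw.coeff z = F.mass Finset.univ z := by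
  rw [numLaw, coeff_law, mass, Finset.sum_filter]

theorem numLaw_tensor (F : Schmidt φ I) (G : Schmidt χ J) :
    (F.tensor G).numLaw = F.numLaw * G.numLaw := by
  rw [numLaw, numLaw, numLaw, ← law_mul]
  simp only [← Nat.cast_add]
  rfl

theorem numLaw_pow (F : Schmidt φ I) (N : ℕ) : (F.pow N).numLaw = F.numLaw ^ N := by
  rw [numLaw, numLaw, ← law_pow]
  simp only [← Nat.cast_sum]
  rfl

theorem sum_w_tensor (F : Schmidt φ I) (G : Schmidt χ J) (hF : ∑ s, F.w s = 1)
    (hG : ∑ s, G.w s = 1) : ∑ s, (F.tensor G).w s = 1 := by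
  change ∑ p : F.S × G.S, F.w p.1 * G.w p.2 = 1
  rw [Fintype.sum_prod_type, ← Finset.sum_mul_sum, hF, hG, one_mul]

theorem sum_w_pow (F : Schmidt φ I) (hF : ∑ s, F.w s = 1) (N : ℕ) :
    ∑ s, (F.pow N).w s = 1 := sum_prod_pi F.w hF N

theorem sum_w_ofVEPR : ∑ s, ofVEPR.w s = 1 := by
  change ∑ s : Fin 2, (1 / 2 : ℝ) = 1
  simp

theorem sum_w_ofEEPR : ∑ s, ofEEPR.w s = 1 := by
  change ∑ s : Fin 2, (1 / 2 : ℝ) = 1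
  simp

theorem sum_w_ofAncilla : ∑ s, ofAncilla.w s = 1 := by
  change ∑ s : Unit, (1 : ℝ) = 1
  simp

/-- Both hat states carry one particle, so E-EPRs merely translate the number law, by the same
amount as ancillas do. -/
theorem numLaw_ofEEPR : ofEEPR.numLaw = T 1 := by
  change law (fun _ : Fin 2 => (1 / 2 : ℝ)) (fun s => ((mode.num s + mode.num s.rev : ℕ) : ℤ)) = _
  rw [law, Fin.sum_univ_two, T]
  have h0 : mode.num 0 + mode.num (Fin.rev 0) = 1 := rfl
  have h1 : mode.num 1 + mode.num (Fin.rev 1) = 1 := rfl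
  rw [h0, h1, ← AddMonoidAlgebra.single_add]
  norm_num [-single_eq_C_mul_T]

theorem numLaw_ofAncilla : ofAncilla.numLaw = T 1 := by
  change law (fun _ : Unit => (1 : ℝ)) (fun s => ((twoModes.num hat0 : ℕ) : ℤ)) = _
  simp [law, T, hat0, ket0, ket1, -single_eq_C_mul_T]

theorem numLaw_ofNumberState (K : ℕ) (c : Fin (K + 1) → ℝ) (hc : ∀ n, 0 ≤ c n) :
    (ofNumberState K c hc).numLaw = law (fun n => c n ^ 2) fun n => ((n : ℕ) : ℤ) := rfl

/-- A V-EPR gives the numbers 0 and 1 with weight 1/2 each, so the general smoothness bound applies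
to the unit shift with constant `√(2 + 2) = 2`. -/
theorem l1_one_sub_T_mul_numLaw_ofVEPR_pow_le (k : ℕ) :
    l1 ((1 - T 1) * ofVEPR.numLaw ^ k) ≤ 2 / Real.sqrt (k + 1) := by
  have h := l1_T_sub_T_mul_law_pow_le (fun _ : Fin 2 => (1 / 2 : ℝ)) (fun _ => by norm_num)
    (by simp) (fun s => ((s : ℕ) : ℤ)) 0 1 (by norm_num) (by norm_num) k
  have h4 : Real.sqrt (1 / (1 / 2 : ℝ) + 1 / (1 / 2)) = 2 := by
    rw [show (1 / (1 / 2 : ℝ) + 1 / (1 / 2)) = 2 ^ 2 by norm_num, Real.sqrt_sq (by norm_num)]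
  rw [h4] at h
  rw [Fin.val_zero, Fin.val_one, Nat.cast_zero, Nat.cast_one, T_zero] at h
  exact h

end Schmidt

end SSR

namespace SSR

open LocalSystem LaurentPolynomial Filter

/-! ### Conversion of states with similar particle number distributions -/

theorem coeff_unifLaw_mul (d : ℕ) (p : ℝ[T;T⁻¹]) (z : ℤ) :
    (unifLaw d * p).coeff z = (1 / d : ℝ) * ∑ j ∈ Finset.range d, p.coeff (z - j) := by
  rw [unifLaw_eq, smul_mul_assoc, Finset.sum_mul, AddMonoidAlgebra.coeff_smul, Finsupp.smul_apply,
    smul_eq_mul, AddMonoidAlgebra.coeff_sum, Finsupp.finsetSum_apply]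
  simp only [coeff_T_mul]

/-- Among the `d` consecutive integers `z + j - i` with `i < d`, only `z` lies in the lattice that
carries `p`. -/
theorem coeff_unifLaw_mul_of_dvd (d : ℕ) (p : ℝ[T;T⁻¹]) (σ z : ℤ) (j : Fin d)
    (hp : ∀ z, p.coeff z ≠ 0 → (d : ℤ) ∣ z - σ) (hz : (d : ℤ) ∣ z - σ) :
    (unifLaw d * p).coeff (z + j) = p.coeff z / d := by
  rw [coeff_unifLaw_mul, Finset.sum_eq_single (j : ℕ)]
  · rw [add_sub_cancel_right]; ring
  · intro i hi hij
    by_contra hne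
    have h1 := (Int.dvd_sub (hp _ hne) hz)
    have h2 : z + (j : ℕ) - (i : ℕ) - σ - (z - σ) = ((j : ℕ) : ℤ) - i := by ring
    rw [h2] at h1
    have h3 := Finset.mem_range.1 hi
    have h4 := j.2
    have h5 := Int.eq_zero_of_abs_lt_dvd h1 (by rw [abs_lt]; omega)
    omega
  · intro h
    exact absurd (Finset.mem_range.2 j.2) h

/-- `√(d x y)` is at least the smaller of `y` and `d x`. In the only nontrivial case, `y - d x ≤ (Q
- d P) + d (P - x)`. -/
theorem sub_sqrt_mul_le {x y P Q d : ℝ} (hd : 0 < d) (hx : 0 ≤ x) (hy : 0 ≤ y) (hyQ : y ≤ Q)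
    (hxP : x ≤ P) : y - Real.sqrt d * Real.sqrt (x * y) ≤ d * (P - x) + d * |P - Q / d| := by
  rw [← Real.sqrt_mul hd.le, ← mul_assoc]
  rcases le_total y (d * x) with h | h
  · have h1 : y ≤ Real.sqrt (d * x * y) := Real.le_sqrt_of_sq_le (by nlinarith)
    have h2 : 0 ≤ d * (P - x) := mul_nonneg hd.le (by linarith)
    have h3 : 0 ≤ d * |P - Q / d| := by positivity
    linarith
  · have h0 : 0 ≤ d * x := by positivity
    have h1 : d * x ≤ Real.sqrt (d * x * y) := Real.le_sqrt_of_sq_le (by nlinarith)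
    have h2 : d * (P - Q / d) ≥ -(d * |P - Q / d|) := by
      have := mul_le_mul_of_nonneg_left (neg_abs_le (P - Q / d)) hd.le
      linarith
    have h3 : d * (P - Q / d) = d * P - Q := by field_simp
    linarith

namespace Schmidt

variable {A B A' B' : LocalSystem} {ψ : BiVec A B} {χ : BiVec A' B'} {I J : ℕ}

theorem sum_mass_le (F : Schmidt ψ I) (U : Finset F.S) (Z : Finset ℤ) :
    ∑ z ∈ Z, F.mass U z ≤ ∑ s ∈ U, F.w s := by
  simp only [mass]
  calc ∑ z ∈ Z, ∑ s ∈ U with (F.n s : ℤ) = z, F.w s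
      ≤ ∑ z ∈ Z ∪ U.image (fun s => (F.n s : ℤ)), ∑ s ∈ U with (F.n s : ℤ) = z, F.w s :=
        Finset.sum_le_sum_of_subset_of_nonneg Finset.subset_union_left
          fun z _ _ => Finset.sum_nonneg fun s _ => F.w_nonneg s
    _ = _ := Finset.sum_fiberwise_of_maps_to
          (fun s hs => Finset.mem_union_right _ (Finset.mem_image_of_mem _ hs)) _

theorem mass_mono (F : Schmidt ψ I) {U V : Finset F.S} (h : U ⊆ V) (z : ℤ) :
    F.mass U z ≤ F.mass V z :=
  Finset.sum_le_sum_of_subset_of_nonneg (Finset.filter_subset_filter _ h)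
    fun s _ _ => F.w_nonneg s

theorem mass_sdiff (F : Schmidt ψ I) {U V : Finset F.S} (h : U ⊆ V) (z : ℤ) :
    F.mass (V \ U) z = F.mass V z - F.mass U z := by
  rw [mass, mass, mass, eq_sub_iff_add_eq, ← Finset.sum_union]
  · rw [← Finset.filter_union, Finset.sdiff_union_of_subset h]
  · exact Finset.disjoint_filter_filter Finset.sdiff_disjoint

theorem exists_index (F : Schmidt ψ I) (hF : ∑ s, F.w s = 1) :
    ∃ (_ : F.S) (_ : A.ι), Nonempty B.ι := by
  obtain ⟨s, -, -⟩ : ∃ s ∈ Finset.univ, F.w s ≠ 0 := by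
    refine Finset.exists_ne_zero_of_sum_ne_zero ?_
    rw [hF]; exact one_ne_zero
  have h : ∀ {m : Type} [Fintype m] (a : Matrix m F.S ℂ), Matrix.conjTranspose a * a = 1 →
      Nonempty m := by
    intro m _ a ha
    by_contra h
    rw [not_nonempty_iff] at h
    have := congrFun (congrFun ha s) s
    simp [Matrix.mul_apply] at this
  obtain ⟨i⟩ := h F.a F.a_iso
  exact ⟨s, i, h F.b F.b_iso⟩

/-- Alice measures her particle number modulo `d`, and both parties convert the outcome. -/
theorem exists_protocol_residues (F : Schmidt ψ I) (G : Schmidt χ J) (hF : ∑ s, F.w s = 1)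
    (hG : ∑ t, G.w t = 1) {d : ℕ} (hd : 0 < d) (σ : ℤ)
    (hσ : ∀ t, G.w t ≠ 0 → (d : ℤ) ∣ G.n t - σ) (δ : ℤ) (V : Finset G.S)
    (U : Fin d → Finset F.S) (hU : ∀ j, ∀ s ∈ U j, (F.n s - δ - σ) % d = (j : ℕ))
    (hcond : ∀ j, ∀ s ∈ U j,
      ((V.filter fun t => (G.n t : ℤ) = F.n s + (-δ - (j : ℕ))).card : ℝ) * F.w s ≤
        F.mass (U j) (F.n s)) {ε₁ : ℝ}
    (hε₁ : ∀ j : Fin d, ∑ s ∈ (Finset.univ.filter fun s => (F.n s - δ - σ) % d = (j : ℕ)) \ U j,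
      F.w s ≤ ε₁) :
    ∃ P : Protocol A' B' A B, 1 - 2 * (∑ t ∈ Vᶜ, G.w t +
      d * (ε₁ + l1 (T δ * (unifLaw d * G.numLaw) - F.numLaw))) ≤ P.fidelity ψ χ := by
  obtain ⟨s₀, -, -⟩ := F.exists_index hF
  obtain ⟨-, oA, ⟨oB⟩⟩ := G.exists_index hG
  obtain ⟨P, hP⟩ := exists_protocol_sectors F G oA oB s₀ U
    (fun r r' s h h' => Fin.ext (by have := hU r s h; have := hU r' s h'; omega)) V
    (fun j => -δ - (j : ℕ)) hcond
  refine ⟨P, ?_⟩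
  set ε₂ := ∑ t ∈ Vᶜ, G.w t
  set ε₃ := l1 (T δ * (unifLaw d * G.numLaw) - F.numLaw) with hε₃
  have hd' : (0 : ℝ) < d := by exact_mod_cast hd
  -- A negative amplitude bound could not be squared, but then the claimed fidelity bound is
  -- negative too.
  rcases lt_or_ge (1 - (ε₂ + d * (ε₁ + ε₃))) 0 with hneg | hpos
  · have := Protocol.fidelity_nonneg χ P ψ
    linarith
  set Z := V.image fun t => (G.n t : ℤ)
  have hGcoeff : ∀ z, G.numLaw.coeff z ≠ 0 → (d : ℤ) ∣ z - σ := by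
    intro z hz
    rw [coeff_numLaw, mass] at hz
    obtain ⟨t, ht, ht'⟩ := Finset.exists_ne_zero_of_sum_ne_zero hz
    rw [← (Finset.mem_filter.1 ht).2]
    exact hσ t ht'
  -- Residue `j` occurs with probability about `1 / d`, and after shifting back by `δ + j` its
  -- conditional number law is close to that of the target. So each of the `d` outcomes contributes
  -- about `1 / d` to the fidelity.
  have key : ∀ j : Fin d, 1 - (ε₂ + d * (ε₁ + ε₃)) ≤ Real.sqrt d *
      ∑ z ∈ Z, Real.sqrt (F.mass (U j) (z - (-δ - (j : ℕ))) * G.mass V z) := by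
    intro j
    set K : Finset F.S := Finset.univ.filter fun s => (F.n s - δ - σ) % d = (j : ℕ) with hK
    have hUK : U j ⊆ K := fun s hs => Finset.mem_filter.2 ⟨Finset.mem_univ _, hU j s hs⟩
    have hinj : Function.Injective fun z : ℤ => z - (-δ - (j : ℕ)) := sub_left_injective
    have hsumV : ∑ z ∈ Z, G.mass V z = 1 - ε₂ := by
      rw [eq_sub_iff_add_eq, ← hG, ← Finset.sum_add_sum_compl V]
      congr 1
      exact Finset.sum_fiberwise_of_maps_to (fun t ht => Finset.mem_image_of_mem _ ht) _
    have hsum1 : ∑ z ∈ Z, (F.mass K (z - (-δ - (j : ℕ))) - F.mass (U j) (z - (-δ - (j : ℕ)))) ≤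
        ε₁ := by
      refine le_trans ?_ (hε₁ j)
      refine le_trans (le_of_eq ?_) (F.sum_mass_le (K \ U j) (Z.image fun z => z - (-δ - (j : ℕ))))
      rw [Finset.sum_image hinj.injOn]
      exact Finset.sum_congr rfl fun z _ => (F.mass_sdiff hUK _).symm
    have hsum3 : ∑ z ∈ Z, |F.mass K (z - (-δ - (j : ℕ))) - G.mass Finset.univ z / d| ≤ ε₃ := by
      rw [hε₃]
      refine le_trans ?_ (sum_abs_coeff_le_l1 _ (Z.image fun z => z - (-δ - (j : ℕ))))
      rw [Finset.sum_image hinj.injOn]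
      refine Finset.sum_le_sum fun z _ => ?_
      by_cases hz : (d : ℤ) ∣ z - σ
      · have h1 : F.mass K (z - (-δ - (j : ℕ))) = F.mass Finset.univ (z - (-δ - (j : ℕ))) := by
          rw [mass, mass]
          refine Finset.sum_congr ?_ fun _ _ => rfl
          ext s
          simp only [hK, Finset.mem_filter, Finset.mem_univ, true_and, and_iff_right_iff_imp]
          intro hs
          have h2 : (F.n s - δ - σ : ℤ) = (z - σ) + (j : ℕ) := by rw [hs]; ring
          rw [h2, Int.add_emod, Int.emod_eq_zero_of_dvd hz, zero_add, Int.emod_emod]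
          exact Int.emod_eq_of_lt (by omega) (by have := j.2; omega)
        rw [AddMonoidAlgebra.coeff_sub, Finsupp.sub_apply, coeff_T_mul, coeff_numLaw, h1,
          show z - (-δ - ((j : ℕ) : ℤ)) - δ = z + (j : ℕ) by ring,
          coeff_unifLaw_mul_of_dvd d _ σ z j hGcoeff hz, coeff_numLaw, abs_sub_comm]
      · have h1 : F.mass K (z - (-δ - (j : ℕ))) = 0 := by
          rw [mass]
          refine Finset.sum_eq_zero fun s hs => absurd ?_ hz
          rw [Finset.mem_filter, hK, Finset.mem_filter] at hs
          have h2 : z - σ = (F.n s - δ - σ : ℤ) - (j : ℕ) := by rw [hs.2]; ring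
          rw [h2, ← hs.1.2]
          exact Int.dvd_self_sub_emod
        have h2 : G.mass Finset.univ z = 0 := by
          rw [← coeff_numLaw]
          by_contra h
          exact hz (hGcoeff z h)
        rw [h1, h2, zero_div, sub_zero, abs_zero]
        exact abs_nonneg _
    have hle : ∑ z ∈ Z, (G.mass V z - Real.sqrt d *
        Real.sqrt (F.mass (U j) (z - (-δ - (j : ℕ))) * G.mass V z)) ≤
        ∑ z ∈ Z, (d * (F.mass K (z - (-δ - (j : ℕ))) - F.mass (U j) (z - (-δ - (j : ℕ)))) +
          d * |F.mass K (z - (-δ - (j : ℕ))) - G.mass Finset.univ z / d|) :=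
      Finset.sum_le_sum fun z _ => sub_sqrt_mul_le hd' (F.mass_nonneg _ _) (G.mass_nonneg _ _)
        (G.mass_mono (Finset.subset_univ _) _) (F.mass_mono hUK _)
    rw [Finset.sum_sub_distrib, hsumV, Finset.sum_add_distrib, ← Finset.mul_sum, ← Finset.mul_sum,
      ← Finset.mul_sum] at hle
    have h1 := mul_le_mul_of_nonneg_left hsum1 hd'.le
    have h2 := mul_le_mul_of_nonneg_left hsum3 hd'.le
    linarith
  have key2 : ∀ j : Fin d, (1 - (ε₂ + d * (ε₁ + ε₃))) ^ 2 / d ≤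
      (∑ z ∈ Z, Real.sqrt (F.mass (U j) (z - (-δ - (j : ℕ))) * G.mass V z)) ^ 2 := by
    intro j
    have := pow_le_pow_left₀ hpos (key j) 2
    rw [mul_pow, Real.sq_sqrt hd'.le] at this
    rw [div_le_iff₀ hd']
    linarith
  have h3 := (Finset.sum_le_sum fun j _ => key2 j).trans hP
  rw [Finset.sum_const, Finset.card_univ, Fintype.card_fin, nsmul_eq_mul,
    mul_div_cancel₀ _ hd'.ne'] at h3
  nlinarith [sq_nonneg (ε₂ + d * (ε₁ + ε₃))]

/-- Discard the source vectors heavier than `α` and then, for each residue, the number sectors of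
mass below `α β`. In a surviving sector, the number of target vectors times a source weight is at
most `β α`, hence at most the sector mass. There are at most `I + 1` sectors, so the second loss is
at most `(I + 1) α β`. -/
theorem exists_protocol_of_card_le (F : Schmidt ψ I) (G : Schmidt χ J) (hF : ∑ s, F.w s = 1)
    (hG : ∑ t, G.w t = 1) {d : ℕ} (hd : 0 < d) (σ : ℤ)
    (hσ : ∀ t, G.w t ≠ 0 → (d : ℤ) ∣ G.n t - σ) (δ : ℤ) (V : Finset G.S) {α β : ℝ} (hα : 0 ≤ α)
    (hV : (V.card : ℝ) ≤ β) :
    ∃ P : Protocol A' B' A B, 1 - 2 * (∑ t ∈ Vᶜ, G.w t + d * ((∑ s with α < F.w s, F.w s +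
      (I + 1) * (α * β)) + l1 (T δ * (unifLaw d * G.numLaw) - F.numLaw))) ≤
        P.fidelity ψ χ := by
  have hβ : 0 ≤ β := (Nat.cast_nonneg _).trans hV
  set L : Fin d → Finset F.S := fun j =>
    Finset.univ.filter fun s => (F.n s - δ - σ) % d = (j : ℕ) ∧ F.w s ≤ α with hL
  set U : Fin d → Finset F.S := fun j => (L j).filter fun s => α * β ≤ F.mass (L j) (F.n s) with hUdef
  refine exists_protocol_residues F G hF hG hd σ hσ δ V U (fun j s hs => ?_) (fun j s hs => ?_)
    (fun j => ?_)
  · exact (Finset.mem_filter.1 (Finset.mem_filter.1 hs).1).2.1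
  · obtain ⟨h1, h2⟩ := Finset.mem_filter.1 hs
    have h3 : F.mass (U j) (F.n s) = F.mass (L j) (F.n s) := by
      rw [mass, mass]
      refine Finset.sum_congr ?_ fun _ _ => rfl
      ext s'
      simp only [hUdef, Finset.mem_filter]
      refine ⟨fun h => ⟨h.1.1, h.2⟩, fun h => ⟨⟨h.1, ?_⟩, h.2⟩⟩
      rw [h.2]; exact h2
    rw [h3]
    refine le_trans ?_ h2
    rw [mul_comm α]
    refine mul_le_mul (le_trans ?_ hV) (Finset.mem_filter.1 h1).2.2 (F.w_nonneg _) hβ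
    exact_mod_cast Finset.card_le_card (Finset.filter_subset _ _)
  · have hsub : (Finset.univ.filter fun s => (F.n s - δ - σ) % d = (j : ℕ)) \ U j ⊆
        (Finset.univ.filter fun s => α < F.w s) ∪
          (L j).filter fun s => F.mass (L j) (F.n s) < α * β := by
      intro s hs
      rw [Finset.mem_sdiff, Finset.mem_filter] at hs
      rw [Finset.mem_union, Finset.mem_filter, Finset.mem_filter]
      rcases lt_or_ge α (F.w s) with h | h
      · exact Or.inl ⟨Finset.mem_univ _, h⟩
      · have h1 : s ∈ L j := Finset.mem_filter.2 ⟨Finset.mem_univ _, hs.1.2, h⟩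
        exact Or.inr ⟨h1, not_le.1 fun h2 => hs.2 (Finset.mem_filter.2 ⟨h1, h2⟩)⟩
    refine (Finset.sum_le_sum_of_subset_of_nonneg hsub fun s _ _ => F.w_nonneg s).trans ?_
    rw [← add_zero (∑ s ∈ _ ∪ _, F.w s)]
    refine (add_le_add_right (Finset.sum_nonneg fun s _ => F.w_nonneg s) _).trans
      (Finset.sum_union_inter.le.trans ?_)
    gcongr
    rw [← Finset.sum_fiberwise_of_maps_to (t := Finset.range (I + 1)) (g := F.n)
      (fun s _ => Finset.mem_range.2 (Nat.lt_succ_of_le (F.n_le s)))]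
    calc _ ≤ ∑ n ∈ Finset.range (I + 1), α * β := by
          refine Finset.sum_le_sum fun n _ => ?_
          by_cases h : F.mass (L j) n < α * β
          · refine le_trans (Finset.sum_le_sum_of_subset_of_nonneg ?_ fun s _ _ => F.w_nonneg s) h.le
            intro s hs
            simp only [Finset.mem_filter] at hs ⊢
            exact ⟨hs.1.1, by exact_mod_cast hs.2⟩
          · rw [Finset.sum_eq_zero]
            · positivity
            · intro s hs
              simp only [Finset.mem_filter] at hs
              rw [hs.2] at hs
              exact absurd hs.1.2 h
      _ = _ := by simp

/-- With at most one target vector per sector, the sector condition only says that a weight is at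
most the mass of its own sector. No flatness is required, which serves the case of zero entropy. -/
theorem exists_protocol_of_injective (F : Schmidt ψ I) (G : Schmidt χ J) (hF : ∑ s, F.w s = 1)
    (hG : ∑ t, G.w t = 1) (hGn : Function.Injective G.n) (δ : ℤ) :
    ∃ P : Protocol A' B' A B, 1 - 2 * l1 (T δ * G.numLaw - F.numLaw) ≤ P.fidelity ψ χ := by
  have h := exists_protocol_residues F G hF hG one_pos 0 (fun t _ => one_dvd _) δ Finset.univ
    (fun _ => Finset.univ) (fun j s _ => by have := j.2; simp) (fun j s _ => ?_) (ε₁ := 0)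
    (fun j => ?_)
  · have h1 : unifLaw 1 = 1 := by simp [unifLaw_eq]
    simpa [h1] using h
  · have h1 : (Finset.univ.filter fun t => (G.n t : ℤ) = F.n s + (-δ - (j : ℕ))).card ≤ 1 := by
      rw [Finset.card_le_one]
      intro t ht t' ht'
      rw [Finset.mem_filter] at ht ht'
      exact hGn (by have := ht.2; have := ht'.2; omega)
    have h2 : ((Finset.univ.filter fun t => (G.n t : ℤ) = F.n s + (-δ - (j : ℕ))).card : ℝ) ≤ 1 := by
      exact_mod_cast h1
    refine (mul_le_mul_of_nonneg_right h2 (F.w_nonneg s)).trans ?_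
    rw [one_mul, mass]
    exact Finset.single_le_sum (f := F.w) (fun s _ => F.w_nonneg s)
      (Finset.mem_filter.2 ⟨Finset.mem_univ s, rfl⟩)
  · simp

end Schmidt

end SSR

namespace SSR

open LocalSystem LaurentPolynomial Filter

/-! ### Typical weights -/

/-- The width of the typical window, between the fluctuations `√N` and the length `N`. -/
def window (N : ℕ) : ℝ := (N : ℝ) ^ (3 / 4 : ℝ)

theorem window_nonneg (N : ℕ) : 0 ≤ window N := by unfold window; positivity

theorem window_pos {N : ℕ} (hN : 0 < N) : 0 < window N := by
  have : (0 : ℝ) < N := by exact_mod_cast hN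
  unfold window; positivity

theorem tendsto_window_div : Tendsto (fun N : ℕ => window N / N) atTop (𝓝 0) := by
  have h := (tendsto_rpow_neg_atTop (y := 1 / 4) (by norm_num)).comp
    (tendsto_natCast_atTop_atTop (R := ℝ))
  refine h.congr' ?_
  filter_upwards [eventually_gt_atTop 0] with N hN
  have hN' : (0 : ℝ) < N := by exact_mod_cast hN
  simp only [Function.comp_apply, window]
  rw [eq_div_iff hN'.ne']
  nth_rw 2 [← Real.rpow_one (N : ℝ)]
  rw [← Real.rpow_add hN']
  norm_num

theorem tendsto_mul_div_window_sq (C : ℝ) :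
    Tendsto (fun N : ℕ => N * C / window N ^ 2) atTop (𝓝 0) := by
  have h := ((tendsto_rpow_neg_atTop (y := 1 / 2) (by norm_num)).comp
    (tendsto_natCast_atTop_atTop (R := ℝ))).mul_const C
  rw [zero_mul] at h
  refine h.congr' ?_
  filter_upwards [eventually_gt_atTop 0] with N hN
  have hN' : (0 : ℝ) < N := by exact_mod_cast hN
  simp only [Function.comp_apply]
  have h1 : window N ^ 2 = (N : ℝ) ^ (3 / 2 : ℝ) := by
    rw [window, ← Real.rpow_natCast, ← Real.rpow_mul hN'.le]
    norm_num
  have h2 : (N : ℝ) ^ (-(1 / 2) : ℝ) * (N : ℝ) ^ (3 / 2 : ℝ) = N := by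
    rw [← Real.rpow_add hN']
    norm_num
  rw [h1, eq_div_iff (by positivity)]
  linear_combination C * h2

theorem tendsto_sq_mul_two_rpow_neg_window (C : ℝ) :
    Tendsto (fun N : ℕ => (C * (N + 1)) * ((C * (N + 1)) * 2 ^ (-window N))) atTop (𝓝 0) := by
  have hl : 0 < Real.log 2 := Real.log_pos one_lt_two
  have hw : Tendsto (fun N : ℕ => Real.log 2 * window N) atTop atTop :=
    Tendsto.const_mul_atTop hl ((tendsto_rpow_atTop (by norm_num)).comp
      (tendsto_natCast_atTop_atTop (R := ℝ)))
  have h := ((Real.tendsto_pow_mul_exp_neg_atTop_nhds_zero 4).comp hw).const_mul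
    (4 * C ^ 2 / Real.log 2 ^ 4)
  rw [mul_zero] at h
  refine squeeze_zero' (Eventually.of_forall fun N => ?_) ?_ h
  · rw [← mul_assoc, ← pow_two]; positivity
  · filter_upwards [eventually_ge_atTop 1] with N hN
    have hN' : (1 : ℝ) ≤ N := by exact_mod_cast hN
    have h1 : (N : ℝ) ≤ window N ^ 2 := by
      rw [window, ← Real.rpow_natCast, ← Real.rpow_mul (by linarith)]
      nth_rw 1 [← Real.rpow_one (N : ℝ)]
      exact Real.rpow_le_rpow_of_exponent_le hN' (by norm_num)
    have h2 : (2 : ℝ) ^ (-window N) = Real.exp (-(Real.log 2 * window N)) := by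
      rw [Real.rpow_def_of_pos two_pos]; ring_nf
    simp only [Function.comp_apply]
    rw [← h2]
    have h3 : 4 * C ^ 2 / Real.log 2 ^ 4 * ((Real.log 2 * window N) ^ 4 * 2 ^ (-window N)) =
        4 * C ^ 2 * (window N ^ 2) ^ 2 * 2 ^ (-window N) := by field_simp
    rw [h3, ← mul_assoc]
    refine mul_le_mul_of_nonneg_right ?_ (by positivity)
    have h4 : ((N : ℝ) + 1) ^ 2 ≤ 4 * (window N ^ 2) ^ 2 := by nlinarith
    nlinarith [mul_le_mul_of_nonneg_left h4 (sq_nonneg C)]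

theorem hasRate_floor {x : ℕ → ℝ} {r : ℝ} (hr : 0 ≤ r)
    (hx : Tendsto (fun N : ℕ => x N / N) atTop (𝓝 r)) : HasRate (fun N => ⌊x N⌋₊) r := by
  have h1 : Tendsto (fun N : ℕ => x N / N - 1 / N) atTop (𝓝 r) := by
    simpa using hx.sub tendsto_one_div_atTop_nhds_zero_nat
  have h2 : Tendsto (fun N : ℕ => max (x N / N) 0) atTop (𝓝 r) := by
    simpa [hr] using hx.max (tendsto_const_nhds (x := (0 : ℝ)))
  refine tendsto_of_tendsto_of_tendsto_of_le_of_le h1 h2 (fun N => ?_) (fun N => ?_)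
  · simp only
    rw [← sub_div]
    exact div_le_div_of_nonneg_right (Nat.sub_one_lt_floor _).le (Nat.cast_nonneg _)
  · simp only
    rcases le_total 0 (x N) with h | h
    · exact le_max_of_le_left (div_le_div_of_nonneg_right (Nat.floor_le h) (Nat.cast_nonneg _))
    · rw [Nat.floor_of_nonpos h]; simp

theorem hasRate_ceil {x : ℕ → ℝ} {r : ℝ} (hr : 0 ≤ r)
    (hx : Tendsto (fun N : ℕ => x N / N) atTop (𝓝 r)) : HasRate (fun N => ⌈x N⌉₊) r := by
  have h1 : Tendsto (fun N : ℕ => max (x N / N) 0 + 1 / N) atTop (𝓝 r) := by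
    simpa [hr] using (hx.max (tendsto_const_nhds (x := (0 : ℝ)))).add tendsto_one_div_atTop_nhds_zero_nat
  refine tendsto_of_tendsto_of_tendsto_of_le_of_le hx h1 (fun N => ?_) (fun N => ?_)
  · exact div_le_div_of_nonneg_right (Nat.le_ceil _) (Nat.cast_nonneg _)
  · simp only
    rcases le_total 0 (x N) with h | h
    · refine le_trans ?_ (add_le_add_left (le_max_left _ _) _)
      rw [← add_div]
      exact div_le_div_of_nonneg_right (Nat.ceil_lt_add_one h).le (Nat.cast_nonneg _)
    · rw [Nat.ceil_eq_zero.2 h]; simp; positivity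

/-! ### Upper tails and covers of Schmidt spectra. -/

namespace Schmidt

variable {A B C D : LocalSystem} {φ : BiVec A B} {χ : BiVec C D} {I J : ℕ}

/-- The Schmidt vectors of weight above `α` have total weight at most `ε`. -/
def UpperTail (F : Schmidt φ I) (α ε : ℝ) : Prop := ∑ s with α < F.w s, F.w s ≤ ε

/-- Some `β` Schmidt vectors carry all the weight up to `ε`. -/
def Cover (F : Schmidt φ I) (β ε : ℝ) : Prop :=
  ∃ V : Finset F.S, (V.card : ℝ) ≤ β ∧ ∑ s ∈ Vᶜ, F.w s ≤ ε

theorem upperTail_of_le (F : Schmidt φ I) {α : ℝ} (h : ∀ s, F.w s ≤ α) : F.UpperTail α 0 := by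
  rw [UpperTail, Finset.filter_false_of_mem fun s _ => (h s).not_gt, Finset.sum_empty]

theorem cover_univ (F : Schmidt φ I) {β : ℝ} (h : (Fintype.card F.S : ℝ) ≤ β) : F.Cover β 0 :=
  ⟨Finset.univ, h, by simp⟩

theorem UpperTail.tensor {F : Schmidt φ I} {α ε : ℝ} (h : F.UpperTail α ε) (G : Schmidt χ J)
    (hG : ∑ t, G.w t = 1) {γ : ℝ} (hγ : 0 < γ) (hGγ : ∀ t, G.w t ≤ γ) :
    (F.tensor G).UpperTail (α * γ) ε := by
  refine le_trans ?_ h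
  calc _ ≤ ∑ p ∈ (Finset.univ.filter fun s => α < F.w s) ×ˢ (Finset.univ : Finset G.S),
        F.w p.1 * G.w p.2 := by
        refine Finset.sum_le_sum_of_subset_of_nonneg (fun p hp => ?_)
          fun p _ _ => mul_nonneg (F.w_nonneg _) (G.w_nonneg _)
        have h1 : α * γ < F.w p.1 * G.w p.2 := (Finset.mem_filter.1 hp).2
        have h2 := mul_le_mul_of_nonneg_left (hGγ p.2) (F.w_nonneg p.1)
        exact Finset.mem_product.2 ⟨Finset.mem_filter.2 ⟨Finset.mem_univ _,
          lt_of_mul_lt_mul_right (h1.trans_le h2) hγ.le⟩, Finset.mem_univ _⟩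
    _ = _ := by rw [Finset.sum_product, ← Finset.sum_mul_sum, hG, mul_one]

theorem Cover.tensor {F : Schmidt φ I} {β ε : ℝ} (h : F.Cover β ε) (G : Schmidt χ J)
    (hG : ∑ t, G.w t = 1) {γ : ℝ} (hGγ : (Fintype.card G.S : ℝ) ≤ γ) :
    (F.tensor G).Cover (β * γ) ε := by
  obtain ⟨V, hV, hε⟩ := h
  refine ⟨V ×ˢ (Finset.univ : Finset G.S), ?_, le_trans (le_of_eq ?_) hε⟩
  · have h1 : (((V ×ˢ (Finset.univ : Finset G.S)).card : ℕ) : ℝ) ≤ β * γ := by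
      rw [Finset.card_product, Nat.cast_mul, Finset.card_univ]
      exact mul_le_mul hV hGγ (Nat.cast_nonneg _) ((Nat.cast_nonneg _).trans hV)
    exact h1
  · have : (V ×ˢ (Finset.univ : Finset G.S))ᶜ = Vᶜ ×ˢ (Finset.univ : Finset G.S) := by
      ext p; simp
    change ∑ p ∈ (V ×ˢ (Finset.univ : Finset G.S))ᶜ, F.w p.1 * G.w p.2 = _
    rw [this, Finset.sum_product, ← Finset.sum_mul_sum, hG, mul_one]

theorem w_le_one (F : Schmidt φ I) (hF : ∑ s, F.w s = 1) (s : F.S) : F.w s ≤ 1 := by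
  rw [← hF]
  exact Finset.single_le_sum (fun s _ => F.w_nonneg s) (Finset.mem_univ s)

theorem w_ofEEPR_pow (m : ℕ) (s : (ofEEPR.pow m).S) : (ofEEPR.pow m).w s = (2 : ℝ) ^ (-(m : ℝ)) := by
  change ∏ _i : Fin m, (1 / 2 : ℝ) = _
  rw [Finset.prod_const, Finset.card_univ, Fintype.card_fin, Real.rpow_neg two_pos.le,
    Real.rpow_natCast, one_div, inv_pow]

theorem card_ofEEPR_pow (m : ℕ) : (Fintype.card (ofEEPR.pow m).S : ℝ) = (2 : ℝ) ^ (m : ℝ) := by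
  have : Fintype.card (ofEEPR.pow m).S = 2 ^ m := by
    change Fintype.card (Fin m → Fin 2) = _
    simp
  rw [this, Real.rpow_natCast]
  simp

theorem card_ofVEPR_pow (m : ℕ) : (Fintype.card (ofVEPR.pow m).S : ℝ) = (2 : ℝ) ^ (m : ℝ) :=
  card_ofEEPR_pow m

theorem card_ofAncilla_pow (m : ℕ) : (Fintype.card (ofAncilla.pow m).S : ℝ) = 1 := by
  have : Fintype.card (ofAncilla.pow m).S = 1 := by
    change Fintype.card (Fin m → Unit) = _
    simp
  rw [this, Nat.cast_one]

theorem card_ofNumberState (K : ℕ) (c : Fin (K + 1) → ℝ) (hc : ∀ n, 0 ≤ c n) :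
    (Fintype.card (ofNumberState K c hc).S : ℝ) = K + 1 := by
  have : Fintype.card (ofNumberState K c hc).S = K + 1 := by
    change Fintype.card (Fin (K + 1)) = _
    simp
  rw [this, Nat.cast_succ]

/-- The weight of the Schmidt vectors of `N` copies that are not typical. -/
def atypical (F : Schmidt φ I) (N : ℕ) : ℝ :=
  ∑ s : Fin N → F.S with window N < |∑ i, -Real.logb 2 (F.w (s i)) - N * EoE φ|,
    ∏ i, F.w (s i)

/-- Chebyshev's inequality for the independent variables `-logb 2 (w s)`, whose mean is the entropy;
the bound is of order `N / window N ^ 2`. -/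
theorem tendsto_atypical (F : Schmidt φ I) (hF : ∑ s, F.w s = 1) :
    Tendsto F.atypical atTop (𝓝 0) := by
  refine squeeze_zero' (Eventually.of_forall fun N => Finset.sum_nonneg fun s _ =>
    Finset.prod_nonneg fun i _ => F.w_nonneg _) ?_ (tendsto_mul_div_window_sq
      (∑ s, F.w s * (-Real.logb 2 (F.w s)) ^ 2 - (∑ s, F.w s * (-Real.logb 2 (F.w s))) ^ 2))
  filter_upwards [eventually_gt_atTop 0] with N hN
  have h := chebyshev_pi F.w F.w_nonneg hF (fun s => -Real.logb 2 (F.w s)) N (window N)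
    (window_pos hN)
  have hE : ∑ s, F.w s * -Real.logb 2 (F.w s) = EoE φ := by
    rw [F.eoE_eq, ← Finset.sum_neg_distrib]
    exact Finset.sum_congr rfl fun s _ => by ring
  rw [hE] at h ⊢
  exact h

theorem logb_prod_w (F : Schmidt φ I) (hw : ∀ s, 0 < F.w s) {N : ℕ} (s : Fin N → F.S) :
    ∑ i, -Real.logb 2 (F.w (s i)) = -Real.logb 2 (∏ i, F.w (s i)) := by
  rw [Real.logb_prod _ _ fun i _ => (hw _).ne', Finset.sum_neg_distrib]

theorem upperTail_pow (F : Schmidt φ I) (hw : ∀ s, 0 < F.w s) (N : ℕ) :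
    (F.pow N).UpperTail (2 ^ (-(N * EoE φ - window N))) (F.atypical N) := by
  refine Finset.sum_le_sum_of_subset_of_nonneg (fun (s : Fin N → F.S) hs => ?_)
    fun s _ _ => (F.pow N).w_nonneg s
  have h1 : (2 : ℝ) ^ (-(N * EoE φ - window N)) < ∏ i, F.w (s i) := (Finset.mem_filter.1 hs).2
  refine Finset.mem_filter.2 ⟨Finset.mem_univ _, ?_⟩
  rw [F.logb_prod_w hw, lt_abs]
  have h2 := (Real.lt_logb_iff_rpow_lt one_lt_two (Finset.prod_pos fun i _ => hw (s i))).2 h1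
  right
  linarith

/-- The cover consists of the vectors of weight at least `2 ^ (-(N E + window N))`. The total weight
is 1, which bounds their number; those left out are atypical. -/
theorem cover_pow (F : Schmidt φ I) (hw : ∀ s, 0 < F.w s) (hF : ∑ s, F.w s = 1) (N : ℕ) :
    (F.pow N).Cover (2 ^ (N * EoE φ + window N)) (F.atypical N) := by
  refine ⟨Finset.univ.filter fun s => (2 : ℝ) ^ (-(N * EoE φ + window N)) ≤ (F.pow N).w s, ?_, ?_⟩
  · have h1 : ∑ s with (2 : ℝ) ^ (-(N * EoE φ + window N)) ≤ (F.pow N).w s, (F.pow N).w s ≤ 1 := by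
      rw [← F.sum_w_pow hF N]
      exact Finset.sum_le_sum_of_subset_of_nonneg (Finset.filter_subset _ _)
        fun s _ _ => (F.pow N).w_nonneg s
    have h2 := Finset.card_nsmul_le_sum
      (Finset.univ.filter fun s => (2 : ℝ) ^ (-(N * EoE φ + window N)) ≤ (F.pow N).w s)
      (F.pow N).w _ fun s hs => (Finset.mem_filter.1 hs).2
    have h3 := h2.trans h1
    rw [nsmul_eq_mul] at h3
    have h4 : (2 : ℝ) ^ (-(N * EoE φ + window N)) * 2 ^ (N * EoE φ + window N) = 1 := by
      rw [← Real.rpow_add two_pos, neg_add_cancel, Real.rpow_zero]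
    have h5 := mul_le_mul_of_nonneg_right h3
      (Real.rpow_nonneg two_pos.le (N * EoE φ + window N))
    rwa [mul_assoc, h4, mul_one, one_mul] at h5
  · refine Finset.sum_le_sum_of_subset_of_nonneg (fun (s : Fin N → F.S) hs => ?_)
      fun s _ _ => (F.pow N).w_nonneg s
    have h1 : ∏ i, F.w (s i) < (2 : ℝ) ^ (-(N * EoE φ + window N)) := not_le.1 fun h =>
      Finset.mem_compl.1 hs (Finset.mem_filter.2 ⟨Finset.mem_univ _, h⟩)
    refine Finset.mem_filter.2 ⟨Finset.mem_univ _, ?_⟩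
    rw [F.logb_prod_w hw, lt_abs]
    have h2 := (Real.logb_lt_iff_lt_rpow one_lt_two (Finset.prod_pos fun i _ => hw (s i))).2 h1
    left
    linarith

end Schmidt

/-! ### Asymptotic conversion -/

section asymp

variable {A B A' B' : ℕ → LocalSystem} {ψ : ∀ N, BiVec (A N) (B N)} {χ : ∀ N, BiVec (A' N) (B' N)}
  {I J : ℕ → ℕ}

theorem asympConverts_of_le (F : ∀ N, Schmidt (ψ N) (I N)) (G : ∀ N, Schmidt (χ N) (J N))
    (hF : ∀ N, ∑ s, (F N).w s = 1) (hG : ∀ N, ∑ t, (G N).w t = 1) (ε : ℕ → ℝ)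
    (hε : Tendsto ε atTop (𝓝 0))
    (h : ∀ N, ∃ P : Protocol (A' N) (B' N) (A N) (B N), 1 - 2 * ε N ≤ P.fidelity (ψ N) (χ N)) :
    AsympConverts ψ χ := by
  choose P hP using h
  refine ⟨P, tendsto_of_tendsto_of_tendsto_of_le_of_le ?_ tendsto_const_nhds hP fun N => ?_⟩
  · simpa using (hε.const_mul 2).const_sub 1
  · have := Protocol.fidelity_le (χ N) (P N) (ψ N)
    rwa [(F N).sum_norm_sq, (G N).sum_norm_sq, hF, hG, one_mul] at this

theorem asympConverts_of_injective (F : ∀ N, Schmidt (ψ N) (I N)) (G : ∀ N, Schmidt (χ N) (J N))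
    (hF : ∀ N, ∑ s, (F N).w s = 1) (hG : ∀ N, ∑ t, (G N).w t = 1)
    (hGn : ∀ N, Function.Injective (G N).n) (δ : ℕ → ℤ)
    (hlaw : Tendsto (fun N => l1 (T (δ N) * (G N).numLaw - (F N).numLaw)) atTop (𝓝 0)) :
    AsympConverts ψ χ :=
  asympConverts_of_le F G hF hG _ hlaw fun N =>
    (F N).exists_protocol_of_injective (G N) (hF N) (hG N) (hGn N) (δ N)

/-- The working criterion. One conversion loses the upper tail, the uncovered weight, the distance
of the number laws and `(I + 1) α β`; the last is quadratic in `N` times `2 ^ (-window N)` and tends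
to zero. -/
theorem asympConverts_of_cover (F : ∀ N, Schmidt (ψ N) (I N)) (G : ∀ N, Schmidt (χ N) (J N))
    (hF : ∀ N, ∑ s, (F N).w s = 1) (hG : ∀ N, ∑ t, (G N).w t = 1) {d : ℕ} (hd : 0 < d)
    (σ : ℕ → ℤ) (hσ : ∀ N t, (G N).w t ≠ 0 → (d : ℤ) ∣ (G N).n t - σ N) (δ : ℕ → ℤ)
    (hlaw : Tendsto (fun N => l1 (T (δ N) * (unifLaw d * (G N).numLaw) - (F N).numLaw)) atTop
      (𝓝 0)) {α β ε₁ ε₂ : ℕ → ℝ} (hα : ∀ N, 0 ≤ α N) (hFα : ∀ N, (F N).UpperTail (α N) (ε₁ N))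
    (hGβ : ∀ N, (G N).Cover (β N) (ε₂ N)) (hε₁ : Tendsto ε₁ atTop (𝓝 0))
    (hε₂ : Tendsto ε₂ atTop (𝓝 0)) (C : ℝ) (hI : ∀ᶠ N in atTop, (I N + 1 : ℝ) ≤ C * (N + 1))
    (hαβ : ∀ᶠ N in atTop, α N * β N ≤ C * (N + 1) * 2 ^ (-window N)) :
    AsympConverts ψ χ := by
  choose V hV hV' using hGβ
  have hβ : ∀ N, 0 ≤ β N := fun N => (Nat.cast_nonneg _).trans (hV N)
  have hlim : Tendsto (fun N => (I N + 1 : ℝ) * (α N * β N)) atTop (𝓝 0) := by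
    refine squeeze_zero' (Eventually.of_forall fun N => ?_) ?_
      (tendsto_sq_mul_two_rpow_neg_window C)
    · exact mul_nonneg (by positivity) (mul_nonneg (hα N) (hβ N))
    · filter_upwards [hI, hαβ] with N h1 h2
      exact mul_le_mul h1 h2 (mul_nonneg (hα N) (hβ N)) (le_trans (by positivity) h1)
  have hε := hε₂.add (((hε₁.add hlim).add hlaw).const_mul (d : ℝ))
  simp only [add_zero, mul_zero] at hε
  refine asympConverts_of_le F G hF hG _ hε fun N => ?_
  obtain ⟨P, hP⟩ := (F N).exists_protocol_of_card_le (G N) (hF N) (hG N) hd (σ N) (hσ N) (δ N)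
    (V N) (hα N) (hV N)
  refine ⟨P, le_trans ?_ hP⟩
  have h1 := hV' N
  have h2 : _ ≤ _ := hFα N
  have hd' : (0 : ℝ) ≤ d := Nat.cast_nonneg d
  gcongr

end asymp

end SSR

namespace SSR

open LocalSystem LaurentPolynomial Filter

/-! ### The particle number distribution of many copies -/

theorem unifLaw_one : unifLaw 1 = 1 := by simp [unifLaw_eq]

/-- `1 - T j` is a sum of `j` translates of `1 - T 1`, and `1 - unifLaw d` averages these over `j <
d`. -/
theorem l1_one_sub_unifLaw_mul_le {d : ℕ} (hd : 0 < d) (p : ℝ[T;T⁻¹]) :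
    l1 ((1 - unifLaw d) * p) ≤ d * l1 ((1 - T 1) * p) := by
  have hd' : (d : ℝ) ≠ 0 := by exact_mod_cast hd.ne'
  have h1 : ∀ j : ℕ, l1 ((1 - T (j : ℤ)) * p) ≤ j * l1 ((1 - T 1) * p) := by
    intro j
    induction j with
    | zero => simp [l1_zero]
    | succ j ih =>
      have h2 : (1 - T ((j + 1 : ℕ) : ℤ)) * p = (1 - T (j : ℤ)) * p + T (j : ℤ) * ((1 - T 1) * p) := by
        rw [Nat.cast_succ, T_add]; ring
      rw [h2]
      refine (l1_add_le _ _).trans ?_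
      rw [l1_T_mul, Nat.cast_succ, add_mul, one_mul]
      gcongr
  have h2 : (1 - unifLaw d) * p = (1 / d : ℝ) • ∑ j ∈ Finset.range d, (1 - T (j : ℤ)) * p := by
    rw [unifLaw_eq, ← Finset.sum_mul, Finset.sum_sub_distrib, Finset.sum_const, Finset.card_range,
      sub_mul, sub_mul, smul_sub, smul_mul_assoc, ← Nat.cast_smul_eq_nsmul ℝ, smul_mul_assoc,
      smul_smul, one_div_mul_cancel hd', one_smul]
  rw [h2, l1_smul, abs_of_nonneg (by positivity), one_div, inv_mul_le_iff₀ (by positivity)]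
  refine (l1_sum_le _ _).trans ?_
  calc ∑ j ∈ Finset.range d, l1 ((1 - T (j : ℤ)) * p)
      ≤ ∑ j ∈ Finset.range d, d * l1 ((1 - T 1) * p) := by
        refine Finset.sum_le_sum fun j hj => (h1 j).trans ?_
        have : (j : ℝ) ≤ d := by exact_mod_cast (Finset.mem_range.1 hj).le
        exact mul_le_mul_of_nonneg_right this (l1_nonneg _)
    _ = _ := by simp

theorem sum_coeff_law_mul {S : Type*} [Fintype S] (w : S → ℝ) (n : S → ℕ) (K : ℕ)
    (hn : ∀ s, n s ≤ K) (g : ℕ → ℝ) :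
    ∑ j : Fin (K + 1), (law w fun s => (n s : ℤ)).coeff ((j : ℕ) : ℤ) * g j =
      ∑ s, w s * g (n s) := by
  classical
  rw [Fin.sum_univ_eq_sum_range fun j => (law w fun s => (n s : ℤ)).coeff ((j : ℕ) : ℤ) * g j]
  rw [← Finset.sum_fiberwise_of_maps_to (t := Finset.range (K + 1)) (g := n)
    (fun s _ => Finset.mem_range.2 (Nat.lt_succ_of_le (hn s)))]
  refine Finset.sum_congr rfl fun j _ => ?_
  rw [coeff_law, Finset.sum_mul]
  simp only [Nat.cast_inj]
  exact Finset.sum_congr rfl fun s hs => by rw [(Finset.mem_filter.1 hs).2]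

theorem law_coeff_law {S : Type*} [Fintype S] (w : S → ℝ) (n : S → ℕ) (K : ℕ)
    (hn : ∀ s, n s ≤ K) :
    law (fun j : Fin (K + 1) => (law w fun s => (n s : ℤ)).coeff ((j : ℕ) : ℤ))
      (fun j => ((j : ℕ) : ℤ)) = law w fun s => (n s : ℤ) := by
  classical
  ext z
  have h := sum_coeff_law_mul w n K hn fun j => if (j : ℤ) = z then 1 else 0
  rw [coeff_law, coeff_law, Finset.sum_filter, Finset.sum_filter]
  simpa using h

theorem law_const {S : Type*} [Fintype S] (w : S → ℝ) (hw : ∑ s, w s = 1) (n : S → ℤ) (z : ℤ)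
    (hn : ∀ s, n s = z) : law w n = T z := by
  rw [law, T, ← hw]
  simp only [hn]
  exact (map_sum (AddMonoidAlgebra.singleAddHom z) w Finset.univ).symm

theorem gaussCoeff_zero_sq (K : ℕ) (j : Fin (K + 1)) :
    gaussCoeff K 0 j ^ 2 = if (j : ℕ) = K / 2 then 1 else 0 := by
  have h : ∀ i : Fin (K + 1), gaussWeight (K / 2) (0 / 4) i = if (i : ℕ) = K / 2 then 1 else 0 := by
    intro i; simp [gaussWeight]
  rw [gaussCoeff_sq]
  simp only [h]
  rw [Fin.sum_univ_eq_sum_range fun i => if i = K / 2 then (1 : ℝ) else 0, Finset.sum_ite_eq',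
    if_pos (Finset.mem_range.2 (by omega)), div_one]

theorem sum_gaussCoeff_zero_sq_mul (K : ℕ) (g : ℕ → ℝ) :
    ∑ j : Fin (K + 1), gaussCoeff K 0 j ^ 2 * g j = g (K / 2) := by
  simp only [gaussCoeff_zero_sq]
  rw [Fin.sum_univ_eq_sum_range fun i => (if i = K / 2 then (1 : ℝ) else 0) * g i]
  simp only [ite_mul, one_mul, zero_mul]
  rw [Finset.sum_ite_eq', if_pos (Finset.mem_range.2 (by omega))]

theorem gaussLaw_zero (K : ℕ) : gaussLaw K 0 = T ((K / 2 : ℕ) : ℤ) := by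
  ext z
  have h := sum_gaussCoeff_zero_sq_mul K fun j => if (j : ℤ) = z then 1 else 0
  rw [gaussLaw, coeff_law, Finset.sum_filter, T, AddMonoidAlgebra.coeff_single,
    Finsupp.single_apply]
  simpa using h

/-! ### Periodicity and Gaussian limit of the number law. -/

namespace Schmidt

variable {A B : LocalSystem} {φ : BiVec A B} {I : ℕ}

theorem siV_eq_sum_sq (F : Schmidt φ I) (hF : ∑ s, F.w s = 1) :
    SiV φ = 4 * ∑ s, F.w s * ((F.n s : ℝ) - ∑ s, F.w s * (F.n s : ℝ)) ^ 2 := by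
  rw [F.siV_eq]
  set m := ∑ s, F.w s * (F.n s : ℝ) with hm
  have h : ∀ s, F.w s * ((F.n s : ℝ) - m) ^ 2 = F.w s * (F.n s : ℝ) ^ 2 -
      2 * m * (F.w s * F.n s) + m ^ 2 * F.w s := fun s => by ring
  simp only [h]
  rw [Finset.sum_add_distrib, Finset.sum_sub_distrib, ← Finset.mul_sum, ← Finset.mul_sum, ← hm, hF]
  ring

theorem siV_nonneg (F : Schmidt φ I) (hF : ∑ s, F.w s = 1) : 0 ≤ SiV φ := by
  rw [F.siV_eq_sum_sq hF]
  exact mul_nonneg (by norm_num) (Finset.sum_nonneg fun s _ =>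
    mul_nonneg (F.w_nonneg s) (sq_nonneg _))

theorem exists_n_eq_of_siV_eq_zero (F : Schmidt φ I) (hw : ∀ s, 0 < F.w s)
    (hF : ∑ s, F.w s = 1) (h : SiV φ = 0) : ∃ n₀ : ℕ, ∀ s, F.n s = n₀ := by
  obtain ⟨s₀, -, -⟩ := F.exists_index hF
  have h1 : ∀ s, (F.n s : ℝ) = ∑ s, F.w s * (F.n s : ℝ) := by
    intro s
    rw [F.siV_eq_sum_sq hF, mul_eq_zero, or_iff_right (by norm_num),
      Finset.sum_eq_zero_iff_of_nonneg fun s _ => mul_nonneg (F.w_nonneg s) (sq_nonneg _)] at h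
    have := (mul_eq_zero.1 (h s (Finset.mem_univ s))).resolve_left (hw s).ne'
    exact sub_eq_zero.1 (pow_eq_zero_iff (two_ne_zero) |>.1 this)
  exact ⟨F.n s₀, fun s => by exact_mod_cast (h1 s).trans (h1 s₀).symm⟩

theorem exists_apply_ne_zero (F : Schmidt φ I) (hw : ∀ s, 0 < F.w s) (s : F.S) :
    ∃ p, φ p ≠ 0 ∧ A.num p.1 = F.n s := by
  by_contra hno
  push Not at hno
  have h := F.sum_norm_sq_mul fun n => if n = F.n s then 1 else 0
  have h1 : 0 < ∑ s', F.w s' * if F.n s' = F.n s then (1 : ℝ) else 0 :=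
    Finset.sum_pos' (fun s' _ => mul_nonneg (F.w_nonneg s') (by split_ifs <;> norm_num))
      ⟨s, Finset.mem_univ s, by simpa using hw s⟩
  rw [← h, Finset.sum_eq_zero] at h1
  · exact lt_irrefl _ h1
  · intro p _
    by_cases hp : φ p = 0
    · simp [hp]
    · simp [hno p hp]

theorem exists_n_eq (F : Schmidt φ I) {p : A.ι × B.ι} (hp : φ p ≠ 0) :
    ∃ s, A.num p.1 = F.n s := by
  rw [show p = (p.1, p.2) from rfl, F.apply_eq] at hp
  obtain ⟨s, -, hs⟩ := Finset.exists_ne_zero_of_sum_ne_zero hp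
  exact ⟨s, F.a_num _ _ (left_ne_zero_of_mul (left_ne_zero_of_mul hs))⟩

theorem hasGap_of_dvd (F : Schmidt φ I) (hw : ∀ s, 0 < F.w s) {d : ℕ} (hd : 2 ≤ d)
    (hdvd : ∀ s s', (d : ℤ) ∣ (F.n s : ℤ) - F.n s') {s s' : F.S} (hs : F.n s ≠ F.n s') :
    HasGap φ := by
  obtain ⟨p, hp, hps⟩ := F.exists_apply_ne_zero hw s
  obtain ⟨q, hq, hqs⟩ := F.exists_apply_ne_zero hw s'
  refine ⟨⟨p, q, hp, hq, by rwa [hps, hqs]⟩, d, hd, fun p q hp hq => ?_⟩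
  obtain ⟨t, ht⟩ := F.exists_n_eq hp
  obtain ⟨t', ht'⟩ := F.exists_n_eq hq
  rw [ht, ht', Nat.modEq_iff_dvd]
  exact hdvd t' t

/-- Includes the degenerate case: for zero variance the number law is a monomial, equal to the
degenerate Gaussian after translation, with `d = 1`. Otherwise a period above 1 exhibits a periodic
gap. -/
theorem exists_period (F : Schmidt φ I) (hw : ∀ s, 0 < F.w s) (hF : ∑ s, F.w s = 1) :
    ∃ d : ℕ, 0 < d ∧ (d = 1 ∨ HasGap φ) ∧ (∀ s s', (d : ℤ) ∣ (F.n s : ℤ) - F.n s') ∧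
      ∃ Δ : ℕ → ℤ, Tendsto (fun N : ℕ =>
        l1 (T (Δ N) * (unifLaw d * F.numLaw ^ N) - gaussLaw N (N * SiV φ))) atTop (𝓝 0) := by
  rcases (F.siV_nonneg hF).eq_or_lt with h0 | hpos
  · obtain ⟨n₀, hn₀⟩ := F.exists_n_eq_of_siV_eq_zero hw hF h0.symm
    refine ⟨1, one_pos, Or.inl rfl, fun s s' => one_dvd _,
      fun N => ((N / 2 : ℕ) : ℤ) - N * n₀, ?_⟩
    have h : ∀ N : ℕ, T (((N / 2 : ℕ) : ℤ) - N * n₀) * (unifLaw 1 * F.numLaw ^ N) -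
        gaussLaw N (N * SiV φ) = 0 := by
      intro N
      rw [← h0, mul_zero, gaussLaw_zero, unifLaw_one, one_mul, numLaw,
        law_const F.w hF _ n₀ fun s => by rw [hn₀ s], T_pow, ← T_add, sub_add_cancel, sub_self]
    simp only [h, l1_zero]
    exact tendsto_const_nhds
  · have hV : 4 * (∑ s, F.w s * (((F.n s : ℤ) : ℝ)) ^ 2 - (∑ s, F.w s * ((F.n s : ℤ) : ℝ)) ^ 2) =
        SiV φ := by
      rw [F.siV_eq]; simp only [Int.cast_natCast]
    obtain ⟨d, hd, hdvd, Δ, hΔ⟩ := exists_period_tendsto_gauss F.w F.w_nonneg hF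
      (fun s => (F.n s : ℤ)) (SiV φ) hV hpos
    refine ⟨d, hd, ?_, fun s s' => hdvd s s' (hw s) (hw s'), Δ, hΔ⟩
    rcases Nat.lt_or_ge d 2 with h | h
    · left; omega
    · right
      obtain ⟨s, s', -, -, hne⟩ := exists_ne_of_variance_pos F.w F.w_nonneg hF
        (fun s => (F.n s : ℤ)) (by linarith)
      exact F.hasGap_of_dvd hw h (fun s s' => hdvd s s' (hw s) (hw s'))
        (s := s) (s' := s') (by simpa using hne)

theorem l1_numLaw_le (F : Schmidt φ I) (hF : ∑ s, F.w s = 1) : l1 F.numLaw ≤ 1 := by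
  rw [numLaw, l1_law_eq _ F.w_nonneg, hF]

/-- The V-EPRs take over the role of `unifLaw d`: convolving their binomial law with it changes the
law by O(`d / √k`). So `k → ∞` suffices, and without a gap `d = 1` and there is nothing to absorb.
-/
theorem exists_tendsto_gauss_mul (F : Schmidt φ I) (hw : ∀ s, 0 < F.w s) (hF : ∑ s, F.w s = 1)
    (k : ℕ → ℕ) (hk : Tendsto k atTop atTop ∨ ¬ HasGap φ) :
    ∃ Δ : ℕ → ℤ, Tendsto (fun N : ℕ => l1 (T (Δ N) * (F.numLaw ^ N * ofVEPR.numLaw ^ k N) -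
      gaussLaw N (N * SiV φ) * ofVEPR.numLaw ^ k N)) atTop (𝓝 0) := by
  obtain ⟨d, hd, hgap, -, Δ, hΔ⟩ := F.exists_period hw hF
  have hB : ∀ k, l1 (ofVEPR.numLaw ^ k) ≤ 1 := fun k => by
    rw [← numLaw_pow]; exact (ofVEPR.pow k).l1_numLaw_le (sum_w_pow _ sum_w_ofVEPR k)
  have hP : ∀ N, l1 (F.numLaw ^ N) ≤ 1 := fun k => by
    rw [← numLaw_pow]; exact (F.pow k).l1_numLaw_le (sum_w_pow _ hF k)
  have hU : Tendsto (fun N => l1 ((1 - unifLaw d) * ofVEPR.numLaw ^ k N)) atTop (𝓝 0) := by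
    by_cases h1 : d = 1
    · subst h1
      simp only [unifLaw_one, sub_self, zero_mul, l1_zero]
      exact tendsto_const_nhds
    · have hk' : Tendsto k atTop atTop := hk.resolve_right fun h => h (hgap.resolve_left h1)
      have h2 : Tendsto (fun N : ℕ => (d : ℝ) * (2 / Real.sqrt (k N + 1))) atTop (𝓝 0) := by
        rw [← mul_zero (d : ℝ)]
        refine Tendsto.const_mul _ (Tendsto.const_div_atTop ?_ _)
        exact Real.tendsto_sqrt_atTop.comp
          (tendsto_atTop_add_const_right _ _ (tendsto_natCast_atTop_atTop.comp hk'))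
      refine squeeze_zero (fun N => l1_nonneg _) (fun N => ?_) h2
      refine (l1_one_sub_unifLaw_mul_le hd _).trans ?_
      exact mul_le_mul_of_nonneg_left (l1_one_sub_T_mul_numLaw_ofVEPR_pow_le _) (Nat.cast_nonneg _)
  refine ⟨Δ, squeeze_zero (fun N => l1_nonneg _) (fun N => ?_) (by
    rw [← add_zero (0 : ℝ)]; exact hU.add hΔ)⟩
  have h1 : T (Δ N) * (F.numLaw ^ N * ofVEPR.numLaw ^ k N) -
      gaussLaw N (N * SiV φ) * ofVEPR.numLaw ^ k N =
      T (Δ N) * (F.numLaw ^ N * ((1 - unifLaw d) * ofVEPR.numLaw ^ k N)) +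
      (T (Δ N) * (unifLaw d * F.numLaw ^ N) - gaussLaw N (N * SiV φ)) * ofVEPR.numLaw ^ k N := by
    ring
  rw [h1]
  refine (l1_add_le _ _).trans (add_le_add ?_ ?_)
  · rw [l1_T_mul]
    exact (l1_mul_le _ _).trans (mul_le_of_le_one_left (l1_nonneg _) (hP N))
  · exact (l1_mul_le _ _).trans (mul_le_of_le_one_right (l1_nonneg _) (hB _))

theorem eoE_nonneg (F : Schmidt φ I) (hF : ∑ s, F.w s = 1) : 0 ≤ EoE φ := by
  rw [F.eoE_eq, ← Finset.sum_neg_distrib]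
  refine Finset.sum_nonneg fun s _ => ?_
  rw [← mul_neg]
  exact mul_nonneg (F.w_nonneg s) (neg_nonneg.2 (Real.logb_nonpos one_lt_two (F.w_nonneg s)
    (F.w_le_one hF s)))

/-- Zero entropy forces every weight to be 1, hence a single Schmidt vector and a single number. No
V-EPRs are then used, and the criterion for injective numbers applies. -/
theorem not_hasGap_of_eoE_eq_zero (F : Schmidt φ I) (hw : ∀ s, 0 < F.w s)
    (hF : ∑ s, F.w s = 1) (h : EoE φ = 0) : ¬ HasGap φ := by
  rintro ⟨⟨p, q, hp, hq, hpq⟩, -⟩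
  obtain ⟨s, hs⟩ := F.exists_n_eq hp
  obtain ⟨s', hs'⟩ := F.exists_n_eq hq
  have hne : s ≠ s' := fun h => hpq (by rw [hs, hs', h])
  have h1 : ∀ s, F.w s = 1 := by
    intro s
    rw [F.eoE_eq, neg_eq_zero, Finset.sum_eq_zero_iff_of_nonpos fun s _ =>
      mul_nonpos_of_nonneg_of_nonpos (F.w_nonneg s) (Real.logb_nonpos one_lt_two (F.w_nonneg s)
        (F.w_le_one hF s))] at h
    have h2 := (mul_eq_zero.1 (h s (Finset.mem_univ s))).resolve_left (hw s).ne'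
    exact Real.eq_one_of_pos_of_logb_eq_zero one_lt_two (hw s) h2
  have h2 := Finset.add_le_sum (f := F.w) (fun s _ => F.w_nonneg s) (Finset.mem_univ s)
    (Finset.mem_univ s') hne
  rw [hF, h1, h1] at h2
  norm_num at h2

end Schmidt

end SSR

namespace SSR

open LocalSystem LaurentPolynomial Filter Schmidt

/-! ### The conversion protocols -/

theorem window_le (N : ℕ) : window N ≤ N := by
  rcases Nat.eq_zero_or_pos N with rfl | hN
  · simp [window]
  · have hN' : (1 : ℝ) ≤ N := by exact_mod_cast hN
    rw [window]
    nth_rw 2 [← Real.rpow_one (N : ℝ)]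
    exact Real.rpow_le_rpow_of_exponent_le hN' (by norm_num)

theorem cast_floor_le {x y : ℝ} (hxy : x ≤ y) (hy : 0 ≤ y) : (⌊x⌋₊ : ℝ) ≤ y :=
  (Nat.cast_le.2 (Nat.floor_mono hxy)).trans (Nat.floor_le hy)

theorem two_rpow_mul_le {a b c : ℝ} (h : a + b ≤ c) : (2 : ℝ) ^ a * 2 ^ b ≤ 2 ^ c := by
  rw [← Real.rpow_add two_pos]
  exact Real.rpow_le_rpow_of_exponent_le one_le_two h

theorem l1_mul_T_pow (p : ℝ[T;T⁻¹]) (m : ℕ) : l1 (p * T 1 ^ m) = l1 p := by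
  rw [T_pow, mul_comm, l1_T_mul]

theorem numLaw_tensor_ofEEPR_pow {A B : LocalSystem} {φ : BiVec A B} {I : ℕ} (F : Schmidt φ I)
    (m : ℕ) : (F.tensor (ofEEPR.pow m)).numLaw = F.numLaw * T 1 ^ m := by
  rw [numLaw_tensor, numLaw_pow, numLaw_ofEEPR]

theorem numLaw_tensor_ofAncilla_pow {A B : LocalSystem} {φ : BiVec A B} {I : ℕ} (F : Schmidt φ I)
    (m : ℕ) : (F.tensor (ofAncilla.pow m)).numLaw = F.numLaw * T 1 ^ m := by
  rw [numLaw_tensor, numLaw_pow, numLaw_ofAncilla]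

section concentrate

variable {A B A' B' : ℕ → LocalSystem} {ψ : ∀ N, BiVec (A N) (B N)} {χ : ∀ N, BiVec (A' N) (B' N)}
  {I J : ℕ → ℕ}

/-- Entanglement concentration: a source with flat spectrum yields `E N - o(N)` E-EPRs on top of a
state `χ` of small Schmidt rank with the same particle number distribution. -/
theorem asympConverts_concentrate (F : ∀ N, Schmidt (ψ N) (I N)) (Y : ∀ N, Schmidt (χ N) (J N))
    (hF : ∀ N, ∑ s, (F N).w s = 1) (hY : ∀ N, ∑ t, (Y N).w t = 1) {E : ℝ} (hE : 0 ≤ E)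
    {k : ℕ → ℕ} (hk : HasRate k 0) {ε : ℕ → ℝ} (hε : Tendsto ε atTop (𝓝 0))
    (hFα : ∀ N, (F N).UpperTail (2 ^ (-(N * E - window N))) (ε N)) {C : ℝ}
    (hI : ∀ N, (I N : ℝ) ≤ C * (N + 1))
    (hcard : ∀ N, (Fintype.card (Y N).S : ℝ) ≤ C * (N + 1) * 2 ^ (k N : ℝ)) (δ : ℕ → ℤ)
    (hlaw : Tendsto (fun N => l1 (T (δ N) * (Y N).numLaw - (F N).numLaw)) atTop (𝓝 0))
    (hinj : 0 < E ∨ ∀ N, Function.Injective (Y N).n) {m : ℕ → ℕ}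
    (hm : ∀ N : ℕ, m N = ⌊N * E - 2 * window N - k N⌋₊) :
    AsympConverts (fun N => tensorVec (ψ N) (powVec ancilla (m N)))
      (fun N => tensorVec (χ N) (powVec eEPR (m N))) := by
  have hlaw' : ∀ N, l1 (T (δ N) * ((Y N).tensor (ofEEPR.pow (m N))).numLaw -
      ((F N).tensor (ofAncilla.pow (m N))).numLaw) = l1 (T (δ N) * (Y N).numLaw - (F N).numLaw) := by
    intro N
    rw [numLaw_tensor_ofEEPR_pow, numLaw_tensor_ofAncilla_pow, ← mul_assoc, ← sub_mul, l1_mul_T_pow]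
  have hFs : ∀ N, ∑ s, ((F N).tensor (ofAncilla.pow (m N))).w s = 1 := fun N =>
    sum_w_tensor _ _ (hF N) (sum_w_pow _ sum_w_ofAncilla _)
  have hYs : ∀ N, ∑ s, ((Y N).tensor (ofEEPR.pow (m N))).w s = 1 := fun N =>
    sum_w_tensor _ _ (hY N) (sum_w_pow _ sum_w_ofEEPR _)
  -- For `E = 0` there is no room for the margin `2 * window N`. The truncated floor gives `m = 0`,
  -- and the conversion rests on injectivity of the target's numbers.
  rcases hE.eq_or_lt with h0 | hpos
  · have hm0 : ∀ N, m N = 0 := fun N => by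
      rw [hm, ← h0, Nat.floor_eq_zero]
      have := window_nonneg N
      have : (0 : ℝ) ≤ k N := Nat.cast_nonneg _
      linarith
    refine asympConverts_of_injective (fun N => (F N).tensor (ofAncilla.pow (m N)))
      (fun N => (Y N).tensor (ofEEPR.pow (m N))) hFs hYs (fun N => ?_) δ (by simpa only [hlaw'])
    have hinj' := hinj.resolve_left (by rw [← h0]; exact lt_irrefl _) N
    rintro ⟨s, u⟩ ⟨s', u'⟩ h
    have hu : u = u' := funext fun i => absurd (i.2.trans_eq (hm0 N)) (Nat.not_lt_zero _)
    subst hu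
    have h1 : (Y N).n s + (ofEEPR.pow (m N)).n u = (Y N).n s' + (ofEEPR.pow (m N)).n u := h
    rw [hinj' (Nat.add_right_cancel h1)]
  · have hm1 : ∀ N, (m N : ℝ) ≤ N * E := fun N => by
      rw [hm]
      have := window_nonneg N
      have : (0 : ℝ) ≤ k N := Nat.cast_nonneg _
      exact cast_floor_le (by linarith) (by positivity)
    have hlim : Tendsto (fun N : ℕ => (N * E - 2 * window N - k N) / N) atTop (𝓝 E) := by
      have h1 := ((tendsto_window_div.const_mul 2).const_sub E).sub hk
      simp only [mul_zero, sub_zero] at h1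
      refine h1.congr' ?_
      filter_upwards [eventually_gt_atTop 0] with N hN
      have hN' : (N : ℝ) ≠ 0 := by exact_mod_cast hN.ne'
      field_simp
    have hC : 0 ≤ C := by
      have h1 := (Nat.cast_nonneg _).trans (hI 0)
      simpa using h1
    refine asympConverts_of_cover (fun N => (F N).tensor (ofAncilla.pow (m N)))
      (fun N => (Y N).tensor (ofEEPR.pow (m N))) hFs hYs one_pos (fun _ => 0)
      (fun N t _ => by simp) δ (by simpa only [unifLaw_one, one_mul, hlaw'])
      (α := fun N => 2 ^ (-(N * E - window N)) * 1)
      (β := fun N => C * (N + 1) * 2 ^ (k N : ℝ) * 2 ^ (m N : ℝ)) (fun N => by positivity)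
      (fun N => (hFα N).tensor _ (sum_w_pow _ sum_w_ofAncilla _) one_pos
        (w_le_one _ (sum_w_pow _ sum_w_ofAncilla _)))
      (fun N => (cover_univ _ (hcard N)).tensor _ (sum_w_pow _ sum_w_ofEEPR _)
        (card_ofEEPR_pow _).le) hε tendsto_const_nhds (C + 2 * E + 1)
      (Eventually.of_forall fun N => ?_) ?_
    · push_cast
      nlinarith [hI N, hm1 N, Nat.cast_nonneg (α := ℝ) N]
    -- As `E > 0`, the argument of the floor is eventually nonnegative and is not truncated.
    · filter_upwards [hlim.eventually (lt_mem_nhds hpos)] with N hN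
      have hpos' : 0 ≤ N * E - 2 * window N - k N := by
        by_contra h
        exact absurd hN (not_lt.2 (div_nonpos_of_nonpos_of_nonneg (not_le.1 h).le
          (Nat.cast_nonneg _)))
      have h1 : (m N : ℝ) ≤ N * E - 2 * window N - k N := by rw [hm]; exact Nat.floor_le hpos'
      -- One `window N` in `m` pays for the spread of the source spectrum, the other is the factor
      -- by which `α β` must be small.
      have h2 : (2 : ℝ) ^ (-(N * E - window N)) * 2 ^ ((k N : ℝ) + m N) ≤ 2 ^ (-window N) :=
        two_rpow_mul_le (by linarith)
      rw [Real.rpow_add two_pos] at h2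
      calc _ = C * (N + 1) * (2 ^ (-(N * E - window N)) * (2 ^ (k N : ℝ) * 2 ^ (m N : ℝ))) := by
            ring
        _ ≤ C * (N + 1) * 2 ^ (-window N) := mul_le_mul_of_nonneg_left h2 (by positivity)
        _ ≤ _ := by gcongr; linarith

end concentrate

section dilute

variable {A B : LocalSystem} {φ : BiVec A B} {I : ℕ}

/-- Entanglement dilution from E-EPRs and a state of a register; the particle number of the target
may be confined to a lattice. -/
theorem asympConverts_dilute (F : Schmidt φ I) (hw : ∀ s, 0 < F.w s) (hF : ∑ s, F.w s = 1)
    (K : ℕ → ℕ) (c : ∀ N, Fin (K N + 1) → ℝ) (hc : ∀ N j, 0 ≤ c N j)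
    (hc1 : ∀ N, ∑ j, c N j ^ 2 = 1) {C : ℝ} (hK : ∀ N, (K N : ℝ) ≤ C * (N + 1)) {d : ℕ}
    (hd : 0 < d) (hdvd : ∀ s s', (d : ℤ) ∣ (F.n s : ℤ) - F.n s') (Δ : ℕ → ℤ)
    (hlaw : Tendsto (fun N => l1 (T (Δ N) * (unifLaw d * F.numLaw ^ N) -
      law (fun j => c N j ^ 2) fun j => ((j : ℕ) : ℤ))) atTop (𝓝 0)) {m : ℕ → ℕ}
    (hm : ∀ N : ℕ, m N = ⌈N * EoE φ + 2 * window N⌉₊) :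
    AsympConverts (fun N => tensorVec (numberState (K N) (c N)) (powVec eEPR (m N)))
      (fun N => tensorVec (powVec φ N) (powVec ancilla (m N))) := by
  have hE := F.eoE_nonneg hF
  have hYs : ∀ N, ∑ s, ((F.pow N).tensor (ofAncilla.pow (m N))).w s = 1 := fun N =>
    sum_w_tensor _ _ (sum_w_pow _ hF _) (sum_w_pow _ sum_w_ofAncilla _)
  have hc1' : ∀ N, ∑ s, (ofNumberState (K N) (c N) (hc N)).w s = 1 := hc1
  have hFs : ∀ N, ∑ s, ((ofNumberState (K N) (c N) (hc N)).tensor (ofEEPR.pow (m N))).w s = 1 :=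
    fun N => sum_w_tensor _ _ (hc1' N) (sum_w_pow _ sum_w_ofEEPR _)
  have ht : ∀ N, ∃ _ : ((F.pow N).tensor (ofAncilla.pow (m N))).S, True := fun N =>
    ⟨(exists_index _ (hYs N)).choose, trivial⟩
  choose t₀ _ using ht
  have hlaw' : ∀ N, l1 (T (Δ N) * (unifLaw d * ((F.pow N).tensor (ofAncilla.pow (m N))).numLaw) -
      ((ofNumberState (K N) (c N) (hc N)).tensor (ofEEPR.pow (m N))).numLaw) =
      l1 (T (Δ N) * (unifLaw d * F.numLaw ^ N) -
        law (fun j => c N j ^ 2) fun j => ((j : ℕ) : ℤ)) := by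
    intro N
    rw [numLaw_tensor_ofEEPR_pow, numLaw_tensor_ofAncilla_pow, ← mul_assoc, ← mul_assoc, ← sub_mul,
      l1_mul_T_pow, numLaw_pow, numLaw_ofNumberState, mul_assoc]
  have hC : 0 ≤ C := by
    have h1 := (Nat.cast_nonneg _).trans (hK 0)
    simpa using h1
  -- The E-EPRs make every source weight at most `2 ^ (-m)`, and `2 ^ (N E + window N)` vectors
  -- cover the target; the second `window N` in `m` is the margin. All numbers in the target are
  -- congruent modulo `d` to that of the reference vector `t₀`.
  refine asympConverts_of_cover
    (fun N => (ofNumberState (K N) (c N) (hc N)).tensor (ofEEPR.pow (m N)))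
    (fun N => (F.pow N).tensor (ofAncilla.pow (m N))) hFs hYs hd
    (fun N => ((F.pow N).tensor (ofAncilla.pow (m N))).n (t₀ N)) (fun N t _ => ?_) Δ
    (by simpa only [hlaw']) (α := fun N => 1 * 2 ^ (-(m N : ℝ)))
    (β := fun N => 2 ^ (N * EoE φ + window N) * 1) (fun N => by positivity)
    (fun N => (upperTail_of_le _ (w_le_one _ (hc1' N))).tensor _ (sum_w_pow _ sum_w_ofEEPR _)
      (by positivity) fun t => (w_ofEEPR_pow _ t).le)
    (fun N => (F.cover_pow hw hF N).tensor _ (sum_w_pow _ sum_w_ofAncilla _)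
      (card_ofAncilla_pow _).le) tendsto_const_nhds (F.tendsto_atypical hF) (C + 2 * EoE φ + 7)
    (Eventually.of_forall fun N => ?_) (Eventually.of_forall fun N => ?_)
  · obtain ⟨s, u⟩ := t
    obtain ⟨s', u'⟩ := t₀ N
    have hu : u = u' := funext fun i => rfl
    subst hu
    have h1 : ∀ r : Fin N → F.S, ((((F.pow N).tensor (ofAncilla.pow (m N))).n (r, u) : ℕ) : ℤ) =
        ∑ i, (F.n (r i) : ℤ) + (ofAncilla.pow (m N)).n u := fun r => by
      rw [← Nat.cast_sum, ← Nat.cast_add]; rfl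
    erw [h1 s, h1 s']
    rw [add_sub_add_right_eq_sub, ← Finset.sum_sub_distrib]
    exact Finset.dvd_sum fun i _ => hdvd _ _
  · have h1 : (m N : ℝ) ≤ N * EoE φ + 2 * window N + 1 := by
      rw [hm]
      have := window_nonneg N
      exact (Nat.ceil_lt_add_one (by positivity)).le
    push_cast
    nlinarith [hK N, h1, Nat.cast_nonneg (α := ℝ) N, window_le N]
  · have h1 : N * EoE φ + 2 * window N ≤ m N := by rw [hm]; exact Nat.le_ceil _
    have h2 : (2 : ℝ) ^ (-(m N : ℝ)) * 2 ^ (N * EoE φ + window N) ≤ 2 ^ (-window N) :=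
      two_rpow_mul_le (by linarith)
    simp only [one_mul, mul_one]
    refine h2.trans (le_mul_of_one_le_left (by positivity) ?_)
    nlinarith [Nat.cast_nonneg (α := ℝ) N]

end dilute

section interconvert

variable {A B A' B' : LocalSystem} {φ : BiVec A B} {ψ : BiVec A' B'} {I J : ℕ}

/-- States with the same entropy of entanglement and the same superselection induced variance are
interconvertible with the help of few V-EPRs and E-EPRs. -/
theorem asympConverts_interconvert (F : Schmidt φ I) (hw : ∀ s, 0 < F.w s) (hF : ∑ s, F.w s = 1)
    (G : Schmidt ψ J) (hw' : ∀ s, 0 < G.w s) (hG : ∑ s, G.w s = 1) (hE : EoE ψ = EoE φ)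
    (hV : SiV ψ = SiV φ) {k l : ℕ → ℕ} (hk : Tendsto k atTop atTop) (hkN : ∀ N, k N ≤ N)
    (hl : ∀ N : ℕ, l N = ⌈3 * window N + k N⌉₊) :
    AsympConverts
      (fun N => tensorVec (tensorVec (powVec φ N) (powVec vEPR (k N))) (powVec eEPR (l N)))
      (fun N => tensorVec (tensorVec (powVec ψ N) (powVec vEPR (k N)))
        (powVec ancilla (l N))) := by
  obtain ⟨Δ, hΔ⟩ := F.exists_tendsto_gauss_mul hw hF k (Or.inl hk)
  obtain ⟨Δ', hΔ'⟩ := G.exists_tendsto_gauss_mul hw' hG k (Or.inl hk)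
  have hFs : ∀ N, ∑ s, (((F.pow N).tensor (ofVEPR.pow (k N))).tensor (ofEEPR.pow (l N))).w s = 1 :=
    fun N => sum_w_tensor _ _ (sum_w_tensor _ _ (sum_w_pow _ hF _) (sum_w_pow _ sum_w_ofVEPR _))
      (sum_w_pow _ sum_w_ofEEPR _)
  have hGs : ∀ N,
      ∑ s, (((G.pow N).tensor (ofVEPR.pow (k N))).tensor (ofAncilla.pow (l N))).w s = 1 :=
    fun N => sum_w_tensor _ _ (sum_w_tensor _ _ (sum_w_pow _ hG _) (sum_w_pow _ sum_w_ofVEPR _))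
      (sum_w_pow _ sum_w_ofAncilla _)
  -- The source has weights below `2 ^ (-(N E - window N) - l)` up to its tail, and the target is
  -- covered by `2 ^ (N E + window N + k)` vectors. Asking the product to be at most `2 ^ (-window
  -- N)` gives `l ≥ 3 * window N + k`. The number laws agree because, translated, both approach the
  -- same Gaussian convolved with the V-EPR law.
  refine asympConverts_of_cover
    (fun N => ((F.pow N).tensor (ofVEPR.pow (k N))).tensor (ofEEPR.pow (l N)))
    (fun N => ((G.pow N).tensor (ofVEPR.pow (k N))).tensor (ofAncilla.pow (l N))) hFs hGs one_pos
    (fun _ => 0) (fun N t _ => by simp) (fun N => Δ' N - Δ N)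
    (squeeze_zero (fun N => l1_nonneg _) (fun N => ?_) (by
      rw [← add_zero (0 : ℝ)]; exact hΔ'.add hΔ))
    (α := fun N => 2 ^ (-(N * EoE φ - window N)) * 1 * 2 ^ (-(l N : ℝ)))
    (β := fun N => 2 ^ (N * EoE ψ + window N) * 2 ^ (k N : ℝ) * 1) (fun N => by positivity)
    (fun N => ((F.upperTail_pow hw N).tensor _ (sum_w_pow _ sum_w_ofVEPR _) one_pos
      (w_le_one _ (sum_w_pow _ sum_w_ofVEPR _))).tensor _ (sum_w_pow _ sum_w_ofEEPR _)
      (by positivity) fun t => (w_ofEEPR_pow _ t).le)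
    (fun N => ((G.cover_pow hw' hG N).tensor _ (sum_w_pow _ sum_w_ofVEPR _)
      (card_ofVEPR_pow _).le).tensor _ (sum_w_pow _ sum_w_ofAncilla _) (card_ofAncilla_pow _).le)
    (F.tendsto_atypical hF) (G.tendsto_atypical hG) (I + 12) (Eventually.of_forall fun N => ?_)
    (Eventually.of_forall fun N => ?_)
  · simp only [numLaw_tensor, numLaw_pow, numLaw_ofEEPR, numLaw_ofAncilla, unifLaw_one,
      one_mul]
    rw [← mul_assoc, ← sub_mul, l1_mul_T_pow, ← l1_T_mul (Δ N), hV]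
    rw [mul_sub, ← mul_assoc, ← T_add, add_sub_cancel, l1_sub_comm (T (Δ N) * _)]
    exact l1_triangle _ _ _
  · have h1 : (l N : ℝ) ≤ 3 * window N + k N + 1 := by
      rw [hl]
      have := window_nonneg N
      exact (Nat.ceil_lt_add_one (by positivity)).le
    have h2 : (k N : ℝ) ≤ N := by exact_mod_cast hkN N
    push_cast
    nlinarith [h1, h2, Nat.cast_nonneg (α := ℝ) N, window_le N, Nat.cast_nonneg (α := ℝ) I]
  · have h1 : 3 * window N + k N ≤ l N := by rw [hl]; exact Nat.le_ceil _
    have h2 : (2 : ℝ) ^ (-(N * EoE φ - window N) + -(l N : ℝ)) *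
        2 ^ (N * EoE ψ + window N + k N) ≤ 2 ^ (-window N) :=
      two_rpow_mul_le (by rw [hE]; linarith)
    rw [Real.rpow_add two_pos, Real.rpow_add two_pos (N * EoE ψ + window N)] at h2
    simp only [mul_one]
    refine h2.trans (le_mul_of_one_le_left (by positivity) ?_)
    nlinarith [Nat.cast_nonneg (α := ℝ) N, Nat.cast_nonneg (α := ℝ) I]

end interconvert

end SSR

namespace SSR

open LocalSystem LaurentPolynomial Filter Schmidt

/-! ### The state with the exact particle number distribution -/

section exact

variable {A B : LocalSystem} {φ : BiVec A B} {I : ℕ} (F : Schmidt φ I)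

/-- The square roots of the particle number distribution. -/
def Schmidt.numCoeff (j : Fin (I + 1)) : ℝ := Real.sqrt (F.numLaw.coeff ((j : ℕ) : ℤ))

theorem Schmidt.numCoeff_sq (j : Fin (I + 1)) :
    F.numCoeff j ^ 2 = F.numLaw.coeff ((j : ℕ) : ℤ) :=
  Real.sq_sqrt (by rw [coeff_numLaw]; exact F.mass_nonneg _ _)

theorem Schmidt.numCoeff_nonneg (j : Fin (I + 1)) : 0 ≤ F.numCoeff j := Real.sqrt_nonneg _

theorem Schmidt.sum_numCoeff_sq_mul (g : ℕ → ℝ) :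
    ∑ j, F.numCoeff j ^ 2 * g j = ∑ s, F.w s * g (F.n s) := by
  simp only [numCoeff_sq]
  exact sum_coeff_law_mul F.w F.n I F.n_le g

theorem Schmidt.law_numCoeff_sq :
    law (fun j => F.numCoeff j ^ 2) (fun j => ((j : ℕ) : ℤ)) = F.numLaw := by
  simp only [numCoeff_sq]
  exact law_coeff_law F.w F.n I F.n_le

theorem Schmidt.siV_numberState_numCoeff : SiV (numberState I F.numCoeff) = SiV φ := by
  rw [(ofNumberState I F.numCoeff F.numCoeff_nonneg).siV_eq, F.siV_eq]
  have h1 := F.sum_numCoeff_sq_mul fun n => (n : ℝ)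
  have h2 := F.sum_numCoeff_sq_mul fun n => (n : ℝ) ^ 2
  rw [← h1, ← h2]
  rfl

theorem Schmidt.siV_powVec (hF : ∑ s, F.w s = 1) (N : ℕ) : SiV (powVec φ N) = N * SiV φ := by
  rw [(F.pow N).siV_eq, F.siV_eq]
  have h1 := sum_prod_pi_mul_sum F.w hF (fun s => (F.n s : ℝ)) N
  have h2 := sum_prod_pi_mul_sum_sq F.w hF (fun s => (F.n s : ℝ)) N
  have h3 : ∑ s, (F.pow N).w s * ((F.pow N).n s : ℝ) = N * ∑ s, F.w s * (F.n s : ℝ) := by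
    rw [← h1]
    simp only [← Nat.cast_sum]
    rfl
  have h4 : ∑ s, (F.pow N).w s * ((F.pow N).n s : ℝ) ^ 2 =
      N * (∑ s, F.w s * (F.n s : ℝ) ^ 2 - (∑ s, F.w s * (F.n s : ℝ)) ^ 2) +
        (N * ∑ s, F.w s * (F.n s : ℝ)) ^ 2 := by
    rw [← h2]
    simp only [← Nat.cast_sum]
    rfl
  rw [h3, h4]
  ring

theorem Schmidt.tendsto_sum_numCoeff_sq (hw : ∀ s, 0 < F.w s) (hF : ∑ s, F.w s = 1) (x : ℝ) :
    Tendsto (fun N : ℕ => ∑ j : Fin (I * N + 1),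
        if ((j : ℕ) : ℝ) - N * expect (numOpA A B) φ ≤ x * Real.sqrt N
          then (F.pow N).numCoeff j ^ 2 else 0) atTop
      (𝓝 ((ProbabilityTheory.gaussianReal 0 (Real.toNNReal (SiV φ / 4))).real (Set.Iic x))) := by
  have hsum : ∀ N : ℕ, (∑ j : Fin (I * N + 1),
      if ((j : ℕ) : ℝ) - N * expect (numOpA A B) φ ≤ x * Real.sqrt N
        then (F.pow N).numCoeff j ^ 2 else 0) =
      ∑ s : Fin N → F.S, if (∑ i, (F.n (s i) : ℝ)) ≤
        N * (∑ s, F.w s * (F.n s : ℝ)) + x * Real.sqrt N then ∏ i, F.w (s i) else 0 := by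
    intro N
    have h := (F.pow N).sum_numCoeff_sq_mul fun n =>
      if (n : ℝ) - N * expect (numOpA A B) φ ≤ x * Real.sqrt N then 1 else 0
    simp only [mul_ite, mul_one, mul_zero] at h
    rw [h, F.expect_numOpA]
    simp only [sub_le_iff_le_add', ← Nat.cast_sum]
    rfl
  simp only [hsum]
  rcases (F.siV_nonneg hF).eq_or_lt with h0 | hpos
  · obtain ⟨n₀, hn₀⟩ := F.exists_n_eq_of_siV_eq_zero hw hF h0.symm
    rw [← h0, zero_div, Real.toNNReal_zero, ProbabilityTheory.gaussianReal_zero_var]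
    refine tendsto_const_nhds.congr' ?_
    -- For `N = 0` the factor `√0` would make the condition true for negative `x` as well.
    filter_upwards [eventually_gt_atTop 0] with N hN
    have hN' : 0 < Real.sqrt N := Real.sqrt_pos.2 (by exact_mod_cast hN)
    simp only [hn₀, Finset.sum_const, Finset.card_univ, Fintype.card_fin, nsmul_eq_mul,
      ← Finset.sum_mul, hF, one_mul, le_add_iff_nonneg_right, mul_nonneg_iff_of_pos_right hN']
    by_cases hx : 0 ≤ x
    · simp only [hx, if_true, sum_prod_pi F.w hF]
      simp [MeasureTheory.measureReal_def, hx]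
    · simp [MeasureTheory.measureReal_def, hx]
  · exact tendsto_real_Iic_gaussian F.w F.w_nonneg hF (fun s => (F.n s : ℝ)) (SiV φ / 4)
      (by rw [F.siV_eq]; ring) (by positivity) x

end exact

/-! ### Variance of the Gaussian states and rates of the auxiliary resources. -/

theorem Schmidt.card_tensor {A B C D : LocalSystem} {φ : BiVec A B} {χ : BiVec C D} {I J : ℕ}
    (F : Schmidt φ I) (G : Schmidt χ J) :
    (Fintype.card (F.tensor G).S : ℝ) = Fintype.card F.S * Fintype.card G.S := by
  rw [← Nat.cast_mul]
  exact congrArg _ (Fintype.card_prod F.S G.S)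

theorem tendsto_siV_gaussState {V : ℝ} (hV : 0 ≤ V) :
    Tendsto (fun N : ℕ => SiV (gaussState N (N * V)) / N) atTop (𝓝 V) := by
  have h : ∀ N : ℕ, SiV (gaussState N (N * V)) =
      4 * (∑ j : Fin (N + 1), gaussCoeff N (N * V) j ^ 2 * ((j : ℕ) : ℝ) ^ 2 -
      (∑ j : Fin (N + 1), gaussCoeff N (N * V) j ^ 2 * ((j : ℕ) : ℝ)) ^ 2) := fun N =>
    (ofNumberState N (gaussCoeff N (N * V)) (gaussCoeff_nonneg N (N * V))).siV_eq
  simp only [h]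
  rcases hV.eq_or_lt with rfl | hpos
  · refine tendsto_const_nhds.congr fun N => ?_
    rw [mul_zero, sum_gaussCoeff_zero_sq_mul N fun j => (j : ℝ) ^ 2,
      sum_gaussCoeff_zero_sq_mul N fun j => (j : ℝ)]
    simp
  · exact tendsto_gauss_variance V hpos

theorem hasRate_sqrt : HasRate Nat.sqrt 0 := by
  have h : Tendsto (fun N : ℕ => 1 / Real.sqrt N) atTop (𝓝 0) :=
    Tendsto.const_div_atTop (Real.tendsto_sqrt_atTop.comp tendsto_natCast_atTop_atTop) _
  refine squeeze_zero (fun N => by positivity) (fun N => ?_) h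
  rw [← Real.sqrt_div_self']
  exact div_le_div_of_nonneg_right Real.nat_sqrt_le_real_sqrt (Nat.cast_nonneg _)

theorem tendsto_nat_sqrt_atTop : Tendsto Nat.sqrt atTop atTop :=
  tendsto_atTop.2 fun b => (eventually_ge_atTop (b * b)).mono fun _ hN => Nat.le_sqrt.2 hN

theorem hasRate_zero : HasRate (fun _ => 0) 0 := by
  simp [HasRate]

theorem tendsto_mul_add_window_div (E a : ℝ) {k : ℕ → ℕ} (hk : HasRate k 0) :
    Tendsto (fun N : ℕ => (N * E + a * window N - k N) / N) atTop (𝓝 E) := by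
  have h1 := ((tendsto_window_div.const_mul a).const_add E).sub hk
  simp only [mul_zero, sub_zero, add_zero] at h1
  refine h1.congr' ?_
  filter_upwards [eventually_gt_atTop 0] with N hN
  have hN' : (N : ℝ) ≠ 0 := by exact_mod_cast hN.ne'
  field_simp

end SSR

end

/-! ### The theorem. -/

open SSR in
theorem theorem2 {A B : LocalSystem} (φ : BiVec A B) (I : ℕ) (hφ : IsPureState φ I) :
    -- every state: number distribution that is Gaussian in the sense of the central limit theorem
    (∃ (c : ∀ N : ℕ, Fin (I * N + 1) → ℝ) (m m' : ℕ → ℕ),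
      (∀ N n, 0 ≤ c N n) ∧
      (∀ N, ∑ n, c N n ^ 2 = 1) ∧
      (∀ N, SiV (numberState (I * N) (c N)) = N * SiV φ) ∧
      (∀ x : ℝ, Filter.Tendsto
        (fun N : ℕ => ∑ n : Fin (I * N + 1),
          if ((n : ℕ) : ℝ) - N * expect (numOpA A B) φ ≤ x * Real.sqrt N then c N n ^ 2 else 0)
        Filter.atTop
        (𝓝 ((ProbabilityTheory.gaussianReal 0 (Real.toNNReal (SiV φ / 4))).real (Set.Iic x)))) ∧
      HasRate m (EoE φ) ∧ HasRate m' (EoE φ) ∧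
      AsympConverts
        (fun N => tensorVec (powVec φ N) (powVec ancilla (m N)))
        (fun N => tensorVec (numberState (I * N) (c N)) (powVec eEPR (m N))) ∧
      AsympConverts
        (fun N => tensorVec (numberState (I * N) (c N)) (powVec eEPR (m' N)))
        (fun N => tensorVec (powVec φ N) (powVec ancilla (m' N)))) ∧
    -- the explicit Gaussian state, which depends on `φ` only through the SiV; a periodic gap is
    -- removed by a vanishing fraction of V-EPRs, which are returned
    (Filter.Tendsto (fun N : ℕ => SiV (gaussState N (N * SiV φ)) / N) Filter.atTop (𝓝 (SiV φ)) ∧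
      ∃ m m' k : ℕ → ℕ,
        HasRate m (EoE φ) ∧ HasRate m' (EoE φ) ∧ HasRate k 0 ∧
        (¬ HasGap φ → ∀ N, k N = 0) ∧
        AsympConverts
          (fun N => tensorVec (tensorVec (powVec φ N) (powVec vEPR (k N)))
            (powVec ancilla (m N)))
          (fun N => tensorVec (tensorVec (gaussState N (N * SiV φ)) (powVec vEPR (k N)))
            (powVec eEPR (m N))) ∧
        AsympConverts
          (fun N => tensorVec (gaussState N (N * SiV φ)) (powVec eEPR (m' N)))
          (fun N => tensorVec (powVec φ N) (powVec ancilla (m' N)))) ∧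
    -- states with equal EoE and equal SiV are asymptotically interconvertible
    (∀ {A' B' : LocalSystem} (ψ : BiVec A' B') (I' : ℕ), IsPureState ψ I' →
      EoE ψ = EoE φ → SiV ψ = SiV φ →
      ∃ k l : ℕ → ℕ, HasRate k 0 ∧ HasRate l 0 ∧
        AsympConverts
          (fun N => tensorVec (tensorVec (powVec φ N) (powVec vEPR (k N))) (powVec eEPR (l N)))
          (fun N => tensorVec (tensorVec (powVec ψ N) (powVec vEPR (k N)))
            (powVec ancilla (l N))) ∧
        AsympConverts
          (fun N => tensorVec (tensorVec (powVec ψ N) (powVec vEPR (k N))) (powVec eEPR (l N)))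
          (fun N => tensorVec (tensorVec (powVec φ N) (powVec vEPR (k N)))
            (powVec ancilla (l N)))) := by
  classical
  obtain ⟨F, hw⟩ := exists_schmidt φ I hφ.total
  have hF := F.sum_w hφ
  have hE := F.eoE_nonneg hF
  have hFN : ∀ N, ∑ s, (F.pow N).w s = 1 := F.sum_w_pow hF
  have hN0 : ∀ N : ℕ, (0 : ℝ) ≤ N := fun N => Nat.cast_nonneg N
  have hI0 : (0 : ℝ) ≤ I := Nat.cast_nonneg I
  have hrate : HasRate (fun N : ℕ => ⌈N * EoE φ + 2 * window N⌉₊) (EoE φ) :=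
    hasRate_ceil hE (by simpa using tendsto_mul_add_window_div (EoE φ) 2 hasRate_zero)
  have hrate' : ∀ k : ℕ → ℕ, HasRate k 0 →
      HasRate (fun N : ℕ => ⌊N * EoE φ - 2 * window N - k N⌋₊) (EoE φ) := fun k hk =>
    hasRate_floor hE (by simpa [← sub_eq_add_neg] using tendsto_mul_add_window_div (EoE φ) (-2) hk)
  have hinj : ∀ (K : ℕ) (c : Fin (K + 1) → ℝ) (hc : ∀ j, 0 ≤ c j),
      Function.Injective (Schmidt.ofNumberState K c hc).n := fun K c hc i j h => Fin.ext h
  refine ⟨?_, ⟨tendsto_siV_gaussState (F.siV_nonneg hF), ?_⟩, ?_⟩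
  -- The register state is given exactly the number law of the `N` copies. Both law distances then
  -- vanish, with no translation and with `d = 1`.
  · have hc1 : ∀ N, ∑ j, (F.pow N).numCoeff j ^ 2 = 1 := fun N => by
      have := (F.pow N).sum_numCoeff_sq_mul fun _ => 1
      simpa [hFN] using this
    refine ⟨fun N => (F.pow N).numCoeff, _, _, fun N => (F.pow N).numCoeff_nonneg, hc1,
      fun N => by rw [Schmidt.siV_numberState_numCoeff, F.siV_powVec hF],
      F.tendsto_sum_numCoeff_sq hw hF, hrate' _ hasRate_zero, hrate, ?_, ?_⟩
    · refine asympConverts_concentrate (fun N => F.pow N)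
        (fun N => Schmidt.ofNumberState (I * N) _ (F.pow N).numCoeff_nonneg) hFN hc1 hE hasRate_zero
        (F.tendsto_atypical hF) (F.upperTail_pow hw) (C := I + 1) (fun N => ?_) (fun N => ?_)
        (fun _ => 0) ?_ (Or.inr fun N => hinj _ _ _) fun N => rfl
      · push_cast; nlinarith [hN0 N]
      · rw [Schmidt.card_ofNumberState]
        push_cast
        rw [Real.rpow_zero]
        nlinarith [hN0 N]
      · simp [Schmidt.numLaw_ofNumberState, Schmidt.law_numCoeff_sq, l1_zero]
    · refine asympConverts_dilute F hw hF (fun N => I * N) _ (fun N => (F.pow N).numCoeff_nonneg) hc1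
        (C := I) (fun N => ?_) one_pos (fun s s' => one_dvd _) (fun _ => 0) ?_ fun N => rfl
      · push_cast; nlinarith [hN0 N]
      · simp [Schmidt.law_numCoeff_sq, unifLaw_one, l1_zero, Schmidt.numLaw_pow]
  · obtain ⟨d, hd, -, hdvd, Δ, hΔ⟩ := F.exists_period hw hF
    obtain ⟨k, hkrate, hkN, hk0, hk⟩ : ∃ k : ℕ → ℕ, HasRate k 0 ∧ (∀ N, k N ≤ N) ∧
        (¬ HasGap φ → ∀ N, k N = 0) ∧ (Filter.Tendsto k Filter.atTop Filter.atTop ∨ ¬ HasGap φ) := by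
      -- With a gap, `⌊√N⌋` V-EPRs are enough: their number diverges, so they smooth the lattice,
      -- yet it is o(N).
      by_cases hgap : HasGap φ
      · exact ⟨Nat.sqrt, hasRate_sqrt, Nat.sqrt_le_self, fun h => absurd hgap h, Or.inl tendsto_nat_sqrt_atTop⟩
      · exact ⟨fun _ => 0, hasRate_zero, Nat.zero_le, fun _ _ => rfl, Or.inr hgap⟩
    obtain ⟨Δ', hΔ'⟩ := F.exists_tendsto_gauss_mul hw hF k hk
    have hc1 : ∀ N : ℕ, ∑ j, gaussCoeff N (N * SiV φ) j ^ 2 = 1 := fun N => sum_gaussCoeff_sq _ _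
    refine ⟨_, _, k, hrate' k hkrate, hrate, hkrate, hk0, ?_, ?_⟩
    · refine asympConverts_concentrate (fun N => (F.pow N).tensor (Schmidt.ofVEPR.pow (k N)))
        (fun N => (Schmidt.ofNumberState N _ (gaussCoeff_nonneg N (N * SiV φ))).tensor
          (Schmidt.ofVEPR.pow (k N)))
        (fun N => Schmidt.sum_w_tensor _ _ (hFN N) (Schmidt.sum_w_pow _ Schmidt.sum_w_ofVEPR _))
        (fun N => Schmidt.sum_w_tensor _ _ (hc1 N) (Schmidt.sum_w_pow _ Schmidt.sum_w_ofVEPR _))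
        hE hkrate (F.tendsto_atypical hF) (fun N => ?_) (C := I + 2) (fun N => ?_) (fun N => ?_)
        (fun N => -Δ' N) ?_ ?_ fun N => rfl
      · have := (F.upperTail_pow hw N).tensor (Schmidt.ofVEPR.pow (k N))
          (Schmidt.sum_w_pow _ Schmidt.sum_w_ofVEPR _) one_pos
          (Schmidt.w_le_one _ (Schmidt.sum_w_pow _ Schmidt.sum_w_ofVEPR _))
        rwa [mul_one] at this
      · have h1 : (k N : ℝ) ≤ N := by exact_mod_cast hkN N
        push_cast
        nlinarith [hN0 N]
      · rw [Schmidt.card_tensor, Schmidt.card_ofNumberState, Schmidt.card_ofVEPR_pow]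
        refine mul_le_mul_of_nonneg_right ?_ (by positivity)
        nlinarith [hN0 N]
      · refine hΔ'.congr fun N => ?_
        rw [Schmidt.numLaw_tensor, Schmidt.numLaw_tensor, Schmidt.numLaw_pow, Schmidt.numLaw_pow,
          Schmidt.numLaw_ofNumberState, l1_sub_comm, ← l1_T_mul (-Δ' N), mul_sub,
          ← mul_assoc (LaurentPolynomial.T _) (LaurentPolynomial.T _), ← LaurentPolynomial.T_add,
          neg_add_cancel, LaurentPolynomial.T_zero, one_mul]
        rfl
      · rcases hE.eq_or_lt with h0 | hpos
        · right
          intro N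
          have hkz := hk0 (F.not_hasGap_of_eoE_eq_zero hw hF h0.symm) N
          rintro ⟨s, u⟩ ⟨s', u'⟩ h
          have hu : u = u' := funext fun i => absurd (i.2.trans_eq hkz) (Nat.not_lt_zero _)
          subst hu
          exact congrArg (·, u) (hinj _ _ _ (Nat.add_right_cancel h))
        · exact Or.inl hpos
    -- The way back needs no V-EPRs: measuring the residue modulo `d` projects the Gaussian onto the
    -- lattice of `φ`.
    · exact asympConverts_dilute F hw hF (fun N => N) _ (fun N => gaussCoeff_nonneg N (N * SiV φ))
        hc1 (C := 1) (fun N => by linarith) hd hdvd Δ hΔ fun N => rfl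
  · intro A' B' ψ I' hψ hEψ hVψ
    obtain ⟨G, hw'⟩ := exists_schmidt ψ I' hψ.total
    have hG := G.sum_w hψ
    -- The V-EPRs are used whether or not gaps occur, so that both number laws are smoothed towards
    -- the same law.
    refine ⟨Nat.sqrt, fun N => ⌈3 * window N + Nat.sqrt N⌉₊, hasRate_sqrt, ?_, ?_, ?_⟩
    · refine hasRate_ceil le_rfl ?_
      have := (tendsto_window_div.const_mul 3).add hasRate_sqrt
      simp only [mul_zero, add_zero] at this
      refine this.congr fun N => ?_
      ring
    · exact asympConverts_interconvert F hw hF G hw' hG hEψ hVψ tendsto_nat_sqrt_atTop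
        Nat.sqrt_le_self fun N => rfl
    · exact asympConverts_interconvert G hw' hG F hw hF hEψ.symm hVψ.symm tendsto_nat_sqrt_atTop
        Nat.sqrt_le_self fun N => rfl
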